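/- **Setting.** Let $V=\coprod_{n\in\frac12\mathbb Z}V_{(n)}$ be a $\frac12\mathbb Z$-graded complex vector space with $\dim V_{(n)}<\infty$ for all $n$ and $V_{(n)}=0$ for $n$ sufficiently negative. Put $V^0=\coprod_{n\in\mathbb Z}V_{(n)}$, $V^1=\coprod_{n\in\mathbb Z+\frac12}V_{(n)}$, $V'=\coprod_n V_{(n)}^*$, $\overline V=\prod_n V_{(n)}=(V')^*$, let $\pi_n$ be the projection of $\overline V$ onto $V_{(n)}$, and let $L_V(0)v=nv$ for $v\in V_{(n)}$. Limits, derivatives and analyticity in $\overline V$ are meant weakly, i.e. after pairing with every $v'\in V'$; $L_V(0)$ extends to $\overline V$ componentwise, and an operator $A$ on $V$ is applied to $w\in\overline V$ by $Aw=\sum_n A\pi_n w$ (weakly convergent). Let $\mathbf 1\in V_{(0)}$, let $L_V(-1)$ be a linear operator on $V$, and let $\phi^i$ ($i\in I$) be analytic maps $\mathbb C^\times\to\operatorname{Hom}(V,\overline V)$. Assume: 1. For each $i$ there is $\operatorname{wt}\phi^i\in\frac12\mathbb Z$ with $[L_V(0),\phi^i(z)]=z\frac{d}{dz}\phi^i(z)+(\operatorname{wt}\phi^i)\phi^i(z)$.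 Hence $\phi^i(z)=\sum_{n\in\mathbb Z}\phi^i_nz^{-n-1}$, where $\phi^i_n:V\to V$ is homogeneous of weight $\operatorname{wt}\phi^i-n-1$. 2. $L_V(-1)\mathbf 1=0$ and $[L_V(-1),\phi^i(z)]=\frac{d}{dz}\phi^i(z)$. 3. $\lim_{z\to0}\phi^i(z)\mathbf 1=\phi^i_{-1}\mathbf 1$ exists and lies in $V^0$ or in $V^1$; put $|\phi^i|=0$ if it lies in $V^0$ and $|\phi^i|=1$ otherwise. 4. $V$ is spanned by the vectors $\phi^{i_1}_{n_1}\cdots\phi^{i_k}_{n_k}\mathbf 1$, $k\ge0$. 5. For $v'\in V'$, $v\in V$ and $i_1,\dots,i_k\in I$, the Laurent series $\langle v',\phi^{i_1}(z_1)\cdots\phi^{i_k}(z_k)v\rangle$ converges absolutely in the region $|z_1|>\cdots>|z_k|>0$ to a rational function $R(\langle v',\phi^{i_1}(z_1)\cdots\phi^{i_k}(z_k)v\rangle)$ whose only possible poles are $z_j=0$ and $z_j=z_l$ ($j\ne l$). The order of the pole $z_j=z_l$ is bounded independently of $v$, $v'$ and the $\phi^{i_n}$ with $n\ne j,l$, and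 the order of the pole $z_j=0$ is bounded independently of $v'$ and the $\phi^{i_n}$ with $n\neq j$. 6. $R(\langle v',\phi^{i_1}(z_1)\phi^{i_2}(z_2)v\rangle)=(-1)^{|\phi^{i_1}||\phi^{i_2}|}R(\langle v',\phi^{i_2}(z_2)\phi^{i_1}(z_1)v\rangle)$. **Definition.** A *grading-restricted vertex superalgebra* structure on $V$ with vacuum $\mathbf 1$ is an analytic map $Y:\mathbb C^\times\to\operatorname{Hom}(V\otimes V,\overline V)$, $z\mapsto Y(\cdot,z)\cdot$, such that ($V$ being grading-restricted as above): * $[L_V(0),Y(u,z)]=z\frac{d}{dz}Y(u,z)+Y(L_V(0)u,z)$; * $Y(\mathbf 1,z)=1_V$ and $\lim_{z\to0}Y(u,z)\mathbf 1=u$; * there is an operator $D$ on $V$ given by $Du=\lim_{z\to0}\frac{d}{dz}Y(u,z)\mathbf 1$, and $\frac{d}{dz}Y(u,z)=Y(Du,z)=[D,Y(u,z)]$; * (duality) for $u_1\in V^{|u_1|}$, $u_2\in V^{|u_2|}$, $v\in V$, $v'\in V'$, the series $\langle v',Y(u_1,z_1)Y(u_2,z_2)v\rangle$, $(-1)^{|u_1||u_2|}\langle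 v',Y(u_2,z_2)Y(u_1,z_1)v\rangle$, $\langle v',Y(Y(u_1,z_1-z_2)u_2,z_2)v\rangle$ (sums over the projections $\pi_m$ of the inner factor) converge absolutely in $|z_1|>|z_2|>0$, $|z_2|>|z_1|>0$, $|z_2|>|z_1-z_2|>0$, respectively, to a common rational function with possible poles only at $z_1=0$, $z_2=0$, $z_1=z_2$. It is a *grading-restricted vertex algebra* if $V^1=0$. It is *generated* by $S\subset V$ if $V$ is the only subspace that contains $\mathbf 1$ and $S$ and is closed under all products $(u,v)\mapsto u_nv$, where $Y(u,z)v=\sum_{n\in\mathbb Z}u_nv\,z^{-n-1}$. **Theorem.** The formula $$\langle v',Y_V(\phi^{i_1}_{m_1}\cdots\phi^{i_k}_{m_k}\mathbf 1,z)v\rangle=\operatorname{Res}_{\xi_1=0}\cdots\operatorname{Res}_{\xi_k=0}\,\xi_1^{m_1}\cdots\xi_k^{m_k}\,R(\langle v',\phi^{i_1}(\xi_1+z)\cdots\phi^{i_k}(\xi_k+z)v\rangle)$$ (for all $k\ge0$, $i_j\in I$, $m_j\in\mathbb Z$, $v\in V$, $v'\in V'$, $z\in\mathbb C^\times$; the residue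 in $\xi_k$ is taken first) gives a well-defined map $Y_V:\mathbb C^\times\to\operatorname{Hom}(V\otimes V,\overline V)$, and $(V,Y_V,\mathbf 1)$ is a grading-restricted vertex superalgebra (a grading-restricted vertex algebra if all $\operatorname{wt}\phi^i$ are integers), with $D=L_V(-1)$, generated by the $\phi^i_{-1}\mathbf 1$, $i\in I$, and with $Y_V(\phi^i_{-1}\mathbf 1,z)=\phi^i(z)$. It is the unique grading-restricted vertex superalgebra structure on $V$ with vacuum $\mathbf 1$ such that $Y(\phi^i_{-1}\mathbf 1,z)=\phi^i(z)$ for all $i\in I$. -/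

import Mathlib

open Filter Topology

noncomputable section

namespace VertexConstruction

universe u v

/-! Graded spaces. A `½ℤ`-graded complex vector space is given by the family `V : ℤ → Type` of its
homogeneous subspaces, where `V n` is the subspace of weight `n / 2`. -/

section Graded

variable (V : ℤ → Type u) [∀ n, AddCommGroup (V n)] [∀ n, Module ℂ (V n)]

/-- The graded space, the direct sum of its homogeneous subspaces. -/
abbrev Space : Type u := DirectSum ℤ V

/-- The algebraic completion, the product of the homogeneous subspaces. -/
abbrev Compl : Type u := (n : ℤ) → V n

/-- The graded dual, the direct sum of the duals of the homogeneous subspaces. -/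
abbrev GDual : Type u := DirectSum ℤ (fun n => Module.Dual ℂ (V n))

/-- Grading restriction: `V n = 0` for `n` sufficiently negative, and every `V n` is
finite-dimensional. -/
structure GradingRestricted : Prop where
  lower : ∃ N : ℤ, ∀ n < N, Subsingleton (V n)
  finite : ∀ n, FiniteDimensional ℂ (V n)

variable {V}

/-- The pairing `⟨v', w⟩ = ∑ n, v'ₙ (wₙ)` (a finite sum) of the graded dual with the completion. -/
def pair : GDual V →ₗ[ℂ] Compl V →ₗ[ℂ] ℂ :=
  DirectSum.toModule ℂ ℤ (Compl V →ₗ[ℂ] ℂ)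
    (fun n => LinearMap.lcomp ℂ ℂ (LinearMap.proj n : Compl V →ₗ[ℂ] V n))

/-- The inclusion of the graded space in its completion. -/
def incl : Space V →ₗ[ℂ] Compl V :=
  LinearMap.pi fun n => DirectSum.component ℂ ℤ V n

/-- The projection of the completion onto the `n`-th homogeneous subspace of the graded space. -/
def proj (n : ℤ) : Compl V →ₗ[ℂ] Space V :=
  (DirectSum.lof ℂ ℤ V n).comp (LinearMap.proj n)

/-- The vector of the graded space defined by an element `vac` of weight `0`. -/
def vacuum (vac : V 0) : Space V := DirectSum.lof ℂ ℤ V 0 vac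

/-- `L(0)` on the graded space: multiplication by the weight `n / 2` on `V n`. -/
def L0 : Space V →ₗ[ℂ] Space V :=
  DirectSum.toModule ℂ ℤ (Space V) fun n => ((n : ℂ) / 2) • DirectSum.lof ℂ ℤ V n

/-- The natural extension of `L(0)` to the completion. -/
def L0Compl : Compl V →ₗ[ℂ] Compl V :=
  LinearMap.pi fun n => ((n : ℂ) / 2) • LinearMap.proj n

/-- `v` has parity `p`: all its components have a weight in `ℤ` if `p = 0`, and in `ℤ + 1/2` if
`p = 1`. -/
def HasParity (p : Fin 2) (v : Space V) : Prop :=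
  ∀ n : ℤ, n % 2 ≠ ((p : ℕ) : ℤ) → v n = 0

/-- `A w = a` in the completion, where `A` is an operator on the graded space and `w` lies in the
completion: the series `∑ₙ A (πₙ w)` converges to `a` in the weak topology given by the graded
dual. -/
def ExtendsTo (A : Space V →ₗ[ℂ] Space V) (w a : Compl V) : Prop :=
  ∀ v' : GDual V, HasSum (fun n : ℤ => pair v' (incl (A (proj n w)))) (pair v' a)

/-- The map `F` from `ℂˣ` to the completion is analytic (in the weak topology). -/
def IsAnalytic (F : ℂ → Compl V) : Prop :=
  ∀ v' : GDual V, DifferentiableOn ℂ (fun z => pair v' (F z)) {0}ᶜ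

/-- The map `F` from `ℂˣ` to the completion has derivative `a` at `z` (in the weak topology). -/
def HasWeakDeriv (F : ℂ → Compl V) (a : Compl V) (z : ℂ) : Prop :=
  ∀ v' : GDual V, HasDerivAt (fun w => pair v' (F w)) (pair v' a) z

/-- The limit of `F z` for `z → 0`, `z ≠ 0`, is `a` (in the weak topology). -/
def HasLimitAtZero (F : ℂ → Compl V) (a : Compl V) : Prop :=
  ∀ v' : GDual V, Tendsto (fun z => pair v' (F z)) (𝓝[≠] 0) (𝓝 (pair v' a))

/-- The coefficient `φₙ` of the Laurent expansion `φ(z) = ∑ₙ φₙ z^{-n-1}` of a field `φ` of weight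
`w / 2`. It is homogeneous of weight `w / 2 - n - 1`, so on `V m` it is the component of that
weight of the value `φ1 = φ(1)`. -/
def mode (w : ℤ) (φ1 : Space V →ₗ[ℂ] Compl V) (n : ℤ) : Space V →ₗ[ℂ] Space V :=
  DirectSum.toModule ℂ ℤ (Space V) fun m =>
    (proj (m + w - 2 * n - 2)).comp (φ1.comp (DirectSum.lof ℂ ℤ V m))

end Graded

/-! Rational functions and residues. -/

/-- The points of `ℂᵏ` with nonzero and pairwise different coordinates. -/
def config (k : ℕ) : Set (Fin k → ℂ) := {z | (∀ j, z j ≠ 0) ∧ Function.Injective z}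

/-- The region `|z₁| > ⋯ > |zₖ| > 0`. -/
def region (k : ℕ) : Set (Fin k → ℂ) := {z | (∀ j, z j ≠ 0) ∧ StrictAnti fun j => ‖z j‖}

/-- The value at `z` of the rational function
`p(z) / (∏ⱼ zⱼ^(a j) * ∏_{j < l} (zⱼ - zₗ)^(b j l))`. -/
def ratFun {k : ℕ} (p : MvPolynomial (Fin k) ℂ) (a : Fin k → ℕ) (b : Fin k → Fin k → ℕ)
    (z : Fin k → ℂ) : ℂ :=
  MvPolynomial.eval z p /
    ((∏ j, z j ^ a j) * ∏ j, ∏ l ∈ Finset.Ioi j, (z j - z l) ^ b j l)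

/-- `f` is, on `config k`, a rational function whose only possible poles are `zⱼ = 0` and
`zⱼ = zₗ`. -/
def IsRational {k : ℕ} (f : (Fin k → ℂ) → ℂ) : Prop :=
  ∃ (p : MvPolynomial (Fin k) ℂ) (a : Fin k → ℕ) (b : Fin k → Fin k → ℕ),
    ∀ z ∈ config k, f z = ratFun p a b z

/-- The residue at `0` of a function with an isolated singularity at `0`, that is, the coefficient
of `ξ⁻¹` of its Laurent expansion in a small punctured disk: the (eventually constant) value of
`(2πi)⁻¹ ∮_{|ξ| = r} f(ξ) dξ` for small `r > 0`. -/
def residue (f : ℂ → ℂ) : ℂ :=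
  limUnder (𝓝[>] (0 : ℝ)) fun r => (2 * (Real.pi : ℂ) * Complex.I)⁻¹ * circleIntegral f 0 r

/-- The iterated residue `Res_{ξ₁ = 0} ⋯ Res_{ξₖ = 0} f(ξ₁, …, ξₖ)`; the residue in `ξₖ` is taken
first. -/
def iterResidue : (k : ℕ) → ((Fin k → ℂ) → ℂ) → ℂ
  | 0, f => f Fin.elim0
  | k + 1, f => residue fun ξ₁ => iterResidue k fun ξ => f (Fin.cons ξ₁ ξ)

/-! Grading-restricted vertex (super)algebras. -/

section Algebra

variable {V : ℤ → Type u} [∀ n, AddCommGroup (V n)] [∀ n, Module ℂ (V n)]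

/-- A grading-restricted vertex superalgebra structure `(V, Y, 𝟏)`. The map `Y` is only considered
on `ℂˣ`; its value at `0` is irrelevant. -/
structure IsVertexSuperalgebra (vac : V 0)
    (Y : ℂ → Space V →ₗ[ℂ] Space V →ₗ[ℂ] Compl V) : Prop where
  grading : GradingRestricted V
  analytic : ∀ u v, IsAnalytic fun z => Y z u v
  /-- `[L(0), Y(u, z)] = z (d/dz) Y(u, z) + Y(L(0) u, z)`. -/
  L0_bracket : ∀ u v, ∀ z : ℂ, z ≠ 0 → ∃ d : Compl V, HasWeakDeriv (fun w => Y w u v) d z ∧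
    L0Compl (Y z u v) - Y z u (L0 v) = z • d + Y z (L0 u) v
  identity : ∀ v, ∀ z : ℂ, z ≠ 0 → Y z (vacuum vac) v = incl v
  creation : ∀ u, HasLimitAtZero (fun z => Y z u (vacuum vac)) (incl u)
  /-- The operator `L(-1) u = lim_{z → 0} (d/dz) Y(u, z) 𝟏` exists on `V`, and
  `(d/dz) Y(u, z) = Y(L(-1) u, z) = [L(-1), Y(u, z)]`. -/
  derivative : ∃ D : Space V →ₗ[ℂ] Space V,
    (∀ u, ∃ dY : ℂ → Compl V,
      (∀ z : ℂ, z ≠ 0 → HasWeakDeriv (fun w => Y w u (vacuum vac)) (dY z) z) ∧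
        HasLimitAtZero dY (incl (D u))) ∧
    (∀ u v, ∀ z : ℂ, z ≠ 0 → HasWeakDeriv (fun w => Y w u v) (Y z (D u) v) z) ∧
    ∀ u v, ∀ z : ℂ, z ≠ 0 → ExtendsTo D (Y z u v) (Y z (D u) v + Y z u (D v))
  duality : ∀ (p₁ p₂ : Fin 2) (u₁ u₂ v : Space V) (v' : GDual V),
    HasParity p₁ u₁ → HasParity p₂ u₂ →
    ∃ f : (Fin 2 → ℂ) → ℂ, IsRational f ∧
      (∀ z₁ z₂ : ℂ, ‖z₂‖ < ‖z₁‖ → 0 < ‖z₂‖ →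
        HasSum (fun m : ℤ => pair v' (Y z₁ u₁ (proj m (Y z₂ u₂ v)))) (f ![z₁, z₂])) ∧
      (∀ z₁ z₂ : ℂ, ‖z₁‖ < ‖z₂‖ → 0 < ‖z₁‖ →
        HasSum (fun m : ℤ => (-1) ^ ((p₁ : ℕ) * (p₂ : ℕ)) *
          pair v' (Y z₂ u₂ (proj m (Y z₁ u₁ v)))) (f ![z₁, z₂])) ∧
      (∀ z₁ z₂ : ℂ, ‖z₁ - z₂‖ < ‖z₂‖ → 0 < ‖z₁ - z₂‖ →
        HasSum (fun m : ℤ => pair v' (Y z₂ (proj m (Y (z₁ - z₂) u₁ u₂)) v)) (f ![z₁, z₂]))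

/-- A grading-restricted vertex algebra: a superalgebra with zero odd part. -/
def IsVertexAlgebra (vac : V 0) (Y : ℂ → Space V →ₗ[ℂ] Space V →ₗ[ℂ] Compl V) : Prop :=
  IsVertexSuperalgebra vac Y ∧ ∀ n : ℤ, Odd n → Subsingleton (V n)

/-- The coefficient `uₙ v` of `z^{-n-1}` in `Y(u, z) v`, the field `Y(u, z)` having weight `a / 2`
for `u` in `V a`. -/
def vertexMode (Y : ℂ → Space V →ₗ[ℂ] Space V →ₗ[ℂ] Compl V) (n : ℤ) (u v : Space V) : Space V :=
  ∑ᶠ a : ℤ, mode a (Y 1 (proj a (incl u))) n v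

/-- The elements of `S` generate `(V, Y, 𝟏)`: the only subspace that contains `𝟏` and `S` and is
closed under all the products `uₙ v` is `V`. -/
def GeneratedBy (vac : V 0) (Y : ℂ → Space V →ₗ[ℂ] Space V →ₗ[ℂ] Compl V) (S : Set (Space V)) :
    Prop :=
  ∀ W : Submodule ℂ (Space V), vacuum vac ∈ W → S ⊆ W →
    (∀ u ∈ W, ∀ v ∈ W, ∀ n : ℤ, vertexMode Y n u v ∈ W) → W = ⊤

end Algebra

/-! Generating fields. -/

section Fields

variable {V : ℤ → Type u} [∀ n, AddCommGroup (V n)] [∀ n, Module ℂ (V n)] {I : Type v}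

/-- The operator `φ^{i₁}_{n₁} ⋯ φ^{iₖ}_{nₖ}`, where `φ^i` has weight `wt i / 2`. -/
def modeProd (φ : I → ℂ → Space V →ₗ[ℂ] Compl V) (wt : I → ℤ) {k : ℕ} (i : Fin k → I)
    (n : Fin k → ℤ) : Module.End ℂ (Space V) :=
  (List.ofFn fun j => (mode (wt (i j)) (φ (i j) 1) (n j) : Module.End ℂ (Space V))).prod

/-- The Laurent series `⟨v', φ^{i₁}(z₁) ⋯ φ^{iₖ}(zₖ) v⟩` converges absolutely to `s`. -/
def ProductHasSum (φ : I → ℂ → Space V →ₗ[ℂ] Compl V) (wt : I → ℤ) {k : ℕ} (i : Fin k → I)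
    (v' : GDual V) (v : Space V) (z : Fin k → ℂ) (s : ℂ) : Prop :=
  HasSum (fun n : Fin k → ℤ => pair v' (incl (modeProd φ wt i n v)) * ∏ j, z j ^ (-n j - 1)) s

open Classical in
/-- The rational function `R(⟨v', φ^{i₁}(z₁) ⋯ φ^{iₖ}(zₖ) v⟩)`, with poles only at `zⱼ = 0` and
`zⱼ = zₗ`, to which the series converges in the region `|z₁| > ⋯ > |zₖ| > 0`. It is unique as a
function on `config k`. -/
def correlator (φ : I → ℂ → Space V →ₗ[ℂ] Compl V) (wt : I → ℤ) {k : ℕ} (i : Fin k → I)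
    (v' : GDual V) (v : Space V) : (Fin k → ℂ) → ℂ :=
  if h : ∃ f : (Fin k → ℂ) → ℂ, IsRational f ∧
      ∀ z ∈ region k, ProductHasSum φ wt i v' v z (f z)
  then h.choose else 0

open Classical in
/-- The parity `|φ^i|`: it is `0` if `φ^i_{-1} 𝟏` is even, and `1` otherwise. -/
def fieldParity (φ : I → ℂ → Space V →ₗ[ℂ] Compl V) (wt : I → ℤ) (vac : V 0) (i : I) : ℕ :=
  if HasParity 0 (mode (wt i) (φ i 1) (-1) (vacuum vac)) then 0 else 1

/-- The conditions on the generating fields `φ^i`, which are maps from `ℂˣ` to `Hom(V, V̄)` (their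
values at `0` are irrelevant), with weights `wt i / 2`, the operator `D = L(-1)` on `V`, and the
vacuum. -/
structure GeneratingFields (vac : V 0) (φ : I → ℂ → Space V →ₗ[ℂ] Compl V) (wt : I → ℤ)
    (D : Space V →ₗ[ℂ] Space V) : Prop where
  grading : GradingRestricted V
  analytic : ∀ i v, IsAnalytic fun z => φ i z v
  /-- `[L(0), φ^i(z)] = z (d/dz) φ^i(z) + (wt i / 2) φ^i(z)`. -/
  L0_bracket : ∀ i v, ∀ z : ℂ, z ≠ 0 → ∃ d : Compl V, HasWeakDeriv (fun w => φ i w v) d z ∧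
    L0Compl (φ i z v) - φ i z (L0 v) = z • d + ((wt i : ℂ) / 2) • φ i z v
  D_vacuum : D (vacuum vac) = 0
  /-- `[D, φ^i(z)] = (d/dz) φ^i(z)`. -/
  D_bracket : ∀ i v, ∀ z : ℂ, z ≠ 0 → ∃ d : Compl V, HasWeakDeriv (fun w => φ i w v) d z ∧
    ExtendsTo D (φ i z v) (d + φ i z (D v))
  creation : ∀ i, ∃ u : Space V, (HasParity 0 u ∨ HasParity 1 u) ∧
    HasLimitAtZero (fun z => φ i z (vacuum vac)) (incl u)
  spanning : Submodule.span ℂ {x : Space V | ∃ (k : ℕ) (i : Fin k → I) (n : Fin k → ℤ),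
    x = modeProd φ wt i n (vacuum vac)} = ⊤
  /-- The products converge to rational functions. The order of the pole `zⱼ = zₗ` is bounded
  independently of `v`, `v'` and the fields at the other places, and the order of the pole
  `zⱼ = 0` is bounded independently of `v'` and the fields at the other places. -/
  rationality : ∀ k : ℕ, ∃ (M : Fin k → I → Space V → ℕ) (N : Fin k → Fin k → I → I → ℕ),
    ∀ (i : Fin k → I) (v' : GDual V) (v : Space V), ∃ p : MvPolynomial (Fin k) ℂ,
      ∀ z ∈ region k, ProductHasSum φ wt i v' v z
        (ratFun p (fun j => M j (i j) v) (fun j l => N j l (i j) (i l)) z)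
  commutativity : ∀ (i₁ i₂ : I) (v' : GDual V) (v : Space V) (z₁ z₂ : ℂ),
    z₁ ≠ 0 → z₂ ≠ 0 → z₁ ≠ z₂ →
    correlator φ wt ![i₁, i₂] v' v ![z₁, z₂] =
      (-1) ^ (fieldParity φ wt vac i₁ * fieldParity φ wt vac i₂) *
        correlator φ wt ![i₂, i₁] v' v ![z₂, z₁]

/-- The formula that defines the vertex operator map:
`⟨v', Y(φ^{i₁}_{m₁} ⋯ φ^{iₖ}_{mₖ} 𝟏, z) v⟩ =
Res_{ξ₁ = 0} ⋯ Res_{ξₖ = 0} ξ₁^{m₁} ⋯ ξₖ^{mₖ} R(⟨v', φ^{i₁}(ξ₁ + z) ⋯ φ^{iₖ}(ξₖ + z) v⟩)`. -/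
def ResidueFormula (vac : V 0) (φ : I → ℂ → Space V →ₗ[ℂ] Compl V) (wt : I → ℤ)
    (Y : ℂ → Space V →ₗ[ℂ] Space V →ₗ[ℂ] Compl V) : Prop :=
  ∀ (k : ℕ) (i : Fin k → I) (m : Fin k → ℤ) (v' : GDual V) (v : Space V) (z : ℂ), z ≠ 0 →
    pair v' (Y z (modeProd φ wt i m (vacuum vac)) v) =
      iterResidue k fun ξ => (∏ j, ξ j ^ m j) * correlator φ wt i v' v fun j => ξ j + z

end Fields

end VertexConstruction

end

noncomputable section
set_option linter.unusedSectionVars false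

namespace VertexConstruction

universe u v

/-! ### Residues of absolutely convergent series of monomials. -/

section Residues

/-! The structure is built from modes, and the residue formula is proved for it afterwards. The
bracket with L(0) is an Euler equation, so the matrix coefficients of a generating field are Laurent
polynomials (`eq_fieldAt`) and the field amounts to a sequence of homogeneous operators φ_n on V.
The pole at z₁ = z₂ of a correlator of two fields has an order bounded by some N that depends only
on the two fields. Multiplied by (z₁ - z₂)^N the correlator has a single Laurent expansion, valid
for |z₁| > |z₂| and for |z₁| < |z₂|, and so commutativity becomes locality: (z₁ - z₂)^N φ^i(z₁)
φ^j(z₂) and (z₁ - z₂)^N φ^j(z₂) φ^i(z₁) agree up to sign as formal series (`modes_loc`).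

Formal calculus then yields the state-field correspondence. The n-th product of two mutually local
fields a, b is again covariant under L(-1), it is local with every field with which a and b are
local (Dong's lemma, `Loc.fieldProd`), and it creates a_n b_{-1} 𝟏 from the vacuum. Hence every
homogeneous vector is created by a field local with the generators (`exists_field`). There is only
one such field of the given weight (Goddard's theorem, `eq_zero_of_mem`): if all modes of a kill the
vacuum, locality makes them kill all vectors φ^{i₁}_{n₁} ⋯ φ^{iₖ}_{nₖ} 𝟏, and these span V. This
defines Y (`vertexMap`), and by uniqueness the field of x_n y is the n-th product of the fields of x
and y (`state_prod`).

For duality, the matrix coefficients of (z₁ - z₂)^N Y(u₁, z₁) Y(u₂, z₂) form a Laurent polynomial X,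
because of locality and homogeneity. The common rational function is X / (z₁ - z₂)^N. Its geometric
expansions are the two products, and the Taylor expansion of X in z₁ at z₂ gives the iterate, since
the Taylor coefficients are n-th products (`exists_twoPoint`).

The residue formula follows by induction on k (`iterResidue_eq`). Put w = ξ₁ + z and u = φ^{i₂}_{m₂}
⋯ φ^{iₖ}_{mₖ} 𝟏. The residues in ξ₂, …, ξₖ leave a function of w that for |w| > |z| is the two-point
function of φ^{i₁}(w) and Y(u, z). Both are holomorphic off 0 and z, so they agree near w = z, where
associativity expands them in powers of w - z with coefficients given by Y(φ^{i₁}_n u, z).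
Uniqueness has the same source: duality determines Y(φ^i_n u, z) from φ^i and Y(u, z)
(`eq_vertexMap`). -/

theorem hasSum_circleIntegral {T : Type*} [Countable T] {w : T → ℂ} {e : T → ℤ} {g : ℂ → ℂ}
    {r : ℝ} (hr : 0 < r) (h : ∀ x, ‖x‖ = r → HasSum (fun t => w t * x ^ e t) (g x)) :
    HasSum (fun t => if e t = -1 then w t else 0)
      ((2 * (Real.pi : ℂ) * Complex.I)⁻¹ * circleIntegral g 0 r) := by
  have hnorm : ∀ θ, ‖circleMap 0 r θ‖ = r := fun θ => by simp [abs_of_pos hr]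
  have h2 : HasSum (fun t => circleIntegral (fun x => w t * x ^ e t) 0 r)
      (circleIntegral g 0 r) := by
    have hcont : ∀ t, Continuous fun θ : ℝ =>
        deriv (circleMap 0 r) θ • (w t * circleMap 0 r θ ^ e t) := by
      intro t
      have : Continuous fun θ : ℝ => circleMap 0 r θ ^ e t :=
        (continuous_circleMap 0 r).zpow₀ _ fun θ => Or.inl (by
          intro h0; have := hnorm θ; rw [h0] at this; simp at this; exact hr.ne this)
      simp only [deriv_circleMap, smul_eq_mul]
      exact ((continuous_circleMap 0 r).mul continuous_const).mul (continuous_const.mul this)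
    -- On the circle the norm of each term is constant, so the terms at x = r serve as the
    -- dominating series.
    have hs : Summable fun t => r * ‖w t * (r : ℂ) ^ e t‖ :=
      ((h r (by simp [abs_of_pos hr])).summable.norm).mul_left r
    have key : ∀ θ : ℝ, ∀ t, ‖deriv (circleMap 0 r) θ • (w t * circleMap 0 r θ ^ e t)‖ =
        r * ‖w t * (r : ℂ) ^ e t‖ := by
      intro θ t
      simp [deriv_circleMap, abs_of_pos hr]
    have := intervalIntegral.hasSum_integral_of_dominated_convergence
      (μ := MeasureTheory.volume) (a := 0) (b := 2 * Real.pi)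
      (F := fun t (θ : ℝ) => deriv (circleMap 0 r) θ • (w t * circleMap 0 r θ ^ e t))
      (f := fun θ => deriv (circleMap 0 r) θ • g (circleMap 0 r θ))
      (fun t _ => r * ‖w t * (r : ℂ) ^ e t‖)
      (fun t => (hcont t).aestronglyMeasurable)
      (fun t => Eventually.of_forall fun θ _ => (key θ t).le)
      (Eventually.of_forall fun θ _ => hs)
      (by simp)
      (Eventually.of_forall fun θ _ => by
        simpa only [smul_eq_mul] using (h _ (hnorm θ)).mul_left (deriv (circleMap 0 r) θ))
    exact this
  have h3 := h2.mul_left (2 * (Real.pi : ℂ) * Complex.I)⁻¹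
  refine h3.congr_fun ?_ 
  intro t
  have hpi : (2 * (Real.pi : ℂ) * Complex.I) ≠ 0 := by simp [Real.pi_ne_zero]
  rw [circleIntegral.integral_const_mul]
  split_ifs with ht
  · have := circleIntegral.integral_sub_center_inv 0 hr.ne'
    simp only [sub_zero] at this
    simp only [ht, zpow_neg, zpow_one, this]
    field_simp
  · have := circleIntegral.integral_sub_zpow_of_ne ht 0 0 r
    simp only [sub_zero] at this
    simp [this]

/-- The circle integrals have the same value for all radii below `ρ`, so the limit that defines
`residue` is attained. Exponents may repeat in `e`, so the residue is a sum over all terms of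
exponent -1. -/
theorem hasSum_residue {T : Type*} [Countable T] {w : T → ℂ} {e : T → ℤ} {g : ℂ → ℂ}
    {ρ : ℝ} (hρ : 0 < ρ) (h : ∀ x, x ≠ 0 → ‖x‖ < ρ → HasSum (fun t => w t * x ^ e t) (g x)) :
    HasSum (fun t => if e t = -1 then w t else 0) (residue g) := by
  have key : ∀ r, 0 < r → r < ρ → HasSum (fun t => if e t = -1 then w t else 0)
      ((2 * (Real.pi : ℂ) * Complex.I)⁻¹ * circleIntegral g 0 r) := fun r h0 h1 =>
    hasSum_circleIntegral h0 fun x hx => h x (by rintro rfl; simp at hx; exact h0.ne hx) (hx ▸ h1)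
  have : residue g = ∑' t, if e t = -1 then w t else 0 := by
    apply Tendsto.limUnder_eq
    refine tendsto_const_nhds.congr' ?_
    filter_upwards [Ioo_mem_nhdsGT hρ] with r hr
    exact (key r hr.1 hr.2).tsum_eq
  rw [this]
  exact (key (ρ / 2) (by linarith) (by linarith)).summable.hasSum

theorem cons_mem_region {k : ℕ} {x : ℂ} {ξ : Fin k → ℂ} (hx : x ≠ 0) (hξ : ξ ∈ region k)
    (h : ∀ j, ‖ξ j‖ < ‖x‖) : (Fin.cons x ξ : Fin (k + 1) → ℂ) ∈ region (k + 1) := by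
  refine ⟨fun j => ?_, ?_⟩
  · refine Fin.cases ?_ (fun j => ?_) j
    · simpa using hx
    · simpa using hξ.1 j
  · intro a b
    refine Fin.cases ?_ (fun a => ?_) a <;> refine Fin.cases ?_ (fun b => ?_) b
    · simp
    · simpa using h b
    · simp
    · simpa using fun hab => hξ.2 hab

theorem region_subset_config (k : ℕ) : region k ⊆ config k := fun _ hz =>
  ⟨hz.1, fun _ _ hab => hz.2.injective (congrArg norm hab)⟩

/-- Induction on `k`: with the outer variable x fixed, the inner residues only involve ξ with all ‖ξ
j‖ < ‖x‖, and these points together with x lie in the region. Taking the residue in the last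
variable first thus matches the ordering of the moduli. -/
theorem hasSum_iterResidue {k : ℕ} {T : Type*} [Countable T] {w : T → ℂ} {e : T → Fin k → ℤ}
    {f : (Fin k → ℂ) → ℂ} {ρ : ℝ} (hρ : 0 < ρ)
    (h : ∀ ξ ∈ region k, (∀ j, ‖ξ j‖ < ρ) → HasSum (fun t => w t * ∏ j, ξ j ^ e t j) (f ξ)) :
    HasSum (fun t => if ∀ j, e t j = -1 then w t else 0) (iterResidue k f) := by
  induction k generalizing ρ w with
  | zero =>
    simpa [iterResidue] using h Fin.elim0 ⟨fun j => j.elim0, fun j => j.elim0⟩ fun j => j.elim0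
  | succ k ih =>
    have h1 : ∀ x : ℂ, x ≠ 0 → ‖x‖ < ρ → HasSum
        (fun t => (if ∀ j : Fin k, e t j.succ = -1 then w t else 0) * x ^ e t 0)
        (iterResidue k fun ξ => f (Fin.cons x ξ)) := by
      intro x hx hxρ
      have := ih (w := fun t => w t * x ^ e t 0) (e := fun t j => e t j.succ)
        (f := fun ξ => f (Fin.cons x ξ)) (norm_pos_iff.2 hx) (fun ξ hξ hb => by
          have := h (Fin.cons x ξ) (cons_mem_region hx hξ hb) (fun j => by
            refine Fin.cases ?_ (fun j => ?_) j
            · simpa using hxρ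
            · simpa using (hb j).trans hxρ)
          simpa [Fin.prod_univ_succ, mul_assoc] using this)
      refine this.congr_fun fun t => ?_
      split_ifs <;> simp
    have h2 := hasSum_residue hρ h1
    refine h2.congr_fun fun t => ?_
    simp only [Fin.forall_fin_succ]
    split_ifs <;> simp_all

end Residues

/-! ### Rational functions on configurations of points. -/

section Rational

variable {k : ℕ}

theorem ratFun_den_ne_zero (a : Fin k → ℕ) (b : Fin k → Fin k → ℕ) {z : Fin k → ℂ}
    (hz : z ∈ config k) :
    (∏ j, z j ^ a j) * ∏ j, ∏ l ∈ Finset.Ioi j, (z j - z l) ^ b j l ≠ 0 := by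
  refine mul_ne_zero (Finset.prod_ne_zero_iff.2 fun j _ => pow_ne_zero _ (hz.1 j))
    (Finset.prod_ne_zero_iff.2 fun j _ => Finset.prod_ne_zero_iff.2 fun l hl =>
      pow_ne_zero _ (sub_ne_zero.2 fun h => ?_))
  exact (Finset.mem_Ioi.1 hl).ne (hz.2 h)

/-- The denominator of `ratFun`, as a polynomial. -/
def denPoly (a : Fin k → ℕ) (b : Fin k → Fin k → ℕ) : MvPolynomial (Fin k) ℂ :=
  (∏ j, MvPolynomial.X j ^ a j) *
    ∏ j, ∏ l ∈ Finset.Ioi j, (MvPolynomial.X j - MvPolynomial.X l) ^ b j l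

theorem ratFun_eq (p : MvPolynomial (Fin k) ℂ) (a : Fin k → ℕ) (b : Fin k → Fin k → ℕ)
    (z : Fin k → ℂ) :
    ratFun p a b z = MvPolynomial.eval z p / MvPolynomial.eval z (denPoly a b) := by
  simp [ratFun, denPoly]

theorem eval_denPoly_ne_zero (a : Fin k → ℕ) (b : Fin k → Fin k → ℕ) {z : Fin k → ℂ}
    (hz : z ∈ config k) : MvPolynomial.eval z (denPoly a b) ≠ 0 := by
  simpa [denPoly, MvPolynomial.eval_prod] using ratFun_den_ne_zero a b hz

theorem denPoly_add (a a' : Fin k → ℕ) (b b' : Fin k → Fin k → ℕ) :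
    denPoly (a + a') (b + b') = denPoly a b * denPoly a' b' := by
  simp only [denPoly, Pi.add_apply, pow_add, Finset.prod_mul_distrib]
  ring

theorem isRational_iff {f : (Fin k → ℂ) → ℂ} : IsRational f ↔
    ∃ (p : MvPolynomial (Fin k) ℂ) (a : Fin k → ℕ) (b : Fin k → Fin k → ℕ),
      ∀ z ∈ config k, f z = MvPolynomial.eval z p / MvPolynomial.eval z (denPoly a b) := by
  simp only [IsRational, ratFun_eq]

theorem IsRational.congr {f g : (Fin k → ℂ) → ℂ} (hf : IsRational f)
    (h : ∀ z ∈ config k, g z = f z) : IsRational g := by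
  obtain ⟨p, a, b, hp⟩ := hf
  exact ⟨p, a, b, fun z hz => (h z hz).trans (hp z hz)⟩

theorem isRational_ratFun (p : MvPolynomial (Fin k) ℂ) (a : Fin k → ℕ) (b : Fin k → Fin k → ℕ) :
    IsRational (ratFun p a b) := ⟨p, a, b, fun _ _ => rfl⟩

theorem isRational_eval (p : MvPolynomial (Fin k) ℂ) :
    IsRational fun z => MvPolynomial.eval z p :=
  ⟨p, 0, 0, fun z _ => by simp [ratFun]⟩

theorem isRational_const (c : ℂ) : IsRational fun _ : Fin k → ℂ => c :=
  (isRational_eval (MvPolynomial.C c)).congr fun z _ => by simp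

theorem isRational_coord (j : Fin k) : IsRational fun z : Fin k → ℂ => z j :=
  (isRational_eval (MvPolynomial.X j)).congr fun z _ => by simp

theorem IsRational.add {f g : (Fin k → ℂ) → ℂ} (hf : IsRational f) (hg : IsRational g) :
    IsRational fun z => f z + g z := by
  obtain ⟨p, a, b, hp⟩ := isRational_iff.1 hf
  obtain ⟨q, a', b', hq⟩ := isRational_iff.1 hg
  refine isRational_iff.2 ⟨p * denPoly a' b' + q * denPoly a b, a + a', b + b', fun z hz => ?_⟩
  have h1 := eval_denPoly_ne_zero a b hz
  have h2 := eval_denPoly_ne_zero a' b' hz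
  rw [hp z hz, hq z hz, denPoly_add]
  simp only [map_add, map_mul]
  field_simp

theorem IsRational.mul {f g : (Fin k → ℂ) → ℂ} (hf : IsRational f) (hg : IsRational g) :
    IsRational fun z => f z * g z := by
  obtain ⟨p, a, b, hp⟩ := isRational_iff.1 hf
  obtain ⟨q, a', b', hq⟩ := isRational_iff.1 hg
  refine isRational_iff.2 ⟨p * q, a + a', b + b', fun z hz => ?_⟩
  rw [hp z hz, hq z hz, denPoly_add]
  simp only [map_mul, div_mul_div_comm]

theorem IsRational.sum {ι : Type*} (s : Finset ι) {f : ι → (Fin k → ℂ) → ℂ}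
    (hf : ∀ i ∈ s, IsRational (f i)) : IsRational fun z => ∑ i ∈ s, f i z := by
  classical
  induction s using Finset.induction_on with
  | empty => simpa using isRational_const (k := k) 0
  | insert i s hi ih =>
    simp only [Finset.sum_insert hi]
    exact (hf i (by simp)).add (ih fun j hj => hf j (by simp [hj]))

theorem IsRational.pow {f : (Fin k → ℂ) → ℂ} (hf : IsRational f) (n : ℕ) :
    IsRational fun z => f z ^ n := by
  induction n with
  | zero => simpa using isRational_const (k := k) 1
  | succ n ih => simpa only [pow_succ] using ih.mul hf

theorem isRational_coord_inv (j : Fin k) : IsRational fun z : Fin k → ℂ => (z j)⁻¹ := by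
  refine ⟨1, Pi.single j 1, 0, fun z _ => ?_⟩
  have : ∏ i, z i ^ (Pi.single j 1 : Fin k → ℕ) i = z j := by
    rw [Finset.prod_eq_single j] <;> simp +contextual
  simp [ratFun, this]

theorem isRational_coord_zpow (j : Fin k) (n : ℤ) : IsRational fun z : Fin k → ℂ => z j ^ n := by
  obtain ⟨m, rfl | rfl⟩ := n.eq_nat_or_neg
  · simpa using (isRational_coord j).pow m
  · simpa using (isRational_coord_inv j).pow m

theorem isRational_sub_inv {j l : Fin k} (h : j < l) :
    IsRational fun z : Fin k → ℂ => (z j - z l)⁻¹ := by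
  refine ⟨1, 0, fun j' l' => if j' = j ∧ l' = l then 1 else 0, fun z _ => ?_⟩
  have : ∏ i, ∏ m ∈ Finset.Ioi i, (z i - z m) ^ (if i = j ∧ m = l then 1 else 0) = z j - z l := by
    rw [Finset.prod_eq_single j]
    · rw [Finset.prod_eq_single l] <;> simp +contextual [h]
    · intro i _ hi
      simp [hi]
    · simp
  simp only [ratFun, map_one, Pi.zero_apply, pow_zero, Finset.prod_const_one, one_mul, this, one_div]

/-- The region contains a product of infinite sets, namely real intervals that move down as j grows,
and a polynomial is determined by its values on such a product. -/
theorem eval_eq_of_region {p q : MvPolynomial (Fin k) ℂ}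
    (h : ∀ z ∈ region k, MvPolynomial.eval z p = MvPolynomial.eval z q) : p = q := by
  refine MvPolynomial.funext_set
    (fun j : Fin k => (fun x : ℝ => (x : ℂ)) '' Set.Ioo ((k : ℝ) - j) ((k : ℝ) - j + 1)) ?_ ?_
  · intro j
    refine Set.Infinite.image (fun x _ y _ hxy => by simpa using hxy) ?_
    exact Set.Ioo_infinite (by linarith)
  · intro z hz
    refine h z ⟨fun j => ?_, fun i j hij => ?_⟩
    · obtain ⟨x, hx, hxz⟩ := hz j trivial
      have : (j : ℝ) < k := by exact_mod_cast j.2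
      rw [← hxz]
      have : x ≠ 0 := by have := hx.1; intro h0; linarith
      simpa using this
    · obtain ⟨x, hx, hxz⟩ := hz i trivial
      obtain ⟨y, hy, hyz⟩ := hz j trivial
      have hj : (j : ℝ) + 1 ≤ k := by exact_mod_cast j.2
      have hi : (i : ℝ) + 1 ≤ j := by exact_mod_cast hij
      have h1 := hx.1; have h2 := hx.2; have h3 := hy.1; have h4 := hy.2
      simp only [← hxz, ← hyz, Complex.norm_real]
      rw [Real.norm_of_nonneg (by linarith), Real.norm_of_nonneg (by linarith)]
      linarith

/-- Clearing denominators reduces this to polynomials. It makes `correlator` on `config k`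
independent of the choice in its definition. -/
theorem IsRational.eq_of_region {f g : (Fin k → ℂ) → ℂ} (hf : IsRational f) (hg : IsRational g)
    (h : ∀ z ∈ region k, f z = g z) : ∀ z ∈ config k, f z = g z := by
  obtain ⟨p, a, b, hp⟩ := isRational_iff.1 hf
  obtain ⟨q, a', b', hq⟩ := isRational_iff.1 hg
  have key : p * denPoly a' b' = q * denPoly a b := by
    refine eval_eq_of_region fun z hz => ?_
    have hz' := region_subset_config k hz
    have := h z hz
    rw [hp z hz', hq z hz', div_eq_div_iff (eval_denPoly_ne_zero a b hz')
      (eval_denPoly_ne_zero a' b' hz')] at this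
    simpa using this
  intro z hz
  rw [hp z hz, hq z hz, div_eq_div_iff (eval_denPoly_ne_zero a b hz)
    (eval_denPoly_ne_zero a' b' hz)]
  simpa using congrArg (MvPolynomial.eval z) key

end Rational

/-! ### Expansions in Laurent monomials. -/

section Expansions

/-- `g` has an absolutely convergent expansion in Laurent monomials on `U`. -/
def Expandable {ι : Type} [Fintype ι] (U : Set (ι → ℂ)) (g : (ι → ℂ) → ℂ) : Prop :=
  ∃ (T : Type) (_ : Countable T) (d : T → ℂ) (e : T → ι → ℤ),
    ∀ z ∈ U, HasSum (fun t => d t * ∏ j, z j ^ e t j) (g z)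

variable {ι : Type} [Fintype ι] {U : Set (ι → ℂ)} {f g : (ι → ℂ) → ℂ}

theorem Expandable.congr (hf : Expandable U f) (h : ∀ z ∈ U, g z = f z) : Expandable U g := by
  obtain ⟨T, hT, d, e, H⟩ := hf
  exact ⟨T, hT, d, e, fun z hz => h z hz ▸ H z hz⟩

/-- Since exponents may repeat, sums and products of expansions only require disjoint unions and
products of the index types; no coefficients have to be collected. -/
theorem Expandable.add (hf : Expandable U f) (hg : Expandable U g) :
    Expandable U fun z => f z + g z := by
  obtain ⟨T, hT, d, e, H⟩ := hf
  obtain ⟨T', hT', d', e', H'⟩ := hg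
  refine ⟨T ⊕ T', inferInstance, Sum.elim d d', Sum.elim e e', fun z hz => ?_⟩
  exact HasSum.sum (f := fun t => Sum.elim d d' t * ∏ j, z j ^ Sum.elim e e' t j)
    (by simpa [Function.comp_def] using H z hz) (by simpa [Function.comp_def] using H' z hz)

theorem Expandable.mul (hU : ∀ z ∈ U, ∀ j, z j ≠ 0) (hf : Expandable U f) (hg : Expandable U g) :
    Expandable U fun z => f z * g z := by
  obtain ⟨T, hT, d, e, H⟩ := hf
  obtain ⟨T', hT', d', e', H'⟩ := hg
  refine ⟨T × T', inferInstance, fun t => d t.1 * d' t.2, fun t j => e t.1 j + e' t.2 j,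
    fun z hz => ?_⟩
  have h0 : Summable fun t : T × T' =>
      (d t.1 * ∏ j, z j ^ e t.1 j) * (d' t.2 * ∏ j, z j ^ e' t.2 j) :=
    summable_mul_of_summable_norm (f := fun t => d t * ∏ j, z j ^ e t j)
      (g := fun t => d' t * ∏ j, z j ^ e' t j) (H z hz).summable.norm (H' z hz).summable.norm
  have h1 := HasSum.mul (H z hz) (H' z hz) h0
  refine h1.congr_fun fun t => ?_
  have : ∏ j, z j ^ (e t.1 j + e' t.2 j) = (∏ j, z j ^ e t.1 j) * ∏ j, z j ^ e' t.2 j := by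
    rw [← Finset.prod_mul_distrib]
    exact Finset.prod_congr rfl fun j _ => zpow_add₀ (hU z hz j) _ _
  show d t.1 * d' t.2 * ∏ j, z j ^ (e t.1 j + e' t.2 j) = _
  rw [this]
  ring

theorem expandable_const (c : ℂ) : Expandable U fun _ => c :=
  ⟨Unit, inferInstance, fun _ => c, 0, fun z _ => by simp⟩

theorem expandable_zpow [DecidableEq ι] (j : ι) (n : ℤ) : Expandable U fun z => z j ^ n := by
  refine ⟨Unit, inferInstance, 1, fun _ => Pi.single j n, fun z _ => ?_⟩
  have : ∏ i, z i ^ (Pi.single j n : ι → ℤ) i = z j ^ n := by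
    rw [Finset.prod_eq_single j] <;> simp +contextual
  simp [this]

theorem expandable_coord [DecidableEq ι] (j : ι) : Expandable U fun z => z j := by
  simpa using expandable_zpow (U := U) j 1

theorem Expandable.eval {α : Type*} (hU : ∀ z ∈ U, ∀ j, z j ≠ 0) (p : MvPolynomial α ℂ)
    {x : α → (ι → ℂ) → ℂ} (hx : ∀ i, Expandable U (x i)) :
    Expandable U fun z => MvPolynomial.eval (fun i => x i z) p := by
  induction p using MvPolynomial.induction_on with
  | C a => simpa using expandable_const (U := U) a
  | add p q hp hq => simpa using hp.add hq
  | mul_X p i hp => simpa using hp.mul hU (hx i)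

/-- This is the part of degree i in b of the expansion of (a - b - c)⁻¹, with i fixed and summed
over the powers of c. It is needed over ℝ too, where it is applied to the norms. -/
theorem hasSum_choose_mul_pow {𝕜 : Type*} [RCLike 𝕜] {a c : 𝕜} (h : ‖c‖ < ‖a‖) (b : 𝕜)
    (i : ℕ) :
    HasSum (fun j : ℕ => ((j + i).choose i : 𝕜) * (b ^ i * c ^ j * (a ^ (i + j + 1))⁻¹))
      ((a - c)⁻¹ * (b / (a - c)) ^ i) := by
  have ha : a ≠ 0 := by rintro rfl; simp at h; exact absurd h (norm_nonneg c).not_gt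
  have hac : a - c ≠ 0 := by rw [sub_ne_zero]; rintro rfl; exact lt_irrefl _ h
  have hr : ‖c / a‖ < 1 := by rwa [norm_div, div_lt_one (norm_pos_iff.2 ha)]
  have h1 := (hasSum_choose_mul_geometric_of_norm_lt_one i hr).mul_left (b ^ i * (a ^ (i + 1))⁻¹)
  have h2 : (a - c)⁻¹ * (b / (a - c)) ^ i =
      b ^ i * (a ^ (i + 1))⁻¹ * (1 / (1 - c / a) ^ (i + 1)) := by
    have : 1 - c / a = (a - c) / a := by field_simp
    rw [this, div_pow, div_pow, pow_succ (a - c)]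
    field_simp
  rw [h2]
  refine h1.congr_fun fun j => ?_
  rw [show i + j + 1 = (i + 1) + j by ring, pow_add a (i + 1) j, div_pow]
  field_simp

/-- The expansion of `(a - b - c)⁻¹` for `|b| + |c| < |a|`. -/
theorem hasSum_inv_three {a b c : ℂ} (h : ‖b‖ + ‖c‖ < ‖a‖) :
    HasSum (fun t : ℕ × ℕ => ((t.2 + t.1).choose t.1 : ℂ) *
      (b ^ t.1 * c ^ t.2 * (a ^ (t.1 + t.2 + 1))⁻¹)) (a - b - c)⁻¹ := by
  -- The norms of the terms are the terms of the same expansion for ‖a‖ - ‖b‖ - ‖c‖, which is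
  -- positive.
  have hs : Summable fun t : ℕ × ℕ => ((t.2 + t.1).choose t.1 : ℂ) *
      (b ^ t.1 * c ^ t.2 * (a ^ (t.1 + t.2 + 1))⁻¹) := by
    refine Summable.of_norm ?_
    have hc' : ‖‖c‖‖ < ‖‖a‖‖ := by simp only [norm_norm]; linarith [norm_nonneg b]
    have hin := fun i => hasSum_choose_mul_pow hc' ‖b‖ i
    have heq : (fun t : ℕ × ℕ => ‖((t.2 + t.1).choose t.1 : ℂ) *
      (b ^ t.1 * c ^ t.2 * (a ^ (t.1 + t.2 + 1))⁻¹)‖) = fun t : ℕ × ℕ =>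
        ((t.2 + t.1).choose t.1 : ℝ) *
      (‖b‖ ^ t.1 * ‖c‖ ^ t.2 * (‖a‖ ^ (t.1 + t.2 + 1))⁻¹) := by
      ext t; simp
    rw [heq, summable_prod_of_nonneg (fun t => by positivity)]
    refine ⟨fun i => (hin i).summable, ?_⟩
    simp only [(hin _).tsum_eq]
    have hp : 0 < ‖a‖ - ‖c‖ := by linarith [norm_nonneg b]
    refine (summable_geometric_of_lt_one (by positivity) ?_).mul_left _
    rw [div_lt_one hp]; linarith
  have h2 := hs.hasSum.prod_fiberwise fun i =>
    hasSum_choose_mul_pow (show ‖c‖ < ‖a‖ by linarith [norm_nonneg b]) b i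
  have hac : a - c ≠ 0 := by
    rw [sub_ne_zero]; rintro rfl; linarith [norm_nonneg b]
  have hb : ‖b‖ < ‖a - c‖ := by linarith [norm_sub_norm_le a c]
  have h3 := (hasSum_geometric_of_norm_lt_one (ξ := b / (a - c))
    (by rwa [norm_div, div_lt_one (norm_pos_iff.2 hac)])).mul_left (a - c)⁻¹
  have h4 : (a - b - c)⁻¹ = (a - c)⁻¹ * (1 - b / (a - c))⁻¹ := by
    rw [← mul_inv, mul_sub, mul_div_cancel₀ _ hac]; congr 1; ring
  rw [h4, ← h2.unique h3]
  exact hs.hasSum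

/-- Meant for the difference of a distant variable and of a point z j + b close to b. -/
theorem expandable_inv_three [DecidableEq ι] (hU : ∀ z ∈ U, ∀ j, z j ≠ 0) (i j : ι) (b : ℂ)
    (h : ∀ z ∈ U, ‖b‖ + ‖z j‖ < ‖z i‖) : Expandable U fun z => (z i - b - z j)⁻¹ := by
  refine ⟨ℕ × ℕ, inferInstance, fun t => ((t.2 + t.1).choose t.1 : ℂ) * b ^ t.1,
    fun t l => (Pi.single j (t.2 : ℤ) : ι → ℤ) l + (Pi.single i (-(t.1 + t.2 + 1 : ℕ) : ℤ) : ι → ℤ) l, fun z hz => ?_⟩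
  refine (hasSum_inv_three (h z hz)).congr_fun fun t => ?_
  have hs : ∀ (l : ι) (n : ℤ), ∏ m, z m ^ (Pi.single l n : ι → ℤ) m = z l ^ n := fun l n => by
    rw [Finset.prod_eq_single l] <;> simp +contextual
  simp only [zpow_add₀ (hU z hz _), Finset.prod_mul_distrib, hs, zpow_neg,
    zpow_natCast]
  ring

theorem expandable_sub_inv [DecidableEq ι] (hU : ∀ z ∈ U, ∀ j, z j ≠ 0) (i j : ι)
    (h : ∀ z ∈ U, ‖z j‖ < ‖z i‖) : Expandable U fun z => (z i - z j)⁻¹ := by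
  simpa using expandable_inv_three hU i j 0 (by simpa using h)

theorem expandable_const_add_inv [DecidableEq ι] (j : ι) {b : ℂ} (hb : b ≠ 0)
    (h : ∀ z ∈ U, ‖z j‖ < ‖b‖) : Expandable U fun z => (z j + b)⁻¹ := by
  refine ⟨ℕ, inferInstance, fun n => b⁻¹ * (-b⁻¹) ^ n, fun n => Pi.single j (n : ℤ),
    fun z hz => ?_⟩
  have hs : ∀ (l : ι) (n : ℤ), ∏ m, z m ^ (Pi.single l n : ι → ℤ) m = z l ^ n := fun l n => by
    rw [Finset.prod_eq_single l] <;> simp +contextual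
  have h1 : ‖-(z j) * b⁻¹‖ < 1 := by
    rw [norm_mul, norm_neg, norm_inv, ← div_eq_mul_inv, div_lt_one (norm_pos_iff.2 hb)]
    exact h z hz
  have h2 := (hasSum_geometric_of_norm_lt_one h1).mul_left b⁻¹
  have h3 : (z j + b)⁻¹ = b⁻¹ * (1 - -(z j) * b⁻¹)⁻¹ := by
    rw [← mul_inv]; congr 1; field_simp; ring
  show HasSum _ (z j + b)⁻¹
  rw [h3]
  refine h2.congr_fun fun n => ?_
  rw [hs, zpow_natCast, mul_assoc, ← mul_pow, neg_mul_comm, mul_comm b⁻¹ (-z j)]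

end Expansions

/-! ### Calculus of formal series in several variables. -/

section Formal

variable {κ κ' : Type*} [AddCommGroup κ] [AddCommGroup κ']
  {M M' : Type*} [AddCommGroup M] [Module ℂ M] [AddCommGroup M'] [Module ℂ M']

/-- The translation of functions by `v`. -/
def shift (v : κ) : Module.End ℂ (κ → M) where
  toFun F y := F (y + v)
  map_add' _ _ := rfl
  map_smul' _ _ := rfl

/-- The difference of two translations. On the coefficients of a formal series in `z₁, z₂, …`, with
`z₁^{-p-1} z₂^{-q-1} ⋯` at the index `(p, q, …)`, it is the multiplication by `zⱼ - zₗ`. -/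
def dif (v w : κ) : Module.End ℂ (κ → M) := shift v - shift w

@[simp] theorem shift_apply (v : κ) (F : κ → M) (y : κ) : shift v F y = F (y + v) := rfl

@[simp] theorem dif_apply (v w : κ) (F : κ → M) (y : κ) :
    dif v w F y = F (y + v) - F (y + w) := rfl

theorem shift_commute (v w : κ) : Commute (shift v : Module.End ℂ (κ → M)) (shift w) := by
  refine LinearMap.ext fun F => funext fun y => ?_
  simp [Module.End.mul_apply, add_assoc, add_comm v w]

theorem dif_commute (v w v' w' : κ) : Commute (dif v w : Module.End ℂ (κ → M)) (dif v' w') :=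
  ((shift_commute v v').sub_right (shift_commute v w')).sub_left
    ((shift_commute w v').sub_right (shift_commute w w'))

/-- Multiplication by a difference of variables is compatible with substitutions of the indices.
This serves to fix some of the variables and to exchange two of them. -/
theorem dif_pow_comp {v w : κ} {v' w' : κ'} (g : κ → κ') (hv : ∀ y, g (y + v) = g y + v')
    (hw : ∀ y, g (y + w) = g y + w') (N : ℕ) (F : κ' → M) :
    (dif v w ^ N) (fun y => F (g y)) = fun y => (dif v' w' ^ N) F (g y) := by
  induction N with
  | zero => simp
  | succ N ih =>
    ext y
    simp [pow_succ', Module.End.mul_apply, ih, hv, hw]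

theorem dif_pow_map (v w : κ) (L : M →ₗ[ℂ] M') (N : ℕ) (F : κ → M) :
    (dif v w ^ N) (fun y => L (F y)) = fun y => L ((dif v w ^ N) F y) := by
  induction N with
  | zero => simp
  | succ N ih =>
    ext y
    simp [pow_succ', Module.End.mul_apply, ih]

theorem dif_pow_eq_zero {v w : κ} {s : κ → Prop} (hv : ∀ y, s y → s (y + v))
    (hw : ∀ y, s y → s (y + w)) (N : ℕ) {F : κ → M} (hF : ∀ y, s y → F y = 0) :
    ∀ y, s y → (dif v w ^ N) F y = 0 := by
  induction N with
  | zero => simpa using hF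
  | succ N ih =>
    intro y hy
    simp [pow_succ', Module.End.mul_apply, ih _ (hv y hy), ih _ (hw y hy)]

theorem dif_pow_swap (v w : κ) (N : ℕ) (F : κ → M) :
    (dif w v ^ N) F = (-1 : ℂ) ^ N • (dif v w ^ N) F := by
  have : (dif w v : Module.End ℂ (κ → M)) = (-1 : ℂ) • dif v w := by
    refine LinearMap.ext fun F => funext fun y => ?_
    simp
  rw [this, smul_pow]
  rfl

/-- The derivative with respect to the first variable. -/
def der₁ : Module.End ℂ (ℤ × κ → M) where
  toFun F y := (-(y.1 : ℂ)) • F (y.1 - 1, y.2)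
  map_add' F G := by ext y; simp
  map_smul' c F := by ext y; simp [smul_comm c]

/-- The derivative with respect to the second variable. -/
def der₂ : Module.End ℂ (ℤ × ℤ → M) where
  toFun F y := (-(y.2 : ℂ)) • F (y.1, y.2 - 1)
  map_add' F G := by ext y; simp
  map_smul' c F := by ext y; simp [smul_comm c]

theorem der₁_apply (F : ℤ × κ → M) (p : ℤ) (y : κ) :
    der₁ F (p, y) = (-(p : ℂ)) • F (p - 1, y) := rfl

theorem der₂_apply (F : ℤ × ℤ → M) (p q : ℤ) :
    der₂ F (p, q) = (-(q : ℂ)) • F (p, q - 1) := rfl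

theorem der₁_pow_map (L : M →ₗ[ℂ] M') (j : ℕ) (F : ℤ × κ → M) :
    (der₁ ^ j) (fun y => L (F y)) = fun y => L ((der₁ ^ j) F y) := by
  induction j with
  | zero => simp
  | succ j ih =>
    ext ⟨p, y⟩
    simp [pow_succ', Module.End.mul_apply, ih, der₁_apply]

theorem der₁_pow_comp (g : κ → κ') (j : ℕ) (F : ℤ × κ' → M) :
    (der₁ ^ j) (fun y : ℤ × κ => F (y.1, g y.2)) = fun y => (der₁ ^ j) F (y.1, g y.2) := by
  induction j with
  | zero => simp
  | succ j ih =>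
    ext ⟨p, y⟩
    simp [pow_succ', Module.End.mul_apply, ih, der₁_apply]

theorem der₁_commute_dif (v w : κ) :
    Commute (der₁ : Module.End ℂ (ℤ × κ → M)) (dif (0, v) (0, w)) := by
  refine LinearMap.ext fun F => funext fun ⟨p, y⟩ => ?_
  simp [Module.End.mul_apply, der₁_apply, smul_sub]

theorem der₁_mul_dif (w : κ) :
    (der₁ * dif (1, 0) (0, w) : Module.End ℂ (ℤ × κ → M)) = dif (1, 0) (0, w) * der₁ + 1 := by
  refine LinearMap.ext fun F => funext fun ⟨p, y⟩ => ?_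
  simp [Module.End.mul_apply, der₁_apply, smul_sub]
  module

theorem der₂_mul_dif :
    (der₂ * dif (1, 0) (0, 1) : Module.End ℂ (ℤ × ℤ → M)) = dif (1, 0) (0, 1) * der₂ - 1 := by
  refine LinearMap.ext fun F => funext fun ⟨p, q⟩ => ?_
  simp [Module.End.mul_apply, der₂_apply, smul_sub]
  module

theorem der₁_commute_der₂ : Commute (der₁ : Module.End ℂ (ℤ × ℤ → M)) der₂ := by
  refine LinearMap.ext fun F => funext fun ⟨p, q⟩ => ?_
  simp [Module.End.mul_apply, der₁_apply, der₂_apply, smul_smul, mul_comm]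

theorem der_commute_dif :
    Commute (der₁ + der₂ : Module.End ℂ (ℤ × ℤ → M)) (dif (1, 0) (0, 1)) := by
  show (der₁ + der₂) * dif (1, 0) (0, 1) = dif (1, 0) (0, 1) * (der₁ + der₂)
  rw [add_mul, mul_add, der₂_mul_dif, der₁_mul_dif]
  abel

/-- By the Leibniz rule, ∂₁ (z₁ - w)^{N+1} F = (z₁ - w)^{N+1} ∂₁ F + (N+1) (z₁ - w)^N F, so a
derivative costs one more factor z₁ - w. -/
theorem dif_pow_succ_der₁ (w : κ) (N : ℕ) {F : ℤ × κ → M} (hF : (dif (1, 0) (0, w) ^ N) F = 0) :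
    (dif (1, 0) (0, w) ^ (N + 1)) (der₁ F) = 0 := by
  have key : ∀ N : ℕ, (der₁ * dif (1, 0) (0, w) ^ (N + 1) : Module.End ℂ (ℤ × κ → M)) =
      dif (1, 0) (0, w) ^ (N + 1) * der₁ + (N + 1 : ℂ) • dif (1, 0) (0, w) ^ N := by
    intro N
    induction N with
    | zero => simpa using der₁_mul_dif w
    | succ N ih =>
      rw [pow_succ _ (N + 1), ← mul_assoc, ih, add_mul, mul_assoc, der₁_mul_dif, smul_mul_assoc,
        ← pow_succ, mul_add, mul_one, ← mul_assoc]
      push_cast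
      module
  have h := congrArg (fun A : Module.End ℂ (ℤ × κ → M) => A F) (key N)
  simp only [Module.End.mul_apply, LinearMap.add_apply, LinearMap.smul_apply, hF, smul_zero,
    add_zero, pow_succ', map_zero] at h
  rw [pow_succ', Module.End.mul_apply]
  exact h.symm

/-- The restriction to the diagonal `z₁ = z₂ = z` of a formal series in `z₁`, `z₂` (and possibly
others), the coefficient of `z^{-n-1}` being at the index `n`. -/
def diag (G : ℤ × ℤ → M) (n : ℤ) : M := ∑ᶠ p : ℤ, G (p, n - 1 - p)

/-- `G` vanishes if one of its arguments is large. -/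
def Trunc (G : ℤ × ℤ → M) : Prop := ∃ P : ℤ, ∀ p q, P ≤ p ∨ P ≤ q → G (p, q) = 0

/-- On an antidiagonal an upper bound for both indices is also a lower bound, so the sums in `diag`
are finite. -/
theorem Trunc.finite {G : ℤ × ℤ → M} (h : Trunc G) (n : ℤ) :
    (Function.support fun p : ℤ => G (p, n - p)).Finite := by
  obtain ⟨P, hP⟩ := h
  refine (Set.finite_Ioo (n - P) P).subset fun p hp => ?_
  by_contra hc
  refine hp (hP _ _ ?_)
  simp only [Set.mem_Ioo, not_and_or, not_lt] at hc
  omega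

theorem Trunc.der₁ {G : ℤ × ℤ → M} (h : Trunc G) (j : ℕ) : Trunc ((der₁ ^ j) G) := by
  induction j with
  | zero => simpa using h
  | succ j ih =>
    obtain ⟨P, hP⟩ := ih
    refine ⟨P + 1, fun p q hpq => ?_⟩
    rw [pow_succ', Module.End.mul_apply, der₁_apply, hP _ _ (by omega), smul_zero]

theorem Trunc.der₂ {G : ℤ × ℤ → M} (h : Trunc G) : Trunc (der₂ G) := by
  obtain ⟨P, hP⟩ := h
  refine ⟨P + 1, fun p q hpq => ?_⟩
  rw [der₂_apply, hP _ _ (by omega), smul_zero]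

theorem Trunc.map {G : ℤ × ℤ → M} (h : Trunc G) (L : M →ₗ[ℂ] M') : Trunc fun y => L (G y) := by
  obtain ⟨P, hP⟩ := h
  exact ⟨P, fun p q hpq => by simp [hP p q hpq]⟩

theorem Trunc.smul {G : ℤ × ℤ → M} (h : Trunc G) (c : ℂ) : Trunc (c • G) := by
  obtain ⟨P, hP⟩ := h
  exact ⟨P, fun p q hpq => by rw [Pi.smul_apply, hP p q hpq, smul_zero]⟩

theorem Trunc.add {G G' : ℤ × ℤ → M} (h : Trunc G) (h' : Trunc G') : Trunc (G + G') := by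
  obtain ⟨P, hP⟩ := h
  obtain ⟨P', hP'⟩ := h'
  exact ⟨max P P', fun p q hpq => by
    rw [Pi.add_apply, hP p q (by omega), hP' p q (by omega), add_zero]⟩

theorem Trunc.sub {G G' : ℤ × ℤ → M} (h : Trunc G) (h' : Trunc G') : Trunc (G - G') := by
  simpa [sub_eq_add_neg] using h.add (h'.smul (-1))

theorem diag_add {G G' : ℤ × ℤ → M} (h : Trunc G) (h' : Trunc G') (n : ℤ) :
    diag (G + G') n = diag G n + diag G' n :=
  finsum_add_distrib (h.finite (n - 1)) (h'.finite (n - 1))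

theorem diag_sub {G G' : ℤ × ℤ → M} (h : Trunc G) (h' : Trunc G') (n : ℤ) :
    diag (G - G') n = diag G n - diag G' n :=
  finsum_sub_distrib (h.finite (n - 1)) (h'.finite (n - 1))

theorem diag_smul (c : ℂ) {G : ℤ × ℤ → M} (h : Trunc G) (n : ℤ) :
    diag (c • G) n = c • diag G n :=
  (smul_finsum' c (h.finite (n - 1))).symm

theorem diag_map (L : M →ₗ[ℂ] M') {G : ℤ × ℤ → M} (h : Trunc G) (n : ℤ) :
    diag (fun y => L (G y)) n = L (diag G n) :=
  (L.toAddMonoidHom.map_finsum (h.finite (n - 1))).symm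

theorem diag_zero (n : ℤ) : diag (0 : ℤ × ℤ → M) n = 0 := finsum_zero

/-- On the diagonal, multiplication by z₁ and multiplication by z₂ (`diag_shift₂`) both become
multiplication by z. -/
theorem diag_shift₁ (G : ℤ × ℤ → M) (n : ℤ) :
    diag (fun y => G (y.1 + 1, y.2)) n = diag G (n + 1) := by
  refine Eq.trans (finsum_congr fun p => ?_)
    (finsum_comp_equiv (Equiv.addRight (1 : ℤ)) (f := fun p => G (p, n + 1 - 1 - p)))
  simp only [Equiv.coe_addRight]
  congr 2
  ring

theorem diag_shift₂ (G : ℤ × ℤ → M) (n : ℤ) :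
    diag (fun y => G (y.1, y.2 + 1)) n = diag G (n + 1) := by
  refine finsum_congr fun p => ?_
  show G (p, n - 1 - p + 1) = _
  congr 2
  ring

/-- The chain rule for G(z, z): after a shift of p in the first sum the factors add up to -(p + 1) -
(n - 1 - p) = -n. -/
theorem diag_der {G : ℤ × ℤ → M} (h : Trunc G) (n : ℤ) :
    diag ((der₁ + der₂ : Module.End ℂ (ℤ × ℤ → M)) G) n = (-(n : ℂ)) • diag G (n - 1) := by
  rw [LinearMap.add_apply, diag_add (by simpa using h.der₁ 1) h.der₂]
  have h1 : diag (der₁ G) n = ∑ᶠ p : ℤ, (-((p : ℂ) + 1)) • G (p, n - 1 - 1 - p) := by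
    refine (finsum_comp_equiv (Equiv.addRight (1 : ℤ))).symm.trans (finsum_congr fun p => ?_)
    simp only [Equiv.coe_addRight, der₁_apply]
    rw [show p + 1 - 1 = p by ring, show n - 1 - (p + 1) = n - 1 - 1 - p by ring]
    push_cast
    rfl
  have h2 : diag (der₂ G) n = ∑ᶠ p : ℤ, (-((n : ℂ) - 1 - p)) • G (p, n - 1 - 1 - p) := by
    unfold diag
    refine finsum_congr fun p => ?_
    simp only [der₂_apply]
    rw [show n - 1 - p - 1 = n - 1 - 1 - p by ring]
    push_cast
    rfl
  have hf : ∀ c : ℤ → ℂ, (Function.support fun p : ℤ => c p • G (p, n - 1 - 1 - p)).Finite :=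
    fun c => (h.finite (n - 1 - 1)).subset fun p hp hz => hp (by
      simp only at hz; simp only [hz, smul_zero])
  rw [h1, h2, ← finsum_add_distrib (hf _) (hf _), diag, smul_finsum' _ (h.finite _)]
  refine finsum_congr fun p => ?_
  module

end Formal

/-! ### Local fields, their n-th products and Dong's lemma. -/

section FormalFields

variable {E : Type*} [AddCommGroup E] [Module ℂ E]

/-- A sequence of modes that annihilate every given vector from some index on. -/
def IsField (a : ℤ → Module.End ℂ E) : Prop := ∀ x, ∃ P : ℤ, ∀ n, P ≤ n → a n x = 0

/-- The coefficients of `(z₁ - z₂)^N a(z₁) b(z₂)`. -/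
def ope (N : ℕ) (a b : ℤ → Module.End ℂ E) : ℤ × ℤ → Module.End ℂ E :=
  (dif (1, 0) (0, 1) ^ N) fun y => a y.1 * b y.2

/-- Locality, `(z₁ - z₂)^N a(z₁) b(z₂) = ε (z₁ - z₂)^N b(z₂) a(z₁)`. -/
def Loc (N : ℕ) (ε : ℂ) (a b : ℤ → Module.End ℂ E) : Prop :=
  ∀ x, (dif (1, 0) (0, 1) ^ N) (fun y : ℤ × ℤ => a y.1 (b y.2 x)) =
    ε • (dif (1, 0) (0, 1) ^ N) fun y => b y.2 (a y.1 x)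

/-- `[D, a(z)] = (d/dz) a(z)`. -/
def Cov (D : Module.End ℂ E) (a : ℤ → Module.End ℂ E) : Prop :=
  ∀ n, D * a n - a n * D = (-(n : ℂ)) • a (n - 1)

variable {a b d : ℤ → Module.End ℂ E} {N : ℕ} {ε : ℂ}

theorem ope_apply (N : ℕ) (a b : ℤ → Module.End ℂ E) (x : E) (y : ℤ × ℤ) :
    ope N a b y x = (dif (1, 0) (0, 1) ^ N) (fun y => a y.1 (b y.2 x)) y :=
  (congrFun (dif_pow_map (1, 0) (0, 1) (LinearMap.applyₗ x) N
    fun y : ℤ × ℤ => a y.1 * b y.2) y).symm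

theorem Loc.mono {N' : ℕ} (h : Loc N ε a b) (hN : N ≤ N') : Loc N' ε a b := by
  intro x
  obtain ⟨k, rfl⟩ := Nat.exists_eq_add_of_le' hN
  rw [pow_add, Module.End.mul_apply, Module.End.mul_apply, h x, map_smul]

theorem Loc.symm (h : Loc N ε a b) (hε : ε * ε = 1) : Loc N ε b a := by
  intro x
  have key : ∀ F : ℤ × ℤ → E, (dif (1, 0) (0, 1) ^ N) (fun y : ℤ × ℤ => F y.swap) =
      fun y => (-1 : ℂ) ^ N • (dif (1, 0) (0, 1) ^ N) F y.swap := by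
    intro F
    rw [dif_pow_comp (v' := (0, 1)) (w' := (1, 0)) (Prod.swap : ℤ × ℤ → ℤ × ℤ)
      (fun y => by simp [Prod.swap]) (fun y => by simp [Prod.swap]), dif_pow_swap]
    rfl
  have h1 := key fun y => a y.1 (b y.2 x)
  have h2 := key fun y => b y.2 (a y.1 x)
  simp only [Prod.fst_swap, Prod.snd_swap] at h1 h2
  rw [h1, h2, h x]
  ext y
  simp only [Pi.smul_apply, smul_smul]
  rw [mul_comm ((-1) ^ N) ε, ← mul_assoc, hε, one_mul]

theorem Loc.smul_left (h : Loc N ε a b) (c : ℂ) : Loc N ε (c • a) b := by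
  intro x
  have h1 : (fun y : ℤ × ℤ => (c • a) y.1 (b y.2 x)) = c • fun y => a y.1 (b y.2 x) := rfl
  have h2 : (fun y : ℤ × ℤ => b y.2 ((c • a) y.1 x)) = c • fun y => b y.2 (a y.1 x) := by
    ext y; simp
  rw [h1, h2, map_smul, map_smul, h x, smul_comm]

theorem Loc.add_left {a' : ℤ → Module.End ℂ E} {N' : ℕ} (h : Loc N ε a b) (h' : Loc N' ε a' b) :
    Loc (max N N') ε (a + a') b := by
  intro x
  have h1 : (fun y : ℤ × ℤ => (a + a') y.1 (b y.2 x)) =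
    (fun y => a y.1 (b y.2 x)) + fun y => a' y.1 (b y.2 x) := rfl
  have h2 : (fun y : ℤ × ℤ => b y.2 ((a + a') y.1 x)) =
    (fun y => b y.2 (a y.1 x)) + fun y => b y.2 (a' y.1 x) := by ext y; simp
  rw [h1, h2, map_add, map_add, (h.mono (le_max_left N N')) x, (h'.mono (le_max_right N N')) x,
    smul_add]

theorem Loc.zero_left : Loc 0 ε (0 : ℤ → Module.End ℂ E) b := by
  intro x
  ext y
  simp

/-- The second index is bounded because b(z₂) x is truncated. Locality brings a(z₁) next to x, and
this bounds the first index. -/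
theorem Loc.trunc (hab : Loc N ε a b) (ha : IsField a) (hb : IsField b) (x : E) :
    Trunc fun y => ope N a b y x := by
  obtain ⟨P, hP⟩ := ha x
  obtain ⟨Q, hQ⟩ := hb x
  refine ⟨max P Q, fun p q h => ?_⟩
  simp only [ope_apply]
  rcases h with h | h
  · rw [hab x, Pi.smul_apply, dif_pow_eq_zero (s := fun y => P ≤ y.1) ?_ ?_ N ?_ (p, q)
      (le_trans (le_max_left _ _) h), smul_zero]
    · rintro ⟨p, q⟩ h; simp only [Prod.mk_add_mk] at h ⊢; omega
    · rintro ⟨p, q⟩ h; simp only [Prod.mk_add_mk] at h ⊢; omega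
    · intro y hy; rw [hP _ hy, map_zero]
  · rw [dif_pow_eq_zero (s := fun y => Q ≤ y.2) ?_ ?_ N ?_ (p, q)
      (le_trans (le_max_right _ _) h)]
    · rintro ⟨p, q⟩ h; simp only [Prod.mk_add_mk] at h ⊢; omega
    · rintro ⟨p, q⟩ h; simp only [Prod.mk_add_mk] at h ⊢; omega
    · intro y hy; rw [hQ _ hy, map_zero]

/-- If (z₁ - z₂) F = 0, then F is constant along antidiagonals, and these run into the range where F
vanishes. Without the truncation the formal delta function would be a counterexample. -/
theorem eq_zero_of_dif_pow {M : Type*} [AddCommGroup M] [Module ℂ M] {Q : ℤ} (N : ℕ)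
    {F : ℤ × ℤ → M} (hF : ∀ p q, Q ≤ q → F (p, q) = 0)
    (h : (dif (1, 0) (0, 1) ^ N) F = 0) : F = 0 := by
  induction N generalizing F with
  | zero => simpa using h
  | succ N ih =>
    rw [pow_succ, Module.End.mul_apply] at h
    have h0 := ih (fun p q hq => by simp [hF _ q hq, hF p _ (hq.trans (by omega : q ≤ q + 1))]) h
    have h1 : ∀ p q, F (p + 1, q) = F (p, q + 1) := fun p q => by
      have := congrFun h0 (p, q)
      simpa [sub_eq_zero] using this
    have h2 : ∀ k : ℕ, ∀ p q, Q ≤ q + k → F (p, q) = 0 := by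
      intro k
      induction k with
      | zero => intro p q hq; exact hF p q (by simpa using hq)
      | succ k ih2 =>
        intro p q hq
        have := h1 (p - 1) q
        rw [sub_add_cancel] at this
        rw [this]
        exact ih2 _ _ (by push_cast at hq; omega)
    ext ⟨p, q⟩
    exact h2 (Q - q).toNat p q (by omega)

/-- The inductive step of Goddard's theorem: being killed by all modes of a passes from x to the
vectors b_q x. -/
theorem Loc.apply_eq_zero (h : Loc N ε a b) (hb : IsField b) {x : E} (hx : ∀ n, a n x = 0)
    (p q : ℤ) : a p (b q x) = 0 := by
  obtain ⟨Q, hQ⟩ := hb x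
  have h0 : (fun y : ℤ × ℤ => b y.2 (a y.1 x)) = 0 := by ext y; simp [hx]
  have := eq_zero_of_dif_pow N (F := fun y : ℤ × ℤ => a y.1 (b y.2 x)) (Q := Q)
    (fun p q hq => by simp [hQ q hq]) (by rw [h x, h0, map_zero, smul_zero])
  exact congrFun this (p, q)

/-- The coefficients of `(j!)⁻¹ (d/dz₁)^j (z₁ - z₂)^N a(z₁) b(z₂)`. -/
def opeDer (N j : ℕ) (a b : ℤ → Module.End ℂ E) : ℤ × ℤ → Module.End ℂ E :=
  ((j.factorial : ℂ)⁻¹) • (der₁ ^ j) (ope N a b)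

theorem opeDer_map {M : Type*} [AddCommGroup M] [Module ℂ M] (N j : ℕ)
    (a b : ℤ → Module.End ℂ E) (L : Module.End ℂ E →ₗ[ℂ] M) :
    (fun y => L (opeDer N j a b y)) =
      ((j.factorial : ℂ)⁻¹) • (der₁ ^ j) fun y => L (ope N a b y) := by
  rw [der₁_pow_map]
  ext y
  simp [opeDer]

theorem trunc_opeDer_map {M : Type*} [AddCommGroup M] [Module ℂ M] (j : ℕ)
    (L : Module.End ℂ E →ₗ[ℂ] M) (h : Trunc fun y => L (ope N a b y)) :
    Trunc fun y => L (opeDer N j a b y) := by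
  rw [opeDer_map]
  exact (h.der₁ j).smul _

theorem trunc_opeDer (h : ∀ x, Trunc fun y => ope N a b y x) (j : ℕ) (x : E) :
    Trunc fun y => opeDer N j a b y x :=
  trunc_opeDer_map j (LinearMap.applyₗ x) (h x)

/-- The product `a_(N-1-j) b` of two fields, `(j!)⁻¹ (d/dz₁)^j (z₁ - z₂)^N a(z₁) b(z₂)` at
`z₁ = z₂`. -/
def fieldProd (N j : ℕ) (a b : ℤ → Module.End ℂ E) (h : ∀ x, Trunc fun y => ope N a b y x)
    (n : ℤ) : Module.End ℂ E where
  toFun x := diag (fun y => opeDer N j a b y x) n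
  map_add' x x' := by
    rw [← diag_add (trunc_opeDer h j x) (trunc_opeDer h j x')]
    congr 1
    ext y
    simp
  map_smul' c x := by
    rw [RingHom.id_apply, ← diag_smul c (trunc_opeDer h j x)]
    congr 1
    ext y
    simp

variable {h : ∀ x, Trunc fun y => ope N a b y x} {j : ℕ}

theorem fieldProd_apply (n : ℤ) (x : E) :
    fieldProd N j a b h n x = diag (fun y => opeDer N j a b y x) n := rfl

/-- The commutator with D acts on a(z₁) b(z₂) as ∂₁ + ∂₂, which commutes with z₁ - z₂ and with ∂₁
and becomes d/dz on the diagonal. -/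
theorem Cov.fieldProd {D : Module.End ℂ E} (ha : Cov D a) (hb : Cov D b) :
    Cov D (fieldProd N j a b h) := by
  set L : Module.End ℂ E →ₗ[ℂ] Module.End ℂ E :=
    LinearMap.mulLeft ℂ D - LinearMap.mulRight ℂ D with hL
  have hLa : ∀ A, L A = D * A - A * D := fun A => rfl
  have h1 : (fun y : ℤ × ℤ => L (a y.1 * b y.2)) =
      (der₁ + der₂ : Module.End ℂ _) fun y : ℤ × ℤ => a y.1 * b y.2 := by
    ext1 ⟨p, q⟩
    have e1 := ha p
    have e2 := hb q
    simp only [LinearMap.add_apply, Pi.add_apply, der₁_apply, der₂_apply]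
    rw [← smul_mul_assoc, ← mul_smul_comm, ← e1, ← e2, hLa]
    noncomm_ring
  have h2 : (fun y => L (ope N a b y)) = (der₁ + der₂ : Module.End ℂ _) (ope N a b) := by
    unfold ope
    rw [← dif_pow_map, h1]
    exact (congrArg (fun A : Module.End ℂ _ => A _) (der_commute_dif.pow_right N)).symm
  have h3 : (fun y => L (opeDer N j a b y)) = (der₁ + der₂ : Module.End ℂ _) (opeDer N j a b) := by
    rw [opeDer_map, h2]
    have hc : Commute (der₁ + der₂ : Module.End ℂ (ℤ × ℤ → Module.End ℂ E)) (der₁ ^ j) :=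
      (((Commute.refl _).add_left der₁_commute_der₂.symm)).pow_right j
    unfold opeDer
    rw [map_smul]
    congr 1
    exact (congrArg (fun A : Module.End ℂ _ => A _) hc).symm
  intro n
  ext x
  have ht := trunc_opeDer h j
  have e1 : D (VertexConstruction.fieldProd N j a b h n x) =
      diag (fun y => D (opeDer N j a b y x)) n := (diag_map D (ht x) n).symm
  have e2 := diag_sub ((ht x).map D) (ht (D x)) n
  have e3 : ((fun y => D (opeDer N j a b y x)) - fun y => opeDer N j a b y (D x)) =
      (der₁ + der₂ : Module.End ℂ _) fun y => opeDer N j a b y x := by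
    ext1 ⟨p, q⟩
    have := LinearMap.congr_fun (congrFun h3 (p, q)) x
    simpa [der₁_apply, der₂_apply, hLa] using this
  rw [LinearMap.sub_apply, Module.End.mul_apply, Module.End.mul_apply, e1, fieldProd_apply, ← e2,
    e3, diag_der (ht x)]
  rfl

/-- The diagonal in the first two variables. -/
theorem dif_diag₁ {Z : ℤ × ℤ × ℤ → E} (hZ : ∀ r, Trunc fun y : ℤ × ℤ => Z (y.1, y.2, r)) :
    dif (1, 0) (0, 1) (fun y : ℤ × ℤ => diag (fun u : ℤ × ℤ => Z (u.1, u.2, y.2)) y.1) =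
      fun y : ℤ × ℤ =>
        diag (fun u : ℤ × ℤ => dif (1, 0) (0, 0, 1) Z (u.1, u.2, y.2)) y.1 := by
  ext ⟨n, r⟩
  have h1 : Trunc fun u : ℤ × ℤ => Z (u.1 + 1, u.2, r) := by
    obtain ⟨P, hP⟩ := hZ r
    exact ⟨P, fun p q hpq => hP (p + 1) q (by omega)⟩
  have := diag_sub h1 (hZ (r + 1)) n
  rw [diag_shift₁ (fun u : ℤ × ℤ => Z (u.1, u.2, r)) n] at this
  simp only [dif_apply, Prod.mk_add_mk, add_zero]
  rw [← this]
  rfl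

theorem dif_diag₂ {Z : ℤ × ℤ × ℤ → E} (hZ : ∀ r, Trunc fun y : ℤ × ℤ => Z (y.1, y.2, r)) :
    dif (1, 0) (0, 1) (fun y : ℤ × ℤ => diag (fun u : ℤ × ℤ => Z (u.1, u.2, y.2)) y.1) =
      fun y : ℤ × ℤ =>
        diag (fun u : ℤ × ℤ => dif (0, 1, 0) (0, 0, 1) Z (u.1, u.2, y.2)) y.1 := by
  ext ⟨n, r⟩
  have h1 : Trunc fun u : ℤ × ℤ => Z (u.1, u.2 + 1, r) := by
    obtain ⟨P, hP⟩ := hZ r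
    exact ⟨P, fun p q hpq => hP p (q + 1) (by omega)⟩
  have := diag_sub h1 (hZ (r + 1)) n
  rw [diag_shift₂ (fun u : ℤ × ℤ => Z (u.1, u.2, r)) n] at this
  simp only [dif_apply, Prod.mk_add_mk, add_zero]
  rw [← this]
  rfl

theorem trunc_dif₁ {Z : ℤ × ℤ × ℤ → E} (hZ : ∀ r, Trunc fun y : ℤ × ℤ => Z (y.1, y.2, r)) (r : ℤ) :
    Trunc fun y : ℤ × ℤ => dif (1, 0) (0, 0, 1) Z (y.1, y.2, r) := by
  obtain ⟨P, hP⟩ := hZ r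
  obtain ⟨Q, hQ⟩ := hZ (r + 1)
  refine ⟨max P Q, fun p q hpq => ?_⟩
  have h1 := hP (p + 1) q (by omega)
  have h2 := hQ p q (by omega)
  simp only at h1 h2
  simp [h1, h2]

theorem trunc_dif₂ {Z : ℤ × ℤ × ℤ → E} (hZ : ∀ r, Trunc fun y : ℤ × ℤ => Z (y.1, y.2, r)) (r : ℤ) :
    Trunc fun y : ℤ × ℤ => dif (0, 1, 0) (0, 0, 1) Z (y.1, y.2, r) := by
  obtain ⟨P, hP⟩ := hZ r
  obtain ⟨Q, hQ⟩ := hZ (r + 1)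
  refine ⟨max P Q, fun p q hpq => ?_⟩
  have h1 := hP p (q + 1) (by omega)
  have h2 := hQ p q (by omega)
  simp only at h1 h2
  simp [h1, h2]

/-- On the diagonal z₁ = z₂ = z each factor z - w may be lifted to z₁ - w or to z₂ - w. In Dong's
lemma some of the factors are spent on the locality of a with d and the others on that of b with d.
-/
theorem dif_pow_diag {Z : ℤ × ℤ × ℤ → E} (hZ : ∀ r, Trunc fun y : ℤ × ℤ => Z (y.1, y.2, r))
    (m₁ m₂ : ℕ) :
    (dif (1, 0) (0, 1) ^ (m₁ + m₂))
        (fun y : ℤ × ℤ => diag (fun u : ℤ × ℤ => Z (u.1, u.2, y.2)) y.1) =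
      fun y : ℤ × ℤ => diag (fun u : ℤ × ℤ => ((dif (1, 0) (0, 0, 1) ^ m₁)
        ((dif (0, 1, 0) (0, 0, 1) ^ m₂) Z)) (u.1, u.2, y.2)) y.1 := by
  induction m₂ generalizing Z with
  | zero =>
    induction m₁ generalizing Z with
    | zero => simp
    | succ m₁ ih =>
      simp only [add_zero, pow_succ, Module.End.mul_apply, dif_diag₁ hZ, pow_zero,
        Module.End.one_apply] at ih ⊢
      exact ih (trunc_dif₁ hZ)
  | succ m₂ ih =>
    simp only [← add_assoc, pow_succ, Module.End.mul_apply, dif_diag₂ hZ]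
    exact ih (trunc_dif₂ hZ)

/-- Dong's lemma. -/
theorem Loc.fieldProd {N₁ N₂ : ℕ} {ε₁ ε₂ : ℂ} (had : Loc N₁ ε₁ a d) (hbd : Loc N₂ ε₂ b d) :
    Loc (N₁ + j + N₂) (ε₁ * ε₂) (fieldProd N j a b h) d := by
  intro x
  -- `L r` takes an operator to its supercommutator with the r-th mode of d, applied to x. Below,
  -- `H` is the three-variable series of a(z₁) b(z₂) under `L`, `G` is (z₁ - z₂)^N H, and `Z` is
  -- ∂₁^j G / j!, whose diagonal is the supercommutator of the product field with d(w).
  set L : ℤ → Module.End ℂ E →ₗ[ℂ] E := fun r =>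
    LinearMap.applyₗ (d r x) - (ε₁ * ε₂) • (d r).comp (LinearMap.applyₗ x) with hLdef
  have hL : ∀ r A, L r A = A (d r x) - (ε₁ * ε₂) • d r (A x) := fun r A => rfl
  set H : ℤ × ℤ × ℤ → E := fun y => L y.2.2 (a y.1 * b y.2.1) with hH
  set G : ℤ × ℤ × ℤ → E := (dif (1, 0) (0, 1, 0) ^ N) H with hG
  have hG' : ∀ r, (fun y : ℤ × ℤ => G (y.1, y.2, r)) = fun y => L r (ope N a b y) := by
    intro r
    rw [ope, ← dif_pow_map, hG]
    exact (dif_pow_comp (v := ((1, 0) : ℤ × ℤ)) (w := (0, 1)) (v' := ((1, 0) : ℤ × ℤ × ℤ))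
      (w' := (0, 1, 0)) (fun y : ℤ × ℤ => (y.1, y.2, r)) (fun y => by ext <;> simp) (fun y => by ext <;> simp)
      N H).symm
  set Z : ℤ × ℤ × ℤ → E := ((j.factorial : ℂ)⁻¹) • (der₁ ^ j) G with hZ
  have hZ' : ∀ r, (fun y : ℤ × ℤ => Z (y.1, y.2, r)) = fun y => L r (opeDer N j a b y) := by
    intro r
    rw [opeDer_map, ← hG' r, hZ]
    have := der₁_pow_comp (fun q : ℤ => (q, r)) j G
    rw [this]
    rfl
  have ht : ∀ r, Trunc fun y => L r (ope N a b y) := fun r =>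
    (h (d r x)).sub (((h x).map (d r)).smul (ε₁ * ε₂))
  have hZt : ∀ r, Trunc fun y : ℤ × ℤ => Z (y.1, y.2, r) := fun r => by
    rw [hZ' r]; exact trunc_opeDer_map j (L r) (ht r)
  have hF : (fun y : ℤ × ℤ => VertexConstruction.fieldProd N j a b h y.1 (d y.2 x)) -
      (ε₁ * ε₂) • (fun y : ℤ × ℤ => d y.2 (VertexConstruction.fieldProd N j a b h y.1 x)) =
      fun y : ℤ × ℤ => diag (fun u : ℤ × ℤ => Z (u.1, u.2, y.2)) y.1 := by
    ext ⟨n, r⟩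
    simp only [Pi.sub_apply, Pi.smul_apply, hZ', hL, fieldProd_apply]
    have t := trunc_opeDer h j
    have e := diag_sub (t (d r x)) (((t x).map (d r)).smul (ε₁ * ε₂)) n
    rw [diag_smul _ ((t x).map (d r)), diag_map (d r) (t x)] at e
    exact e.symm
  have hH0 : (dif (1, 0) (0, 0, 1) ^ N₁) ((dif (0, 1, 0) (0, 0, 1) ^ N₂) H) = 0 := by
    -- The field d is moved first past b and then past a. The first summand is killed by (z₂ -
    -- w)^N₂, the second by (z₁ - w)^N₁.
    have hsplit : H = (fun y : ℤ × ℤ × ℤ => a y.1 (b y.2.1 (d y.2.2 x) -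
        ε₂ • d y.2.2 (b y.2.1 x))) + fun y : ℤ × ℤ × ℤ =>
        ε₂ • (a y.1 (d y.2.2 (b y.2.1 x)) - ε₁ • d y.2.2 (a y.1 (b y.2.1 x))) := by
      ext ⟨p, q, r⟩
      simp only [hH, hL, Pi.add_apply, Module.End.mul_apply, map_sub, map_smul]
      module
    have k1 : (dif (0, 1, 0) (0, 0, 1) ^ N₂) (fun y : ℤ × ℤ × ℤ => a y.1 (b y.2.1 (d y.2.2 x) -
        ε₂ • d y.2.2 (b y.2.1 x))) = 0 := by
      ext ⟨p, q, r⟩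
      have e1 := congrFun (dif_pow_comp (v := ((1, 0) : ℤ × ℤ)) (w := (0, 1))
        (v' := ((0, 1, 0) : ℤ × ℤ × ℤ)) (w' := (0, 0, 1)) (fun y : ℤ × ℤ => (p, y.1, y.2))
        (fun y => by ext <;> simp) (fun y => by ext <;> simp) N₂ (fun y : ℤ × ℤ × ℤ => a y.1 (b y.2.1 (d y.2.2 x) -
          ε₂ • d y.2.2 (b y.2.1 x)))) (q, r)
      rw [← e1]
      simp only []
      rw [dif_pow_map _ _ (a p)]
      have e2 : (fun y : ℤ × ℤ => b y.1 (d y.2 x) - ε₂ • d y.2 (b y.1 x)) =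
        (fun y : ℤ × ℤ => b y.1 (d y.2 x)) - ε₂ • fun y => d y.2 (b y.1 x) := rfl
      rw [e2, map_sub, map_smul, hbd x, sub_self]
      simp
    have k2 : (dif (1, 0) (0, 0, 1) ^ N₁) (fun y : ℤ × ℤ × ℤ =>
        ε₂ • (a y.1 (d y.2.2 (b y.2.1 x)) - ε₁ • d y.2.2 (a y.1 (b y.2.1 x)))) = 0 := by
      ext ⟨p, q, r⟩
      have e1 := congrFun (dif_pow_comp (v := ((1, 0) : ℤ × ℤ)) (w := (0, 1))
        (v' := ((1, 0) : ℤ × ℤ × ℤ)) (w' := (0, 0, 1)) (fun y : ℤ × ℤ => (y.1, q, y.2))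
        (fun y => by ext <;> simp) (fun y => by ext <;> simp) N₁ (fun y : ℤ × ℤ × ℤ =>
          ε₂ • (a y.1 (d y.2.2 (b y.2.1 x)) - ε₁ • d y.2.2 (a y.1 (b y.2.1 x))))) (p, r)
      rw [← e1]
      have e2 : (fun y : ℤ × ℤ => ε₂ • (a y.1 (d y.2 (b q x)) - ε₁ • d y.2 (a y.1 (b q x)))) =
        ε₂ • ((fun y : ℤ × ℤ => a y.1 (d y.2 (b q x))) - ε₁ • fun y => d y.2 (a y.1 (b q x))) := rfl
      simp only []
      rw [e2, map_smul, map_sub, map_smul, had (b q x), sub_self]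
      simp
    have hc : Commute (dif (1, 0) (0, 0, 1) ^ N₁ : Module.End ℂ (ℤ × ℤ × ℤ → E))
      (dif (0, 1, 0) (0, 0, 1) ^ N₂) := (dif_commute _ _ _ _).pow_pow _ _
    rw [hsplit, map_add, k1, zero_add, ← Module.End.mul_apply, hc.eq, Module.End.mul_apply, k2,
      map_zero]
  have hG0 : (dif (1, 0) (0, 0, 1) ^ N₁) ((dif (0, 1, 0) (0, 0, 1) ^ N₂) G) = 0 := by
    have hc : Commute ((dif (1, 0) (0, 0, 1) ^ N₁ : Module.End ℂ (ℤ × ℤ × ℤ → E)) *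
        (dif (0, 1, 0) (0, 0, 1) ^ N₂)) (dif (1, 0) (0, 1, 0) ^ N) :=
      ((dif_commute _ _ _ _).pow_pow _ _).mul_left ((dif_commute _ _ _ _).pow_pow _ _)
    rw [← Module.End.mul_apply, hG, ← Module.End.mul_apply, hc.eq, Module.End.mul_apply,
      Module.End.mul_apply, hH0, map_zero]
  -- Each ∂₁ raises the required power of z₁ - w by one, and it leaves the factors z₂ - w alone.
  have hD0 : ∀ i : ℕ, (dif (1, 0) (0, 0, 1) ^ (N₁ + i))
      ((der₁ ^ i) ((dif (0, 1, 0) (0, 0, 1) ^ N₂) G)) = 0 := by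
    intro i
    induction i with
    | zero => simpa using hG0
    | succ i ih =>
      rw [pow_succ' der₁, Module.End.mul_apply, ← add_assoc]
      exact dif_pow_succ_der₁ _ _ ih
  have hZ0 : (dif (1, 0) (0, 0, 1) ^ (N₁ + j)) ((dif (0, 1, 0) (0, 0, 1) ^ N₂) Z) = 0 := by
    have hc : Commute (dif (0, 1, 0) (0, 0, 1) ^ N₂ : Module.End ℂ (ℤ × ℤ × ℤ → E)) (der₁ ^ j) :=
      (der₁_commute_dif _ _).symm.pow_pow _ _
    rw [hZ, map_smul, ← Module.End.mul_apply _ (der₁ ^ j), hc.eq, Module.End.mul_apply, map_smul,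
      hD0 j, smul_zero]
  have h0 := dif_pow_diag hZt (N₁ + j) N₂
  rw [hZ0, ← hF, map_sub, map_smul, sub_eq_iff_eq_add] at h0
  rw [h0]
  ext y
  simp only [Pi.add_apply]
  rw [show (fun u : ℤ × ℤ => (0 : ℤ × ℤ × ℤ → E) (u.1, u.2, y.2)) = 0 from rfl, diag_zero, zero_add]

/-- The index -1 belongs to z₂^0: for a power series in z₂ one may set z₂ = 0, and (z₁ - z₂)^N
becomes z₁^N. -/
theorem dif_pow_apply_neg_one {M : Type*} [AddCommGroup M] [Module ℂ M] {F : ℤ × ℤ → M}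
    (hF : ∀ p q, 0 ≤ q → F (p, q) = 0) (N : ℕ) (p : ℤ) :
    (dif (1, 0) (0, 1) ^ N) F (p, -1) = F (p + N, -1) := by
  induction N generalizing F with
  | zero => simp
  | succ N ih =>
    rw [pow_succ, Module.End.mul_apply, ih]
    · simp [hF _ 0 le_rfl, add_assoc]
    · intro p q hq
      simp [hF _ q hq, hF p (q + 1) (by omega)]

theorem der₁_pow_apply_neg_one {M : Type*} [AddCommGroup M] [Module ℂ M] (F : ℤ × ℤ → M)
    (j : ℕ) (q : ℤ) : (der₁ ^ j) F (-1, q) = (j.factorial : ℂ) • F (-1 - j, q) := by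
  induction j generalizing F with
  | zero => simp
  | succ j ih =>
    rw [pow_succ, Module.End.mul_apply, ih, der₁_apply, smul_smul, Nat.factorial_succ]
    push_cast
    rw [show (-1 - (j : ℤ) - 1) = -1 - (j + 1) by ring]
    congr 1
    ring

theorem der₁_pow_eq_zero {M : Type*} [AddCommGroup M] [Module ℂ M] {F : ℤ × ℤ → M}
    (hF : ∀ p q, 0 ≤ p ∨ 0 ≤ q → F (p, q) = 0) (j : ℕ) :
    ∀ p q, 0 ≤ p ∨ 0 ≤ q → (der₁ ^ j) F (p, q) = 0 := by
  induction j with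
  | zero => simpa using hF
  | succ j ih =>
    intro p q h
    rw [pow_succ', Module.End.mul_apply, der₁_apply]
    by_cases hp : p = 0
    · simp [hp]
    · rw [ih _ _ (by omega), smul_zero]

section Creation

variable {vac : E} (hab : Loc N ε a b) (ha : ∀ n, 0 ≤ n → a n vac = 0)
  (hb : ∀ n, 0 ≤ n → b n vac = 0)

include hab ha hb

/-- The argument of `Loc.trunc` with the bound 0: applied to the vacuum, the series contains no
negative powers of z₁ or z₂. -/
theorem Loc.ope_vac {p q : ℤ} (hpq : 0 ≤ p ∨ 0 ≤ q) : ope N a b (p, q) vac = 0 := by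
  rw [ope_apply]
  rcases hpq with h | h
  · rw [hab vac, Pi.smul_apply, dif_pow_eq_zero (s := fun y => 0 ≤ y.1) ?_ ?_ N ?_ (p, q) h,
      smul_zero]
    · rintro ⟨p, q⟩ h; simp only [Prod.mk_add_mk] at h ⊢; omega
    · rintro ⟨p, q⟩ h; simp only [Prod.mk_add_mk] at h ⊢; omega
    · intro y hy; rw [ha _ hy, map_zero]
  · rw [dif_pow_eq_zero (s := fun y => 0 ≤ y.2) ?_ ?_ N ?_ (p, q) h]
    · rintro ⟨p, q⟩ h; simp only [Prod.mk_add_mk] at h ⊢; omega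
    · rintro ⟨p, q⟩ h; simp only [Prod.mk_add_mk] at h ⊢; omega
    · intro y hy; rw [hb _ hy, map_zero]

theorem Loc.opeDer_vac {p q : ℤ} (hpq : 0 ≤ p ∨ 0 ≤ q) : opeDer N j a b (p, q) vac = 0 := by
  have := congrFun (opeDer_map N j a b (LinearMap.applyₗ vac)) (p, q)
  simp only [LinearMap.applyₗ_apply_apply] at this
  rw [this, Pi.smul_apply, der₁_pow_eq_zero (fun p q h => hab.ope_vac ha hb h) j p q hpq,
    smul_zero]

theorem Loc.fieldProd_vac {n : ℤ} (hn : 0 ≤ n) : VertexConstruction.fieldProd N j a b h n vac = 0 := by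
  rw [fieldProd_apply, diag, finsum_congr (g := fun _ => (0 : E)), finsum_zero]
  intro p
  exact hab.opeDer_vac ha hb (by omega)

/-- The two indices add up to -2 and are both negative, so only the constant term (-1, -1) survives.
There ∂₁^j / j! picks the coefficient of z₁^j, and (z₁ - z₂)^N acts as z₁^N. -/
theorem Loc.fieldProd_neg_one_vac :
    VertexConstruction.fieldProd N j a b h (-1) vac = a (N - 1 - j) (b (-1) vac) := by
  rw [fieldProd_apply, diag, finsum_eq_single _ (-1 : ℤ)]
  · have := congrFun (opeDer_map N j a b (LinearMap.applyₗ vac)) (-1, -1 - 1 - -1)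
    simp only [LinearMap.applyₗ_apply_apply] at this
    rw [this, Pi.smul_apply, der₁_pow_apply_neg_one, smul_smul,
      inv_mul_cancel₀ (by exact_mod_cast j.factorial_ne_zero), one_smul, ope_apply]
    rw [show (-1 - 1 - -1 : ℤ) = -1 by norm_num, dif_pow_apply_neg_one]
    · simp only
      congr 2
      ring
    · intro p q hq
      simp [hb q hq]
  · intro p hp
    exact hab.opeDer_vac ha hb (by omega)

end Creation

/-- The field `a` has weight `h / 2`. -/
def Homog (gr : ℤ → Submodule ℂ E) (h : ℤ) (a : ℤ → Module.End ℂ E) : Prop :=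
  ∀ n m m' x, x ∈ gr m → m' = m + h - 2 * n - 2 → a n x ∈ gr m'

/-- The analogue of `Homog` for two variables. -/
def Homog₂ (gr : ℤ → Submodule ℂ E) (w : ℤ) (F : ℤ × ℤ → Module.End ℂ E) : Prop :=
  ∀ p q m m' x, x ∈ gr m → m' = m + w - 2 * (p + q) → F (p, q) x ∈ gr m'

variable {gr : ℤ → Submodule ℂ E}

theorem Homog₂.dif {w : ℤ} {F : ℤ × ℤ → Module.End ℂ E} (hF : Homog₂ gr w F) (N : ℕ) :
    Homog₂ gr (w - 2 * N) ((dif (1, 0) (0, 1) ^ N) F) := by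
  induction N with
  | zero => simpa using hF
  | succ N ih =>
    intro p q m m' x hx hm
    rw [pow_succ', Module.End.mul_apply, dif_apply, LinearMap.sub_apply]
    exact sub_mem (ih _ _ m m' x hx (by push_cast at hm; simp; linarith))
      (ih _ _ m m' x hx (by push_cast at hm; simp; linarith))

theorem Homog₂.der₁ {w : ℤ} {F : ℤ × ℤ → Module.End ℂ E} (hF : Homog₂ gr w F) (j : ℕ) :
    Homog₂ gr (w + 2 * j) ((der₁ ^ j) F) := by
  induction j with
  | zero => simpa using hF
  | succ j ih =>
    intro p q m m' x hx hm
    rw [pow_succ', Module.End.mul_apply, der₁_apply, LinearMap.smul_apply]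
    exact Submodule.smul_mem _ _ (ih _ _ m m' x hx (by push_cast at hm; linarith))

theorem Homog.homog₂ {h g : ℤ} (ha : Homog gr h a) (hb : Homog gr g b) :
    Homog₂ gr (h + g - 4) fun y => a y.1 * b y.2 := by
  intro p q m m' x hx hm
  exact ha p (m + g - 2 * q - 2) m' _ (hb q m _ x hx rfl) (by rw [hm]; ring)

theorem Homog.opeDer {h g : ℤ} (ha : Homog gr h a) (hb : Homog gr g b) :
    Homog₂ gr (h + g - 4 - 2 * N + 2 * j) (opeDer N j a b) := by
  intro p q m m' x hx hm
  exact Submodule.smul_mem _ _ (((ha.homog₂ hb).dif N).der₁ j p q m m' x hx hm)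

theorem Homog.fieldProd {h' g : ℤ} (ha : Homog gr h' a) (hb : Homog gr g b) :
    Homog gr (h' + g - 2 * N + 2 * j) (fieldProd N j a b h) := by
  intro n m m' x hx hm
  rw [fieldProd_apply, diag]
  refine finsum_induction (· ∈ gr m') (zero_mem _) (fun _ _ => add_mem) fun p => ?_
  exact ha.opeDer hb _ _ m m' x hx (by rw [hm]; ring)

end FormalFields

/-! ### Homogeneous vectors and operators. -/

section Grading

variable (V : ℤ → Type u) [∀ n, AddCommGroup (V n)] [∀ n, Module ℂ (V n)]

/-- The homogeneous subspace of weight `m / 2`. -/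
def gr (m : ℤ) : Submodule ℂ (Space V) where
  carrier := {x | ∀ n, n ≠ m → x n = 0}
  add_mem' hx hy n hn := by rw [DirectSum.add_apply, hx n hn, hy n hn, add_zero]
  zero_mem' n _ := rfl
  smul_mem' c x hx n hn := by rw [DirectSum.smul_apply, hx n hn, smul_zero]

variable {V}

theorem lof_apply_of_ne {m n : ℤ} (h : n ≠ m) (x : V m) : DirectSum.lof ℂ ℤ V m x n = 0 :=
  DirectSum.of_eq_of_ne m n x h

theorem lof_mem_gr (m : ℤ) (x : V m) : DirectSum.lof ℂ ℤ V m x ∈ gr V m :=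
  fun _ hn => lof_apply_of_ne hn x

theorem eq_lof_of_mem_gr {m : ℤ} {x : Space V} (hx : x ∈ gr V m) :
    x = DirectSum.lof ℂ ℤ V m (x m) := by
  refine DFinsupp.ext fun n => ?_
  by_cases hn : n = m
  · subst hn; exact (DirectSum.lof_apply (R := ℂ) n (x n)).symm
  · rw [hx n hn]; exact (lof_apply_of_ne hn _).symm

theorem space_induction {p : Space V → Prop} (h0 : p 0) (hadd : ∀ x y, p x → p y → p (x + y))
    (h : ∀ m, ∀ x ∈ gr V m, p x) (x : Space V) : p x :=
  DirectSum.induction_on x h0 (fun m x => h m _ (lof_mem_gr m x)) hadd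

theorem proj_incl (m : ℤ) (x : Space V) : proj m (incl x) = DirectSum.lof ℂ ℤ V m (x m) := rfl

theorem proj_incl_of_mem {m : ℤ} {x : Space V} (hx : x ∈ gr V m) : proj m (incl x) = x := by
  rw [proj_incl, ← eq_lof_of_mem_gr hx]

theorem proj_mem_gr (m : ℤ) (x : Compl V) : proj m x ∈ gr V m := lof_mem_gr m _

theorem incl_apply (x : Space V) (n : ℤ) : incl x n = x n := rfl

theorem incl_injective : Function.Injective (incl : Space V →ₗ[ℂ] Compl V) := fun _ _ h =>
  DFinsupp.ext fun n => congrFun h n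

theorem vacuum_mem_gr (vac : V 0) : vacuum vac ∈ gr V 0 := lof_mem_gr 0 vac

/-- For large n the weight of a_n x falls below the lower bound of the grading. -/
theorem Homog.isField (hV : GradingRestricted V) {h : ℤ} {a : ℤ → Module.End ℂ (Space V)}
    (ha : Homog (gr V) h a) : IsField a := by
  obtain ⟨N, hN⟩ := hV.lower
  intro x
  induction x using space_induction with
  | h0 => exact ⟨0, fun n _ => map_zero _⟩
  | hadd x y hx hy =>
    obtain ⟨P, hP⟩ := hx
    obtain ⟨Q, hQ⟩ := hy
    exact ⟨max P Q, fun n hn => by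
      rw [map_add, hP n (le_trans (le_max_left _ _) hn), hQ n (le_trans (le_max_right _ _) hn),
        add_zero]⟩
  | h m x hx =>
    refine ⟨|m + h| + |N|, fun n hn => ?_⟩
    have h1 := ha n m _ x hx rfl
    have hlt : m + h - 2 * n - 2 < N := by
      have := le_abs_self (m + h); have := neg_abs_le N; have := abs_nonneg (m + h)
      have := abs_nonneg N
      omega
    rw [eq_lof_of_mem_gr h1, @Subsingleton.elim _ (hN _ hlt) (a n x _) 0, map_zero]

theorem Homog.proj_comm {h : ℤ} {a : ℤ → Module.End ℂ (Space V)} (ha : Homog (gr V) h a)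
    (n m : ℤ) (x : Space V) :
    proj m (incl (a n x)) = a n (proj (m - h + 2 * n + 2) (incl x)) := by
  induction x using space_induction with
  | h0 => simp
  | hadd x y hx hy => simp only [map_add, hx, hy]
  | h l x hx =>
    have h1 := ha n l _ x hx rfl
    by_cases hl : l = m - h + 2 * n + 2
    · rw [← hl, proj_incl_of_mem hx, proj_incl_of_mem]
      convert h1 using 1
      rw [hl]; ring_nf
    · rw [proj_incl, proj_incl, hx _ (Ne.symm hl), h1 m (by omega), map_zero, map_zero, map_zero]

end Grading

/-- The sign `(-1)^(h g)`. -/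
def sgn (h g : ℤ) : ℂ := (-1) ^ (h * g)

theorem sgn_comm (h g : ℤ) : sgn h g = sgn g h := by rw [sgn, sgn, mul_comm]

theorem sgn_add (h h' g : ℤ) : sgn (h + h') g = sgn h g * sgn h' g := by
  rw [sgn, add_mul, zpow_add₀ (by norm_num)]; rfl

theorem sgn_even (h g : ℤ) : sgn (2 * h) g = 1 := by
  rw [sgn, mul_assoc]
  exact Even.neg_one_zpow ⟨h * g, by ring⟩

theorem sgn_add_even (h h' g : ℤ) : sgn (h + 2 * h') g = sgn h g := by
  rw [sgn_add, sgn_even, mul_one]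

theorem sgn_mul_self (h g : ℤ) : sgn h g * sgn h g = 1 := by
  rw [← sgn_add, ← two_mul, sgn_even]

/-! ### The state-field correspondence. -/

section StateField

variable {V : ℤ → Type u} [∀ n, AddCommGroup (V n)] [∀ n, Module ℂ (V n)] {I : Type v}

/-- The properties of the modes of the generating fields that concern a single field. -/
structure CovariantModes (vac : V 0) (φ : I → ℤ → Module.End ℂ (Space V)) (wt : I → ℤ)
    (D : Module.End ℂ (Space V)) : Prop where
  grading : GradingRestricted V
  homog : ∀ i, Homog (gr V) (wt i) (φ i)
  cov : ∀ i, Cov D (φ i)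
  D_vacuum : D (vacuum vac) = 0
  creation : ∀ i n, 0 ≤ n → φ i n (vacuum vac) = 0
  span : ∀ W : Submodule ℂ (Space V), vacuum vac ∈ W →
    (∀ i n x, x ∈ W → φ i n x ∈ W) → W = ⊤

/-- The properties of the modes of the generating fields. -/
structure GeneratingModes (vac : V 0) (φ : I → ℤ → Module.End ℂ (Space V)) (wt : I → ℤ)
    (D : Module.End ℂ (Space V)) : Prop extends CovariantModes vac φ wt D where
  loc : ∀ i j, ∃ N, Loc N (sgn (wt i) (wt j)) (φ i) (φ j)

/-- The fields of weight `h / 2` that are covariant, create a vector from the vacuum and are local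
with the generating fields. -/
def fields (vac : V 0) (φ : I → ℤ → Module.End ℂ (Space V)) (wt : I → ℤ)
    (D : Module.End ℂ (Space V)) (h : ℤ) : Submodule ℂ (ℤ → Module.End ℂ (Space V)) where
  -- Locality is only demanded with the generating fields, which suffices for uniqueness; locality
  -- between any two of these fields comes later, in `state_loc`. The sign is read off the weights
  -- and is therefore multiplicative under products of fields.
  carrier := {a | Homog (gr V) h a ∧ Cov D a ∧ (∀ n, 0 ≤ n → a n (vacuum vac) = 0) ∧
    ∀ i, ∃ N, Loc N (sgn h (wt i)) a (φ i)}
  add_mem' := by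
    rintro a b ⟨h1, h2, h3, h4⟩ ⟨k1, k2, k3, k4⟩
    refine ⟨fun n m m' x hx hm => add_mem (h1 n m m' x hx hm) (k1 n m m' x hx hm), fun n => ?_,
      fun n hn => ?_, fun i => ?_⟩
    · rw [Pi.add_apply, mul_add, add_mul, add_sub_add_comm, h2 n, k2 n, Pi.add_apply, smul_add]
    · rw [Pi.add_apply, LinearMap.add_apply, h3 n hn, k3 n hn, add_zero]
    · obtain ⟨N, hN⟩ := h4 i
      obtain ⟨N', hN'⟩ := k4 i
      exact ⟨_, hN.add_left hN'⟩
  zero_mem' := ⟨fun n m m' x _ _ => zero_mem _, fun n => by simp, fun n _ => rfl,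
    fun i => ⟨0, Loc.zero_left⟩⟩
  smul_mem' := by
    rintro c a ⟨h1, h2, h3, h4⟩
    refine ⟨fun n m m' x hx hm => Submodule.smul_mem _ _ (h1 n m m' x hx hm), fun n => ?_,
      fun n hn => ?_, fun i => ?_⟩
    · rw [Pi.smul_apply, mul_smul_comm, smul_mul_assoc, Pi.smul_apply, smul_comm, ← h2 n]
      exact (smul_sub c _ _).symm
    · rw [Pi.smul_apply, LinearMap.smul_apply, h3 n hn, smul_zero]
    · obtain ⟨N, hN⟩ := h4 i
      exact ⟨N, hN.smul_left c⟩

/-- The modes of the identity operator. -/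
def idField : ℤ → Module.End ℂ (Space V) := fun n => if n = -1 then 1 else 0

theorem loc_idField (b : ℤ → Module.End ℂ (Space V)) : Loc 0 1 idField b := by
  intro x
  ext y
  simp only [idField, pow_zero, Module.End.one_apply, one_smul]
  split_ifs <;> simp

namespace CovariantModes

variable {vac : V 0} {φ : I → ℤ → Module.End ℂ (Space V)} {wt : I → ℤ}
  {D : Module.End ℂ (Space V)} (G : CovariantModes vac φ wt D)

include G

/-- The common kernel of the modes of a contains the vacuum and is stable under the generators by
locality, so it is V. The sign in the locality plays no role, and locality between the generators is
not needed; this allows its use in `fieldParity_eq`, where their signs are determined. -/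
theorem eq_zero_of_modes_vacuum {a : ℤ → Module.End ℂ (Space V)}
    (ha : ∀ i, ∃ N ε, Loc N ε a (φ i)) (h0 : ∀ n, a n (vacuum vac) = 0) : a = 0 := by
  have hW := G.span (⨅ n, LinearMap.ker (a n)) (by simpa [Submodule.mem_iInf] using h0) (by
    intro i q x hx
    obtain ⟨N, ε, hN⟩ := ha i
    simp only [Submodule.mem_iInf, LinearMap.mem_ker] at hx ⊢
    exact fun p => hN.apply_eq_zero ((G.homog i).isField G.grading) hx p q)
  refine funext fun n => LinearMap.ext fun x => ?_
  have : x ∈ ⨅ n, LinearMap.ker (a n) := hW ▸ Submodule.mem_top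
  simp only [Submodule.mem_iInf, LinearMap.mem_ker] at this
  exact this n

/-- As D kills the vacuum, covariance gives D a_n 𝟏 = -n a_{n-1} 𝟏, and the vanishing of a_{-1} 𝟏
passes to all lower modes. -/
theorem modes_vacuum_eq_zero {a : ℤ → Module.End ℂ (Space V)} (hD : Cov D a)
    (hc : ∀ n, 0 ≤ n → a n (vacuum vac) = 0) (h0 : a (-1) (vacuum vac) = 0) (n : ℤ) :
    a n (vacuum vac) = 0 := by
  have key : ∀ k : ℕ, a (-1 - k) (vacuum vac) = 0 := by
    intro k
    induction k with
    | zero => simpa using h0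
    | succ k ih =>
      have := LinearMap.congr_fun (hD (-1 - k)) (vacuum vac)
      simp only [LinearMap.sub_apply, Module.End.mul_apply, ih, map_zero, G.D_vacuum, sub_zero,
        LinearMap.smul_apply] at this
      have hne : (-((-1 - k : ℤ) : ℂ)) ≠ 0 := by
        have : (-(-1 - k : ℤ)) ≠ 0 := by omega
        exact_mod_cast this
      have := (smul_eq_zero.1 this.symm).resolve_left hne
      rw [← this]
      push_cast
      congr 2
      ring
  rcases le_or_gt 0 n with h | h
  · exact hc n h
  · have := key (-1 - n).toNat
    rwa [show -1 - ((-1 - n).toNat : ℤ) = n by omega] at this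

end CovariantModes

namespace GeneratingModes

variable {vac : V 0} {φ : I → ℤ → Module.End ℂ (Space V)} {wt : I → ℤ}
  {D : Module.End ℂ (Space V)} (G : GeneratingModes vac φ wt D)

include G

theorem gen_mem (i : I) : φ i ∈ fields vac φ wt D (wt i) :=
  ⟨G.homog i, G.cov i, G.creation i, fun j => G.loc i j⟩

theorem idField_mem : (idField : ℤ → Module.End ℂ (Space V)) ∈ fields vac φ wt D 0 := by
  refine ⟨fun n m m' x hx hm => ?_, fun n => ?_, fun n hn => ?_, fun i => ⟨0, ?_⟩⟩
  · unfold idField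
    split_ifs with h
    · rw [Module.End.one_apply, hm, h]; convert hx using 1; ring_nf
    · exact zero_mem _
  · unfold idField
    by_cases h : n = 0
    · simp [h]
    · rw [if_neg (by omega : ¬ n - 1 = -1), smul_zero]
      split_ifs <;> simp
  · rw [idField, if_neg (by omega)]; rfl
  · have : sgn 0 (wt i) = 1 := by simpa using sgn_even 0 (wt i)
    rw [this]
    exact loc_idField _

theorem isField {h : ℤ} {a : ℤ → Module.End ℂ (Space V)} (ha : a ∈ fields vac φ wt D h) :
    IsField a := ha.1.isField G.grading

theorem trunc {h g : ℤ} {a b : ℤ → Module.End ℂ (Space V)} {N : ℕ} {ε : ℂ}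
    (ha : a ∈ fields vac φ wt D h) (hb : b ∈ fields vac φ wt D g) (hab : Loc N ε a b) :
    ∀ x, Trunc fun y => ope N a b y x := hab.trunc (G.isField ha) (G.isField hb)

theorem fieldProd_mem {h g : ℤ} {a b : ℤ → Module.End ℂ (Space V)} {N : ℕ} {ε : ℂ} {j : ℕ}
    (ha : a ∈ fields vac φ wt D h) (hb : b ∈ fields vac φ wt D g) (hab : Loc N ε a b) :
    fieldProd N j a b (G.trunc ha hb hab) ∈ fields vac φ wt D (h + g - 2 * N + 2 * j) := by
  refine ⟨ha.1.fieldProd hb.1, ha.2.1.fieldProd hb.2.1,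
    fun n hn => hab.fieldProd_vac ha.2.2.1 hb.2.2.1 hn, fun i => ?_⟩
  obtain ⟨N₁, h₁⟩ := ha.2.2.2 i
  obtain ⟨N₂, h₂⟩ := hb.2.2.2 i
  refine ⟨N₁ + j + N₂, ?_⟩
  have : sgn (h + g - 2 * N + 2 * j) (wt i) = sgn h (wt i) * sgn g (wt i) := by
    rw [show h + g - 2 * (N : ℤ) + 2 * j = h + g + 2 * (j - N) by ring, sgn_add_even, sgn_add]
  rw [this]
  exact h₁.fieldProd h₂

/-- Goddard's uniqueness theorem. -/
theorem eq_zero_of_mem {h : ℤ} {a : ℤ → Module.End ℂ (Space V)} (ha : a ∈ fields vac φ wt D h)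
    (h0 : a (-1) (vacuum vac) = 0) : a = 0 :=
  G.toCovariantModes.eq_zero_of_modes_vacuum (fun i => (ha.2.2.2 i).imp fun _ h => ⟨_, h⟩)
    (G.toCovariantModes.modes_vacuum_eq_zero ha.2.1 ha.2.2.1 h0)

theorem vec_mem {h : ℤ} {a : ℤ → Module.End ℂ (Space V)} (ha : a ∈ fields vac φ wt D h) :
    a (-1) (vacuum vac) ∈ gr V h :=
  ha.1 (-1) 0 h _ (vacuum_mem_gr vac) (by ring)

/-- The order of locality can be enlarged until N' - 1 - m is a natural number, so the m-th product
exists for every integer m. The last clause records Dong's lemma for the field so obtained. -/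
theorem exists_prod {h g : ℤ} {a b : ℤ → Module.End ℂ (Space V)}
    (ha : a ∈ fields vac φ wt D h) (hb : b ∈ fields vac φ wt D g) {ε : ℂ}
    (hab : ∃ N, Loc N ε a b) (m : ℤ) :
    ∃ c ∈ fields vac φ wt D (h + g - 2 * m - 2), c (-1) (vacuum vac) = a m (b (-1) (vacuum vac)) ∧
      ∀ (d : ℤ → Module.End ℂ (Space V)) (ε₁ ε₂ : ℂ), (∃ N₁, Loc N₁ ε₁ a d) →
        (∃ N₂, Loc N₂ ε₂ b d) → ∃ N₃, Loc N₃ (ε₁ * ε₂) c d := by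
  obtain ⟨N, hN⟩ := hab
  have hN' := hN.mono (le_max_left N (m + 1).toNat)
  set N' := max N (m + 1).toNat with hN'def
  have hm : m + 1 ≤ N' := by
    have := le_max_right N (m + 1).toNat
    omega
  have hj : ((N' - 1 - m).toNat : ℤ) = N' - 1 - m := by omega
  refine ⟨fieldProd N' (N' - 1 - m).toNat a b (G.trunc ha hb hN'), ?_, ?_, ?_⟩
  · have := G.fieldProd_mem (j := (N' - 1 - m).toNat) ha hb hN'
    rw [hj] at this
    convert this using 1
    ring_nf
  · rw [hN'.fieldProd_neg_one_vac ha.2.2.1 hb.2.2.1, hj]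
    congr 2
    ring
  · rintro d ε₁ ε₂ ⟨N₁, h₁⟩ ⟨N₂, h₂⟩
    exact ⟨_, h₁.fieldProd h₂⟩

/-- The vectors all of whose components are created by fields form a subspace. It contains the
vacuum, and it is stable under φ^i_n because φ^i_n b_{-1} 𝟏 is created by the n-th product of φ^i
and b. -/
theorem exists_field (x : Space V) (h : ℤ) :
    ∃ a ∈ fields vac φ wt D h, a (-1) (vacuum vac) = proj h (incl x) := by
  have hW := G.span
    { carrier := {x | ∀ h, ∃ a ∈ fields vac φ wt D h, a (-1) (vacuum vac) = proj h (incl x)}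
      add_mem' := by
        intro x y hx hy h
        obtain ⟨a, ha, ha'⟩ := hx h
        obtain ⟨b, hb, hb'⟩ := hy h
        exact ⟨a + b, add_mem ha hb, by
          rw [Pi.add_apply, LinearMap.add_apply, ha', hb', map_add, map_add]⟩
      zero_mem' := fun h => ⟨0, zero_mem _, by simp⟩
      smul_mem' := by
        intro c x hx h
        obtain ⟨a, ha, ha'⟩ := hx h
        exact ⟨c • a, Submodule.smul_mem _ _ ha, by
          rw [Pi.smul_apply, LinearMap.smul_apply, ha', map_smul, map_smul]⟩ } ?_ ?_
  · have : x ∈ (⊤ : Submodule ℂ (Space V)) := trivial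
    rw [← hW] at this
    exact this h
  · intro h
    by_cases hh : h = 0
    · subst hh
      exact ⟨idField, G.idField_mem, by rw [proj_incl_of_mem (vacuum_mem_gr vac)]; simp [idField]⟩
    · exact ⟨0, zero_mem _, by rw [proj_incl, vacuum_mem_gr vac h hh]; simp⟩
  · intro i n x hx h
    obtain ⟨b, hb, hb'⟩ := hx (h - wt i + 2 * n + 2)
    obtain ⟨c, hc, hc', -⟩ := G.exists_prod (G.gen_mem i) hb
      ((hb.2.2.2 i).imp fun _ h => h.symm (sgn_mul_self _ _)) n
    refine ⟨c, ?_, ?_⟩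
    · convert hc using 1; ring_nf
    · rw [hc', hb', (G.homog i).proj_comm]

/-- The state-field correspondence on the homogeneous subspace of weight `h / 2`. -/
def vecEquiv (h : ℤ) : fields vac φ wt D h ≃ₗ[ℂ] V h :=
  LinearEquiv.ofBijective
    ((DirectSum.component ℂ ℤ V h).comp
      ((LinearMap.applyₗ (vacuum vac)).comp
        ((LinearMap.proj (-1)).comp (fields vac φ wt D h).subtype)))
    (by
      refine ⟨(injective_iff_map_eq_zero _).2 fun a ha => ?_, fun x => ?_⟩
      · refine Subtype.ext (G.eq_zero_of_mem a.2 ?_)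
        have h1 : (a.1 (-1) (vacuum vac)) h = 0 := ha
        rw [eq_lof_of_mem_gr (G.vec_mem a.2), h1, map_zero]
      · obtain ⟨a, ha, h1⟩ := G.exists_field (DirectSum.lof ℂ ℤ V h x) h
        refine ⟨⟨a, ha⟩, ?_⟩
        show (a (-1) (vacuum vac)) h = x
        rw [h1, proj_incl_of_mem (lof_mem_gr h x)]
        exact DirectSum.lof_apply (R := ℂ) h x)

/-- The modes of the vertex operators. -/
def state : Space V →ₗ[ℂ] (ℤ → Module.End ℂ (Space V)) :=
  DirectSum.toModule ℂ ℤ _ fun h =>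
    (fields vac φ wt D h).subtype.comp (G.vecEquiv h).symm.toLinearMap

theorem state_mem {h : ℤ} {x : Space V} (hx : x ∈ gr V h) :
    G.state x ∈ fields vac φ wt D h := by
  rw [eq_lof_of_mem_gr hx, state, DirectSum.toModule_lof]
  exact ((G.vecEquiv h).symm (x h)).2

/-- Identities between fields are proved below through this form of uniqueness, by comparing the
vectors they create. -/
theorem state_vec {h : ℤ} {a : ℤ → Module.End ℂ (Space V)} (ha : a ∈ fields vac φ wt D h) :
    G.state (a (-1) (vacuum vac)) = a := by
  rw [eq_lof_of_mem_gr (G.vec_mem ha), state, DirectSum.toModule_lof]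
  have : (a (-1) (vacuum vac)) h = G.vecEquiv h ⟨a, ha⟩ := rfl
  rw [this]
  simp

theorem state_vacuum_neg_one (x : Space V) : G.state x (-1) (vacuum vac) = x := by
  induction x using space_induction with
  | h0 => simp
  | hadd x y hx hy => rw [map_add, Pi.add_apply, LinearMap.add_apply, hx, hy]
  | h m x hx =>
    obtain ⟨a, ha, h1⟩ := G.exists_field x m
    rw [proj_incl_of_mem hx] at h1
    rw [← h1, G.state_vec ha]

theorem state_vacuum : G.state (vacuum vac) = idField := by
  have := G.state_vec G.idField_mem
  simpa [idField] using this

theorem state_gen (i : I) : G.state (φ i (-1) (vacuum vac)) = φ i := G.state_vec (G.gen_mem i)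

/-- For fixed x, the vectors y whose components have fields local with that of x form a subspace
stable under the generators, by Dong's lemma for the products of φ^i with the fields of these
components. -/
theorem state_loc {h g : ℤ} {x y : Space V} (hx : x ∈ gr V h) (hy : y ∈ gr V g) :
    ∃ N, Loc N (sgn h g) (G.state x) (G.state y) := by
  have hW := G.span
    { carrier := {y | ∀ g, ∃ N, Loc N (sgn g h) (G.state (proj g (incl y))) (G.state x)}
      add_mem' := by
        intro y z hy hz g
        obtain ⟨N, hN⟩ := hy g
        obtain ⟨N', hN'⟩ := hz g
        exact ⟨_, by simpa only [map_add] using hN.add_left hN'⟩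
      zero_mem' := fun g => ⟨0, by simpa only [map_zero] using Loc.zero_left⟩
      smul_mem' := by
        intro c y hy g
        obtain ⟨N, hN⟩ := hy g
        exact ⟨N, by simpa only [map_smul] using hN.smul_left c⟩ } ?_ ?_
  · have : y ∈ (⊤ : Submodule ℂ (Space V)) := trivial
    rw [← hW] at this
    obtain ⟨N, hN⟩ := this g
    rw [proj_incl_of_mem hy] at hN
    exact ⟨N, sgn_comm g h ▸ hN.symm (sgn_mul_self _ _)⟩
  · intro g
    by_cases hg : g = 0
    · subst hg
      rw [proj_incl_of_mem (vacuum_mem_gr vac), G.state_vacuum]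
      exact ⟨0, by rw [show sgn 0 h = 1 by simpa using sgn_even 0 h]; exact loc_idField _⟩
    · exact ⟨0, by rw [proj_incl, vacuum_mem_gr vac g hg, map_zero, map_zero]; exact Loc.zero_left⟩
  · intro i n y hy g
    have hb := G.state_mem (proj_mem_gr (g - wt i + 2 * n + 2) (incl y))
    obtain ⟨c, hc, hc', hloc⟩ := G.exists_prod (G.gen_mem i) hb
      ((hb.2.2.2 i).imp fun _ h => h.symm (sgn_mul_self _ _)) n
    have h1 : proj g (incl (φ i n y)) = c (-1) (vacuum vac) := by
      rw [hc', G.state_vacuum_neg_one, (G.homog i).proj_comm]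
    rw [h1, G.state_vec hc]
    obtain ⟨N, hN⟩ := hloc (G.state x) (sgn (wt i) h) _
      (((G.state_mem hx).2.2.2 i).imp fun _ h' => sgn_comm h (wt i) ▸ h'.symm (sgn_mul_self _ _))
      (hy _)
    refine ⟨N, ?_⟩
    convert hN using 1
    -- The weight g differs by an even number from the sum of the weights of the two factors, so the
    -- sign is unchanged.
    rw [← sgn_add, show g = g - wt i + 2 * n + 2 + wt i + 2 * (-n - 1) by ring, sgn_add_even]
    congr 1
    ring

/-- Both fields create the vector x_{N-1-j} y. This is the operator product expansion, from which
associativity is derived. -/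
theorem state_prod {h g : ℤ} {x y : Space V} (hx : x ∈ gr V h) (hy : y ∈ gr V g) {N : ℕ} {ε : ℂ}
    (hl : Loc N ε (G.state x) (G.state y)) (j : ℕ) :
    G.state (G.state x (N - 1 - j) y) = fieldProd N j (G.state x) (G.state y)
      (G.trunc (G.state_mem hx) (G.state_mem hy) hl) := by
  have ha := G.state_mem hx
  have hb := G.state_mem hy
  rw [← G.state_vec (G.fieldProd_mem (j := j) ha hb hl),
    hl.fieldProd_neg_one_vac ha.2.2.1 hb.2.2.1, G.state_vacuum_neg_one]

/-- The vector x_n y is the coefficient at (n - N, -1) of (z₁ - z₂)^N a(z₁) b(z₂) 𝟏, where a and b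
are the fields of x and y, and this series has no negative powers of z₁. -/
theorem state_eq_zero_of_le {h g : ℤ} {x y : Space V} (hx : x ∈ gr V h) (hy : y ∈ gr V g) {N : ℕ}
    {ε : ℂ} (hl : Loc N ε (G.state x) (G.state y)) {n : ℤ} (hn : N ≤ n) :
    G.state x n y = 0 := by
  have ha := G.state_mem hx
  have hb := G.state_mem hy
  have h1 := hl.ope_vac ha.2.2.1 hb.2.2.1 (p := n - N) (q := -1) (Or.inl (by omega))
  rw [ope_apply, dif_pow_apply_neg_one] at h1
  · simpa [G.state_vacuum_neg_one] using h1
  · intro p q hq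
    simp [hb.2.2.1 q hq]

theorem D_eq_mode {h : ℤ} {x : Space V} (hx : x ∈ gr V h) : D x = G.state x (-2) (vacuum vac) := by
  have ha := G.state_mem hx
  have := LinearMap.congr_fun (ha.2.1 (-1)) (vacuum vac)
  simp only [LinearMap.sub_apply, Module.End.mul_apply, G.state_vacuum_neg_one, G.D_vacuum,
    map_zero, sub_zero, LinearMap.smul_apply] at this
  rw [this]
  norm_num

/-- The derivative of the field of x has its weight raised by one, which is 2 in half units. It
belongs to `fields` and creates x_{-2} 𝟏 = D x. -/
theorem state_D (x : Space V) (n : ℤ) : G.state (D x) n = (-(n : ℂ)) • G.state x (n - 1) := by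
  induction x using space_induction generalizing n with
  | h0 => simp
  | hadd x y hx hy => simp only [map_add, Pi.add_apply, hx, hy, smul_add]
  | h m x hx =>
    have ha := G.state_mem hx
    set a := G.state x with hadef
    have hd : (fun n : ℤ => (-(n : ℂ)) • a (n - 1)) ∈ fields vac φ wt D (m + 2) := by
      refine ⟨fun n l l' y hy hl => ?_, fun n => ?_, fun n hn => ?_, fun i => ?_⟩
      · exact Submodule.smul_mem _ _ (ha.1 (n - 1) l l' y hy (by rw [hl]; ring))
      · show D * ((-(n : ℂ)) • a (n - 1)) - ((-(n : ℂ)) • a (n - 1)) * D = _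
        rw [mul_smul_comm, smul_mul_assoc]
        exact (smul_sub _ _ _).symm.trans (congrArg _ (ha.2.1 (n - 1)))
      · show (-(n : ℂ)) • a (n - 1) (vacuum vac) = 0
        by_cases h : n = 0
        · simp [h]
        · rw [ha.2.2.1 _ (by omega), smul_zero]
      · obtain ⟨N, hN⟩ := ha.2.2.2 i
        refine ⟨N + 1, fun y => ?_⟩
        rw [show sgn (m + 2) (wt i) = sgn m (wt i) from sgn_add_even m 1 _]
        have h0 := dif_pow_succ_der₁ (1 : ℤ) N (F := (fun w : ℤ × ℤ => a w.1 (φ i w.2 y)) -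
          sgn m (wt i) • fun w : ℤ × ℤ => φ i w.2 (a w.1 y)) (by
            rw [map_sub, map_smul, hN y, sub_self])
        rw [map_sub, map_smul, map_sub, map_smul, sub_eq_zero] at h0
        convert h0 using 2
        congr 1
        ext w
        simp [der₁]
    have h1 := G.state_vec hd
    have h2 : (fun n : ℤ => (-(n : ℂ)) • a (n - 1)) (-1) (vacuum vac) = D x := by
      rw [G.D_eq_mode hx, ← hadef]
      norm_num
    rw [h2] at h1
    rw [h1]

theorem D_mem_gr {h : ℤ} {x : Space V} (hx : x ∈ gr V h) : D x ∈ gr V (h + 2) := by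
  rw [G.D_eq_mode hx]
  exact (G.state_mem hx).1 (-2) 0 _ _ (vacuum_mem_gr vac) (by ring)

end GeneratingModes

end StateField

/-! ### Uniqueness of Laurent coefficients. -/

section LaurentCoefficients

theorem hasSum_coeff {k : ℕ} {T : Type*} [Countable T] {d : T → ℂ} {e : T → Fin k → ℤ}
    {f : (Fin k → ℂ) → ℂ} {ρ : ℝ} (hρ : 0 < ρ)
    (h : ∀ ξ ∈ region k, (∀ j, ‖ξ j‖ < ρ) → HasSum (fun t => d t * ∏ j, ξ j ^ e t j) (f ξ))
    (m : Fin k → ℤ) :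
    HasSum (fun t => if ∀ j, e t j + m j = -1 then d t else 0)
      (iterResidue k fun ξ => (∏ j, ξ j ^ m j) * f ξ) := by
  refine hasSum_iterResidue (e := fun t j => e t j + m j) hρ fun ξ hξ hb => ?_
  refine ((h ξ hξ hb).mul_left (∏ j, ξ j ^ m j)).congr_fun fun t => ?_
  simp only [zpow_add₀ (hξ.1 _), Finset.prod_mul_distrib]
  ring

theorem eq_of_hasSum_laurent {c c' : ℤ → ℂ} {f : ℂ → ℂ} {ρ : ℝ} (hρ : 0 < ρ)
    (h : ∀ z, z ≠ 0 → ‖z‖ < ρ → HasSum (fun k : ℤ => c k * z ^ (-k - 1)) (f z))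
    (h' : ∀ z, z ≠ 0 → ‖z‖ < ρ → HasSum (fun k : ℤ => c' k * z ^ (-k - 1)) (f z)) : c = c' := by
  have key : ∀ (c : ℤ → ℂ),
      (∀ z, z ≠ 0 → ‖z‖ < ρ → HasSum (fun k : ℤ => c k * z ^ (-k - 1)) (f z)) →
      ∀ n, residue (fun z => z ^ n * f z) = c n := by
    intro c h n
    have := hasSum_residue (w := c) (e := fun k => -k - 1 + n) (g := fun z => z ^ n * f z) hρ
      (fun z hz hb => by
        refine ((h z hz hb).mul_left (z ^ n)).congr_fun fun k => ?_
        rw [zpow_add₀ hz]; ring)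
    refine this.unique ?_
    convert hasSum_ite_eq n (c n) using 2 with k
    by_cases hk : k = n
    · subst hk; rw [if_pos rfl, if_pos (by ring)]
    · rw [if_neg hk, if_neg (by omega)]
  ext n
  rw [← key c h n, key c' h' n]

end LaurentCoefficients

/-! ### Laurent polynomials in one variable. -/

section FiniteExpansions

/-- `f(z) = ∑ₖ c k z^{-k-1}`, a finite sum. -/
def FinExp (c : ℤ → ℂ) (f : ℂ → ℂ) : Prop :=
  ∃ s : Finset ℤ, (∀ k, k ∉ s → c k = 0) ∧ ∀ z, z ≠ 0 → f z = ∑ k ∈ s, c k * z ^ (-k - 1)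

variable {c c' : ℤ → ℂ} {f f' : ℂ → ℂ}

theorem FinExp.hasSum (h : FinExp c f) {z : ℂ} (hz : z ≠ 0) :
    HasSum (fun k : ℤ => c k * z ^ (-k - 1)) (f z) := by
  obtain ⟨s, h0, h1⟩ := h
  rw [h1 z hz]
  exact hasSum_sum_of_ne_finset_zero fun k hk => by rw [h0 k hk, zero_mul]

theorem FinExp.add (h : FinExp c f) (h' : FinExp c' f') : FinExp (c + c') (f + f') := by
  obtain ⟨s, h0, h1⟩ := h
  obtain ⟨s', h0', h1'⟩ := h'
  classical
  refine ⟨s ∪ s', fun k hk => ?_, fun z hz => ?_⟩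
  · simp only [Finset.mem_union, not_or] at hk
    rw [Pi.add_apply, h0 k hk.1, h0' k hk.2, add_zero]
  · rw [Pi.add_apply, h1 z hz, h1' z hz,
      Finset.sum_subset (Finset.subset_union_left (s₂ := s')) fun k _ hk => by
        rw [h0 k hk, zero_mul],
      Finset.sum_subset (Finset.subset_union_right (s₁ := s) (s₂ := s')) fun k _ hk => by
        rw [h0' k hk, zero_mul], ← Finset.sum_add_distrib]
    exact Finset.sum_congr rfl fun k _ => by rw [Pi.add_apply, add_mul]

theorem finExp_zero : FinExp 0 0 := ⟨∅, fun _ _ => rfl, fun z _ => by simp⟩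

theorem FinExp.hasDerivAt (h : FinExp c f) {z : ℂ} (hz : z ≠ 0) :
    ∃ d, HasDerivAt f d z ∧ HasSum (fun k : ℤ => (-(k : ℂ) * c (k - 1)) * z ^ (-k - 1)) d := by
  obtain ⟨s, h0, h1⟩ := h
  refine ⟨∑ k ∈ s, c k * (((-k - 1 : ℤ) : ℂ) * z ^ (-k - 1 - 1)), ?_, ?_⟩
  · have : HasDerivAt (fun z => ∑ k ∈ s, c k * z ^ (-k - 1))
        (∑ k ∈ s, c k * (((-k - 1 : ℤ) : ℂ) * z ^ (-k - 1 - 1))) z :=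
      HasDerivAt.fun_sum fun k _ => (hasDerivAt_zpow _ _ (Or.inl hz)).const_mul _
    refine this.congr_of_eventuallyEq ?_
    filter_upwards [isOpen_ne.mem_nhds hz] with w hw using h1 w hw
  · have h2 : HasSum (fun k : ℤ => c k * (((-k - 1 : ℤ) : ℂ) * z ^ (-k - 1 - 1)))
        (∑ k ∈ s, c k * (((-k - 1 : ℤ) : ℂ) * z ^ (-k - 1 - 1))) :=
      hasSum_sum_of_ne_finset_zero fun k hk => by rw [h0 k hk, zero_mul]
    rw [← (Equiv.addRight (-1 : ℤ)).hasSum_iff] at h2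
    refine h2.congr_fun fun k => ?_
    simp only [Function.comp_apply, Equiv.coe_addRight]
    rw [show k + -1 = k - 1 by ring, show -(k - 1) - 1 = -k by ring]
    push_cast
    ring

theorem FinExp.hasDerivAt_of (h : FinExp c f) (h' : FinExp (fun k => -(k : ℂ) * c (k - 1)) f')
    {z : ℂ} (hz : z ≠ 0) : HasDerivAt f (f' z) z := by
  obtain ⟨d, h1, h2⟩ := h.hasDerivAt hz
  rwa [← (h2.unique (h'.hasSum hz))]

theorem FinExp.tendsto (h : FinExp c f) (hc : ∀ k, 0 ≤ k → c k = 0) :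
    Tendsto f (𝓝[≠] 0) (𝓝 (c (-1))) := by
  obtain ⟨s, h0, h1⟩ := h
  have h2 : Tendsto (fun z : ℂ => ∑ k ∈ s, c k * z ^ (-k - 1)) (𝓝[≠] 0)
      (𝓝 (∑ k ∈ s, if k = -1 then c (-1) else 0)) := by
    refine tendsto_finsetSum _ fun k _ => ?_
    rcases lt_trichotomy k (-1) with hk | hk | hk
    · rw [if_neg hk.ne]
      obtain ⟨n, hn⟩ : ∃ n : ℕ, -k - 1 = (n + 1 : ℕ) := ⟨(-k - 2).toNat, by omega⟩
      simp only [hn, zpow_natCast]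
      have : Tendsto (fun z : ℂ => c k * z ^ (n + 1)) (𝓝 0) (𝓝 (c k * 0 ^ (n + 1))) := by
        exact ((continuous_id.pow _).tendsto 0).const_mul _
      simpa using this.mono_left nhdsWithin_le_nhds
    · subst hk
      simp
    · rw [if_neg hk.ne', hc k (by omega)]
      simp
  have h3 : (∑ k ∈ s, if k = -1 then c (-1) else 0) = c (-1) := by
    rw [Finset.sum_ite_eq' s (-1) fun _ => c (-1)]
    split_ifs with h
    · rfl
    · exact (h0 _ h).symm
  rw [h3] at h2
  refine h2.congr' ?_
  filter_upwards [self_mem_nhdsWithin] with z hz using (h1 z hz).symm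

end FiniteExpansions

/-! ### Homogeneous fields as functions of z. -/

section FieldsAt

variable {V : ℤ → Type u} [∀ n, AddCommGroup (V n)] [∀ n, Module ℂ (V n)]

theorem pair_lof (n : ℤ) (l : Module.Dual ℂ (V n)) (w : Compl V) :
    pair (DirectSum.lof ℂ ℤ (fun n => Module.Dual ℂ (V n)) n l) w = l (w n) := by
  simp [pair, DirectSum.toModule_lof]

theorem compl_ext {w w' : Compl V} (h : ∀ v' : GDual V, pair v' w = pair v' w') : w = w' := by
  funext n
  rw [← sub_eq_zero, ← Module.forall_dual_apply_eq_zero_iff ℂ]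
  intro l
  rw [map_sub, sub_eq_zero]
  simpa only [pair_lof] using h (DirectSum.lof ℂ ℤ _ n l)

theorem gdual_induction {p : GDual V → Prop} (h0 : p 0) (hadd : ∀ x y, p x → p y → p (x + y))
    (h : ∀ n l, p (DirectSum.lof ℂ ℤ (fun n => Module.Dual ℂ (V n)) n l)) (x : GDual V) : p x :=
  DirectSum.induction_on x h0 h hadd

theorem space_ext {x y : Space V} (h : ∀ v' : GDual V, pair v' (incl x) = pair v' (incl y)) :
    x = y := incl_injective (compl_ext h)

/-- The value at `z` of the field of weight `h / 2` with given modes. -/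
def fieldAt (h : ℤ) (z : ℂ) : (ℤ → Module.End ℂ (Space V)) →ₗ[ℂ] Space V →ₗ[ℂ] Compl V where
  toFun a := DirectSum.toModule ℂ ℤ _ fun m => LinearMap.pi fun n =>
    (z ^ (-((m + h - n) / 2))) • ((DirectSum.component ℂ ℤ V n).comp
      ((a ((m + h - n) / 2 - 1)).comp (DirectSum.lof ℂ ℤ V m)))
  map_add' a b := by
    refine DirectSum.linearMap_ext ℂ fun m => LinearMap.ext fun x => funext fun n => ?_
    simp [DirectSum.toModule_lof]
  map_smul' c a := by
    refine DirectSum.linearMap_ext ℂ fun m => LinearMap.ext fun x => funext fun n => ?_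
    simp [DirectSum.toModule_lof, smul_comm c]

variable {h m : ℤ} {a : ℤ → Module.End ℂ (Space V)} {x : Space V}

/-- For a homogeneous field only the mode k with m + h - 2k - 2 = n can map weight m to weight n. If
m + h - n is odd there is no such k, and the rounded quotient names a mode whose n-th component is
zero. -/
theorem fieldAt_apply (hx : x ∈ gr V m) (h : ℤ) (z : ℂ) (n : ℤ) :
    fieldAt h z a x n = (z ^ (-((m + h - n) / 2))) • (a ((m + h - n) / 2 - 1) x) n := by
  rw [eq_lof_of_mem_gr hx]
  simp [fieldAt, DirectSum.toModule_lof, DirectSum.component]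
  rfl

theorem Homog.apply_eq_zero (ha : Homog (gr V) h a) (hx : x ∈ gr V m) {k n : ℤ}
    (hk : k ≠ (m + h - n) / 2 - 1) : (a k x) n = 0 :=
  ha k m _ x hx rfl n (by omega)

theorem Homog.finExp (ha : Homog (gr V) h a) (v' : GDual V) (x : Space V) :
    FinExp (fun k => pair v' (incl (a k x))) fun z => pair v' (fieldAt h z a x) := by
  induction x using space_induction with
  | h0 => simp only [map_zero]; exact finExp_zero
  | hadd x y hx hy => simp only [map_add]; exact hx.add hy
  | h m x hx =>
    induction v' using gdual_induction with
    | h0 => simp only [map_zero]; exact finExp_zero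
    | hadd v' w' hv hw => simp only [map_add]; exact hv.add hw
    | h n l =>
      refine ⟨{(m + h - n) / 2 - 1}, fun k hk => ?_, fun z _ => ?_⟩
      · beta_reduce
        rw [pair_lof, incl_apply, ha.apply_eq_zero hx (by simpa using hk), map_zero]
      · beta_reduce
        rw [Finset.sum_singleton, pair_lof, pair_lof, fieldAt_apply hx, map_smul, incl_apply,
          smul_eq_mul, mul_comm]
        congr 2
        ring

theorem Homog.proj_fieldAt (ha : Homog (gr V) h a) (hx : x ∈ gr V m) (z : ℂ) (k : ℤ) :
    proj (m + h - 2 * k - 2) (fieldAt h z a x) = z ^ (-k - 1) • a k x := by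
  have h1 := ha k m _ x hx rfl
  have h2 : (m + h - (m + h - 2 * k - 2)) / 2 = k + 1 := by omega
  rw [proj, LinearMap.comp_apply, LinearMap.proj_apply, fieldAt_apply hx, h2,
    show k + 1 - 1 = k by ring, map_smul, ← eq_lof_of_mem_gr h1]
  congr 2
  ring

theorem Homog.proj_fieldAt_eq_zero (ha : Homog (gr V) h a) (hx : x ∈ gr V m) (z : ℂ) {n : ℤ}
    (hn : ∀ k : ℤ, m + h - 2 * k - 2 ≠ n) : proj n (fieldAt h z a x) = 0 := by
  rw [proj, LinearMap.comp_apply, LinearMap.proj_apply, fieldAt_apply hx,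
    ha ((m + h - n) / 2 - 1) m _ x hx rfl n (hn _).symm, smul_zero, map_zero]

/-- Translates the sums over projections in the axioms into sums over modes: distinct modes have
distinct target weights, and the remaining projections vanish. -/
theorem Homog.hasSum_proj (ha : Homog (gr V) h a) (hx : x ∈ gr V m) (z : ℂ)
    (T : Space V →ₗ[ℂ] ℂ) (s : ℂ) : HasSum (fun n => T (proj n (fieldAt h z a x))) s ↔
      HasSum (fun k : ℤ => T (a k x) * z ^ (-k - 1)) s := by
  have hinj : Function.Injective fun k : ℤ => m + h - 2 * k - 2 := fun a b hab => by
    simp only at hab; omega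
  rw [← hinj.hasSum_iff]
  · refine Eq.to_iff (congrArg (fun F : ℤ → ℂ => HasSum F s) (funext fun k => ?_))
    rw [Function.comp_apply, ha.proj_fieldAt hx, map_smul, smul_eq_mul, mul_comm]
  · intro n hn
    rw [ha.proj_fieldAt_eq_zero hx z, map_zero]
    intro k hk
    exact hn ⟨k, hk⟩

theorem mode_homog (w : ℤ) (φ1 : Space V →ₗ[ℂ] Compl V) : Homog (gr V) w (mode w φ1) := by
  intro n m m' x hx hm
  rw [eq_lof_of_mem_gr hx, mode, DirectSum.toModule_lof, hm]
  have : m + w - 2 * n - 2 = m + w - 2 * n - 2 := rfl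
  exact proj_mem_gr _ _

theorem mode_apply (w : ℤ) (φ1 : Space V →ₗ[ℂ] Compl V) (hx : x ∈ gr V m) {n k : ℤ}
    (hn : n = m + w - 2 * k - 2) : (mode w φ1 k x) n = φ1 x n := by
  subst hn
  have h1 : mode w φ1 k x = proj (m + w - 2 * k - 2) (φ1 x) := by
    conv_lhs => rw [eq_lof_of_mem_gr hx]
    conv_rhs => rw [eq_lof_of_mem_gr hx]
    simp [mode, DirectSum.toModule_lof]
  rw [h1]
  exact DirectSum.lof_apply (R := ℂ) _ _

end FieldsAt

/-! ### Single-valued solutions of the Euler equation. -/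

section HomogeneousFunctions

/-- In the coordinate z = exp w the equation has constant coefficients. -/
theorem eq_zpow_of_euler {c : ℂ → ℂ} {K : ℤ}
    (h : ∀ z, z ≠ 0 → ∃ d, HasDerivAt c d z ∧ z * d = (K / 2 : ℂ) * c z) (w : ℂ) :
    c (Complex.exp w) = c 1 * Complex.exp (K / 2 * w) := by
  have hd : ∀ w, HasDerivAt (fun w => c (Complex.exp w) * Complex.exp (-(K / 2 * w))) 0 w := by
    intro w
    obtain ⟨d, h1, h2⟩ := h (Complex.exp w) (Complex.exp_ne_zero w)
    have e1 : HasDerivAt (fun w => c (Complex.exp w)) (d * Complex.exp w) w :=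
      HasDerivAt.comp w h1 (Complex.hasDerivAt_exp w)
    have e2 : HasDerivAt (fun w : ℂ => Complex.exp (-(K / 2 * w)))
        (Complex.exp (-(K / 2 * w)) * (-(K / 2 * 1))) w :=
      (((hasDerivAt_id w).const_mul (K / 2 : ℂ)).fun_neg).cexp
    have e3 := e1.mul e2
    refine e3.congr_deriv ?_
    rw [mul_comm d, h2]
    ring
  have hconst := is_const_of_deriv_eq_zero (fun w => (hd w).differentiableAt)
    (fun w => (hd w).deriv) w 0
  simp only [Complex.exp_zero, mul_zero, neg_zero, mul_one] at hconst
  rw [← hconst, mul_assoc, ← Complex.exp_add]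
  simp

theorem eq_zpow_of_euler_even {c : ℂ → ℂ} {K e : ℤ} (hK : K = 2 * e)
    (h : ∀ z, z ≠ 0 → ∃ d, HasDerivAt c d z ∧ z * d = (K / 2 : ℂ) * c z) {z : ℂ} (hz : z ≠ 0) :
    c z = z ^ e * c 1 := by
  have := eq_zpow_of_euler h (Complex.log z)
  rw [Complex.exp_log hz] at this
  rw [this, mul_comm, hK]
  congr 1
  push_cast
  rw [mul_div_cancel_left₀ _ (two_ne_zero), Complex.exp_int_mul, Complex.exp_log hz]

/-- One turn around the origin multiplies the solution by exp(π i K) = -1, but c is single valued.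
-/
theorem eq_zero_of_euler_odd {c : ℂ → ℂ} {K : ℤ} (hK : Odd K)
    (h : ∀ z, z ≠ 0 → ∃ d, HasDerivAt c d z ∧ z * d = (K / 2 : ℂ) * c z) {z : ℂ} (hz : z ≠ 0) :
    c z = 0 := by
  have h1 := eq_zpow_of_euler h (2 * Real.pi * Complex.I)
  have h2 := eq_zpow_of_euler h (Complex.log z)
  rw [Complex.exp_two_pi_mul_I, show (K / 2 : ℂ) * (2 * Real.pi * Complex.I) =
    K * (Real.pi * Complex.I) by ring, Complex.exp_int_mul, Complex.exp_pi_mul_I,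
    hK.neg_one_zpow] at h1
  have h3 : c 1 = 0 := by linear_combination h1 / 2
  rw [Complex.exp_log hz, h3, zero_mul] at h2
  exact h2

end HomogeneousFunctions

/-! ### Laurent expansions in two variables. -/

section TwoVariables

theorem mem_config_two {z₁ z₂ : ℂ} (h₁ : z₁ ≠ 0) (h₂ : z₂ ≠ 0) (h₁₂ : z₁ ≠ z₂) :
    ![z₁, z₂] ∈ config 2 := by
  refine ⟨by simp [Fin.forall_fin_two, h₁, h₂], ?_⟩
  intro a b hab
  fin_cases a <;> fin_cases b <;> simp_all

theorem hasSum_dif_pow {F : ℤ × ℤ → ℂ} {z₁ z₂ s : ℂ} (h₁ : z₁ ≠ 0) (h₂ : z₂ ≠ 0)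
    (h : HasSum (fun y : ℤ × ℤ => F y * (z₁ ^ (-y.1 - 1) * z₂ ^ (-y.2 - 1))) s) (N : ℕ) :
    HasSum (fun y : ℤ × ℤ => (dif (1, 0) (0, 1) ^ N) F y * (z₁ ^ (-y.1 - 1) * z₂ ^ (-y.2 - 1)))
      ((z₁ - z₂) ^ N * s) := by
  induction N with
  | zero => simpa using h
  | succ N ih =>
    have e1 := ((Equiv.addRight ((1, 0) : ℤ × ℤ)).hasSum_iff.2 ih).mul_left z₁
    have e2 := ((Equiv.addRight ((0, 1) : ℤ × ℤ)).hasSum_iff.2 ih).mul_left z₂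
    have e3 := e1.sub e2
    rw [show (z₁ - z₂) ^ (N + 1) * s = z₁ * ((z₁ - z₂) ^ N * s) - z₂ * ((z₁ - z₂) ^ N * s) by ring]
    refine e3.congr_fun fun y => ?_
    have h3 : z₁ ^ (-y.1 - 1) = z₁ * z₁ ^ (-(y.1 + 1) - 1) := by
      rw [← zpow_one_add₀ h₁]; congr 1; ring
    have h4 : z₂ ^ (-y.2 - 1) = z₂ * z₂ ^ (-(y.2 + 1) - 1) := by
      rw [← zpow_one_add₀ h₂]; congr 1; ring
    simp only [pow_succ', Module.End.mul_apply, dif_apply, Function.comp_apply,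
      Equiv.coe_addRight, Prod.fst_add, Prod.snd_add, add_zero]
    rw [sub_mul]
    congr 1
    · rw [h3]; ring
    · rw [h4]; ring

/-- The coefficients of a Laurent expansion in two variables are determined by its sum. -/
theorem hasSum_coeff₂ {F : ℤ × ℤ → ℂ} {T : Type*} [Countable T] {d : T → ℂ}
    {e : T → Fin 2 → ℤ} {g : (Fin 2 → ℂ) → ℂ}
    (hF : ∀ z ∈ region 2,
      HasSum (fun y : ℤ × ℤ => F y * (z 0 ^ (-y.1 - 1) * z 1 ^ (-y.2 - 1))) (g z))
    (hd : ∀ z ∈ region 2, HasSum (fun t => d t * ∏ j, z j ^ e t j) (g z)) (y : ℤ × ℤ) :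
    HasSum (fun t => if e t 0 + y.1 = -1 ∧ e t 1 + y.2 = -1 then d t else 0) (F y) := by
  have h1 := hasSum_coeff (d := F) (e := fun y : ℤ × ℤ => ![-y.1 - 1, -y.2 - 1]) (f := g)
    one_pos (fun z hz _ => by simpa [Fin.prod_univ_two] using hF z hz) ![y.1, y.2]
  have h2 := hasSum_coeff one_pos (fun z hz _ => hd z hz) ![y.1, y.2]
  have h3 : HasSum (fun t : ℤ × ℤ => if ∀ j, (![-t.1 - 1, -t.2 - 1] : Fin 2 → ℤ) j +
      (![y.1, y.2] : Fin 2 → ℤ) j = -1 then F t else 0) (F y) := by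
    convert hasSum_ite_eq y (F y) using 2 with t
    by_cases ht : t = y
    · subst ht; rw [if_pos rfl, if_pos (by simp [Fin.forall_fin_two]; constructor <;> ring)]
    · rw [if_neg ht, if_neg]
      intro hc
      simp only [Fin.forall_fin_two, Matrix.cons_val_zero, Matrix.cons_val_one] at hc
      exact ht (Prod.ext (by omega) (by omega))
  rw [← h1.unique h3]
  refine h2.congr_fun fun t => ?_
  simp [Fin.forall_fin_two]

theorem ratFun_two (p : MvPolynomial (Fin 2) ℂ) (a : Fin 2 → ℕ) (b : Fin 2 → Fin 2 → ℕ)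
    (z : Fin 2 → ℂ) : ratFun p a b z =
      MvPolynomial.eval z p / (z 0 ^ a 0 * z 1 ^ a 1 * (z 0 - z 1) ^ b 0 1) := by
  have h0 : Finset.Ioi (0 : Fin 2) = {1} := by decide
  have h1 : Finset.Ioi (1 : Fin 2) = ∅ := by decide
  simp [ratFun, Fin.prod_univ_two, h0, h1]

/-- With the pole on the diagonal cancelled, the denominator is a monomial, so one expansion holds
on all of `config 2`, whichever variable is larger. This is the source of locality. -/
theorem expandable_mul_ratFun {N : ℕ} (p : MvPolynomial (Fin 2) ℂ) (a : Fin 2 → ℕ)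
    {b : Fin 2 → Fin 2 → ℕ} (hb : b 0 1 ≤ N) :
    ∃ (T : Type) (_ : Countable T) (d : T → ℂ) (e : T → Fin 2 → ℤ), ∀ z : Fin 2 → ℂ,
      z ∈ config 2 → HasSum (fun t => d t * ∏ j, z j ^ e t j)
        ((z 0 - z 1) ^ N * ratFun p a b z) := by
  have hU : ∀ z ∈ config 2, ∀ j, z j ≠ 0 := fun z hz => hz.1
  have h := ((expandable_zpow (U := config 2) (0 : Fin 2) (-(a 0 : ℤ))).mul hU
    (expandable_zpow (1 : Fin 2) (-(a 1 : ℤ)))).mul hU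
    (Expandable.eval hU (p * (MvPolynomial.X 0 - MvPolynomial.X 1) ^ (N - b 0 1))
      (x := fun i z => z i) expandable_coord)
  refine h.congr fun z hz => ?_
  have h01 : z 0 - z 1 ≠ 0 := sub_ne_zero.2 fun h => by simpa using hz.2 h
  have e0 := hU z hz 0
  have e1 := hU z hz 1
  simp only [ratFun_two, map_mul, map_pow, map_sub, MvPolynomial.eval_X, zpow_neg, zpow_natCast]
  rw [pow_sub₀ _ h01 hb]
  field_simp

end TwoVariables

/-! ### From the hypotheses on the generating fields to properties of their modes. -/

section GeneratingFields

variable {V : ℤ → Type u} [∀ n, AddCommGroup (V n)] [∀ n, Module ℂ (V n)] {I : Type v}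
  {vac : V 0} {φ : I → ℂ → Space V →ₗ[ℂ] Compl V} {wt : I → ℤ} {D : Space V →ₗ[ℂ] Space V}

theorem L0_apply {m : ℤ} {x : Space V} (hx : x ∈ gr V m) : L0 x = ((m : ℂ) / 2) • x := by
  rw [eq_lof_of_mem_gr hx]
  simp [L0, DirectSum.toModule_lof]

theorem L0Compl_apply (w : Compl V) (n : ℤ) : L0Compl w n = ((n : ℂ) / 2) • w n := by
  simp [L0Compl]

/-- The modes of the generating fields. -/
def modes (φ : I → ℂ → Space V →ₗ[ℂ] Compl V) (wt : I → ℤ) (i : I) (n : ℤ) :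
    Module.End ℂ (Space V) := mode (wt i) (φ i 1) n

theorem modes_homog (φ : I → ℂ → Space V →ₗ[ℂ] Compl V) (wt : I → ℤ) (i : I) :
    Homog (gr V) (wt i) (modes φ wt i) := fun n => mode_homog _ _ n

theorem modeProd_succ {k : ℕ} (i : Fin (k + 1) → I) (n : Fin (k + 1) → ℤ) (x : Space V) :
    modeProd φ wt i n x = modes φ wt (i 0) (n 0) (modeProd φ wt (Fin.tail i) (Fin.tail n) x) := by
  simp only [modeProd, List.ofFn_succ, List.prod_cons, Module.End.mul_apply]
  rfl

theorem modeProd_zero (i : Fin 0 → I) (n : Fin 0 → ℤ) (x : Space V) :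
    modeProd φ wt i n x = x := by
  simp [modeProd]

namespace GeneratingFields

variable (H : GeneratingFields vac φ wt D)

include H

theorem euler {m : ℤ} {x : Space V} (hx : x ∈ gr V m) (i : I) (n : ℤ) (l : Module.Dual ℂ (V n))
    (z : ℂ) (hz : z ≠ 0) : ∃ d, HasDerivAt (fun z => l (φ i z x n)) d z ∧
      z * d = ((n - m - wt i : ℤ) / 2 : ℂ) * l (φ i z x n) := by
  obtain ⟨d, h1, h2⟩ := H.L0_bracket i x z hz
  refine ⟨l (d n), ?_, ?_⟩
  · simpa only [pair_lof] using h1 (DirectSum.lof ℂ ℤ _ n l)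
  · have h3 := congrArg l (congrFun h2 n)
    rw [L0_apply hx, map_smul, Pi.sub_apply, L0Compl_apply, Pi.add_apply, Pi.smul_apply,
      Pi.smul_apply, Pi.smul_apply, map_sub, map_add, map_smul, map_smul, map_smul, map_smul] at h3
    simp only [smul_eq_mul] at h3
    push_cast
    linear_combination -h3

/-- Each component of φ^i(z) x solves an Euler equation, so it is an integral power of z times its
value at 1, or zero if the exponent would be half-integral. This justifies reading the modes off
φ^i(1). -/
theorem eq_fieldAt (i : I) {z : ℂ} (hz : z ≠ 0) :
    φ i z = fieldAt (wt i) z (modes φ wt i) := by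
  refine LinearMap.ext fun x => ?_
  induction x using space_induction with
  | h0 => simp
  | hadd x y hx hy => rw [map_add, map_add, hx, hy]
  | h m x hx =>
    funext n
    rw [← sub_eq_zero, ← Module.forall_dual_apply_eq_zero_iff ℂ]
    intro l
    rw [map_sub, sub_eq_zero, fieldAt_apply hx, map_smul, smul_eq_mul]
    rcases Int.even_or_odd' (m + wt i - n) with ⟨e, he | he⟩
    · rw [he, show 2 * e / 2 = e by omega, modes, mode_apply _ _ hx (by omega)]
      exact eq_zpow_of_euler_even (K := n - m - wt i) (by omega) (H.euler hx i n l) hz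
    · rw [eq_zero_of_euler_odd (K := n - m - wt i) (c := fun z => l (φ i z x n))
        ⟨-e - 1, by omega⟩ (H.euler hx i n l) hz,
        modes_homog φ wt i _ m _ x hx rfl n (by omega), map_zero, mul_zero]

theorem finExp (i : I) (v' : GDual V) (x : Space V) :
    FinExp (fun k => pair v' (incl (modes φ wt i k x))) fun z => pair v' (φ i z x) := by
  obtain ⟨s, h0, h1⟩ := (modes_homog φ wt i).finExp v' x
  refine ⟨s, h0, fun z hz => ?_⟩
  beta_reduce
  rw [H.eq_fieldAt i hz]
  exact h1 z hz

/-- The component of φ^i(z) 𝟏 in question, multiplied by z^{n+1}, is constant in z; but φ^i(z) 𝟏 has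
a limit at 0, so the product tends to 0. -/
theorem modes_creation (i : I) (n : ℤ) (hn : 0 ≤ n) : modes φ wt i n (vacuum vac) = 0 := by
  obtain ⟨u, -, hu⟩ := H.creation i
  have h1 := modes_homog φ wt i n 0 _ _ (vacuum_mem_gr vac) rfl
  suffices h0 : (modes φ wt i n (vacuum vac)) (0 + wt i - 2 * n - 2) = 0 by
    rw [eq_lof_of_mem_gr h1, h0, map_zero]
  rw [← Module.forall_dual_apply_eq_zero_iff ℂ]
  intro l
  have h2 := hu (DirectSum.lof ℂ ℤ _ _ l)
  simp only [pair_lof] at h2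
  have h3 : Tendsto (fun z : ℂ => z ^ (n + 1)) (𝓝[≠] 0) (𝓝 0) := by
    obtain ⟨k, hk⟩ : ∃ k : ℕ, n + 1 = (k + 1 : ℕ) := ⟨n.toNat, by omega⟩
    simp only [hk, zpow_natCast]
    have : Tendsto (fun z : ℂ => z ^ (k + 1)) (𝓝 0) (𝓝 (0 ^ (k + 1))) :=
      (continuous_id.pow _).tendsto 0
    simpa using this.mono_left nhdsWithin_le_nhds
  have h4 := h3.mul h2
  rw [zero_mul] at h4
  refine tendsto_nhds_unique ?_ h4
  refine tendsto_const_nhds.congr' ?_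
  filter_upwards [self_mem_nhdsWithin] with z hz
  have hz' : z ≠ 0 := hz
  rw [H.eq_fieldAt i hz', fieldAt_apply (vacuum_mem_gr vac),
    show (0 + wt i - (0 + wt i - 2 * n - 2)) / 2 = n + 1 by omega, map_smul, smul_eq_mul, ← mul_assoc,
    ← zpow_add₀ hz', show n + 1 - 1 = n by ring]
  simp

/-- As D is not assumed to be homogeneous, components cannot be compared; instead the two
expressions for D φ^i(z) x are expanded in z, and Laurent coefficients are unique. -/
theorem modes_cov (i : I) : Cov D (modes φ wt i) := by
  intro k
  refine LinearMap.ext fun x => ?_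
  induction x using space_induction with
  | h0 => simp
  | hadd x y hx hy => rw [map_add, map_add, hx, hy]
  | h m x hx =>
    refine space_ext fun v' => ?_
    set c₁ : ℤ → ℂ := fun k => pair v' (incl (D (modes φ wt i k x))) with hc₁
    set c₂ : ℤ → ℂ := fun k => -(k : ℂ) * pair v' (incl (modes φ wt i (k - 1) x)) +
      pair v' (incl (modes φ wt i k (D x))) with hc₂
    have h1 : ∀ z : ℂ, z ≠ 0 → ∃ s, HasSum (fun k : ℤ => c₁ k * z ^ (-k - 1)) s ∧
        HasSum (fun k : ℤ => c₂ k * z ^ (-k - 1)) s := by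
      intro z hz
      obtain ⟨d, hd1, hd2⟩ := H.D_bracket i x z hz
      refine ⟨pair v' (d + φ i z (D x)), ?_, ?_⟩
      · have := hd2 v'
        nth_rw 1 [H.eq_fieldAt i hz] at this
        exact ((modes_homog φ wt i).hasSum_proj hx z ((pair v').comp (incl.comp D)) _).1 this
      · obtain ⟨d', h3, h4⟩ := (H.finExp i v' x).hasDerivAt hz
        have h5 := (H.finExp i v' (D x)).hasSum hz
        rw [map_add]
        rw [h3.unique (hd1 v')] at h4
        refine (h4.add h5).congr_fun fun k => ?_
        simp only [hc₂]
        ring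
    choose! s hs using h1
    have h2 := eq_of_hasSum_laurent (f := s) one_pos (fun z hz _ => (hs z hz).1)
      fun z hz _ => (hs z hz).2
    have h3 := congrFun h2 k
    simp only [hc₁, hc₂] at h3
    simp only [LinearMap.sub_apply, Module.End.mul_apply, LinearMap.smul_apply, map_sub, map_smul,
      smul_eq_mul, h3]
    ring

theorem modes_span (W : Submodule ℂ (Space V)) (h0 : vacuum vac ∈ W)
    (h : ∀ i n x, x ∈ W → modes φ wt i n x ∈ W) : W = ⊤ := by
  have key : ∀ (k : ℕ) (i : Fin k → I) (n : Fin k → ℤ), modeProd φ wt i n (vacuum vac) ∈ W := by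
    intro k
    induction k with
    | zero => intro i n; rwa [modeProd_zero]
    | succ k ih => intro i n; rw [modeProd_succ]; exact h _ _ _ (ih _ _)
  rw [eq_top_iff, ← H.spanning, Submodule.span_le]
  rintro x ⟨k, i, n, rfl⟩
  exact key k i n

theorem covariantModes : CovariantModes vac (modes φ wt) wt D where
  grading := H.grading
  homog := modes_homog φ wt
  cov := H.modes_cov
  D_vacuum := H.D_vacuum
  creation := H.modes_creation
  span := H.modes_span

theorem correlator_spec {k : ℕ} (i : Fin k → I) (v' : GDual V) (x : Space V) :
    IsRational (correlator φ wt i v' x) ∧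
      ∀ z ∈ region k, ProductHasSum φ wt i v' x z (correlator φ wt i v' x z) := by
  have h : ∃ f : (Fin k → ℂ) → ℂ, IsRational f ∧
      ∀ z ∈ region k, ProductHasSum φ wt i v' x z (f z) := by
    obtain ⟨M, N, hMN⟩ := H.rationality k
    obtain ⟨p, hp⟩ := hMN i v' x
    exact ⟨_, isRational_ratFun _ _ _, hp⟩
  rw [correlator, dif_pos h]
  exact h.choose_spec

theorem productHasSum_two {i j : I} {v' : GDual V} {x : Space V} {z : Fin 2 → ℂ} {s : ℂ}
    (h : ProductHasSum φ wt ![i, j] v' x z s) :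
    HasSum (fun y : ℤ × ℤ => pair v' (incl (modes φ wt i y.1 (modes φ wt j y.2 x))) *
      (z 0 ^ (-y.1 - 1) * z 1 ^ (-y.2 - 1))) s := by
  unfold ProductHasSum at h
  rw [← (finTwoArrowEquiv ℤ).symm.hasSum_iff] at h
  refine h.congr_fun fun y => ?_
  simp only [Function.comp_apply, finTwoArrowEquiv_symm_apply, modeProd_succ, modeProd_zero,
    Fin.prod_univ_two]
  rfl

/-- For given x and v' the two correlators are f(z₁, z₂) = ε g(z₂, z₁), and (z₁ - z₂)^N₀ f has one
expansion for both orders of the moduli, so the coefficients agree. The order `N₀` is independent of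
x and v' because the bound on the pole at z₁ = z₂ is. -/
theorem modes_loc (i j : I) : ∃ N, Loc N
    ((-1) ^ (fieldParity φ wt vac i * fieldParity φ wt vac j)) (modes φ wt i) (modes φ wt j) := by
  obtain ⟨M, N, hMN⟩ := H.rationality 2
  set N₀ := max (N 0 1 i j) (N 0 1 j i) with hN₀
  set ε : ℂ := (-1) ^ (fieldParity φ wt vac i * fieldParity φ wt vac j) with hε
  refine ⟨N₀, fun x => ?_⟩
  ext1 y
  refine space_ext fun v' => ?_
  obtain ⟨p, hp⟩ := hMN ![i, j] v' x
  obtain ⟨q, hq⟩ := hMN ![j, i] v' x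
  set f := ratFun p (fun l => M l ((![i, j] : Fin 2 → I) l) x)
    (fun l l' => N l l' ((![i, j] : Fin 2 → I) l) ((![i, j] : Fin 2 → I) l')) with hf
  set g := ratFun q (fun l => M l ((![j, i] : Fin 2 → I) l) x)
    (fun l l' => N l l' ((![j, i] : Fin 2 → I) l) ((![j, i] : Fin 2 → I) l')) with hg
  have hcorr : ∀ {i : Fin 2 → I} {f : (Fin 2 → ℂ) → ℂ}, IsRational f →
      (∀ z ∈ region 2, ProductHasSum φ wt i v' x z (f z)) →
      ∀ z ∈ config 2, correlator φ wt i v' x z = f z := fun hf h =>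
    (H.correlator_spec _ v' x).1.eq_of_region hf fun z hz =>
      ((H.correlator_spec _ v' x).2 z hz).unique (h z hz)
  have hfg : ∀ z₁ z₂ : ℂ, z₁ ≠ 0 → z₂ ≠ 0 → z₁ ≠ z₂ → f ![z₁, z₂] = ε * g ![z₂, z₁] := by
    intro z₁ z₂ h₁ h₂ h₁₂
    have e1 := hcorr (f := f) (isRational_ratFun _ _ _) hp _ (mem_config_two h₁ h₂ h₁₂)
    have e2 := hcorr (f := g) (isRational_ratFun _ _ _) hq _ (mem_config_two h₂ h₁ h₁₂.symm)
    rw [← e1, ← e2]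
    exact H.commutativity i j v' x z₁ z₂ h₁ h₂ h₁₂
  have hne : ∀ z ∈ region 2, z 0 ≠ z 1 := fun z hz h => by
    simpa using (region_subset_config 2 hz).2 h
  have hswap : ∀ z : Fin 2 → ℂ, ![z 0, z 1] = z := fun z => by
    ext l; fin_cases l <;> rfl
  obtain ⟨T, hT, d, e, hde⟩ := expandable_mul_ratFun p
    (fun l => M l ((![i, j] : Fin 2 → I) l) x) (N := N₀)
    (b := fun l l' => N l l' ((![i, j] : Fin 2 → I) l) ((![i, j] : Fin 2 → I) l'))
    (le_max_left _ _)
  set A : ℤ × ℤ → ℂ := fun y =>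
    pair v' (incl (modes φ wt i y.1 (modes φ wt j y.2 x))) with hA
  set B : ℤ × ℤ → ℂ := fun y =>
    pair v' (incl (modes φ wt j y.1 (modes φ wt i y.2 x))) with hB
  have hAs := hasSum_coeff₂ (F := (dif (1, 0) (0, 1) ^ N₀) A) (d := d) (e := e)
    (g := fun z => (z 0 - z 1) ^ N₀ * f z)
    (fun z hz => hasSum_dif_pow (hz.1 0) (hz.1 1) (H.productHasSum_two (hp z hz)) N₀)
    (fun z hz => hde z (region_subset_config 2 hz)) y
  -- The expansion of (z₁ - z₂)^N₀ f is evaluated at the interchanged point. This permutes the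
  -- exponents and contributes the sign (-1)^N₀.
  have hBs := hasSum_coeff₂ (F := ((-1) ^ N₀ * ε) • (dif (1, 0) (0, 1) ^ N₀) B) (d := d)
    (e := fun t l => e t (Equiv.swap 0 1 l))
    (g := fun z => ((-1) ^ N₀ * ε) * ((z 0 - z 1) ^ N₀ * g z))
    (fun z hz => by
      refine ((hasSum_dif_pow (hz.1 0) (hz.1 1) (H.productHasSum_two (hq z hz)) N₀).mul_left
        ((-1) ^ N₀ * ε)).congr_fun fun y => ?_
      simp only [Pi.smul_apply, smul_eq_mul, mul_assoc]
      rfl)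
    (fun z hz => by
      have hz' : ![z 1, z 0] ∈ config 2 := mem_config_two (hz.1 1) (hz.1 0) (hne z hz).symm
      have h1 := hde ![z 1, z 0] hz'
      have h2 := hfg (z 1) (z 0) (hz.1 1) (hz.1 0) (hne z hz).symm
      rw [← hf, h2, hswap] at h1
      have h3 : (![z 1, z 0] 0 - ![z 1, z 0] 1) ^ N₀ * (ε * g z) =
          ((-1) ^ N₀ * ε) * ((z 0 - z 1) ^ N₀ * g z) := by
        simp only [Matrix.cons_val_zero, Matrix.cons_val_one]
        rw [← neg_sub (z 0) (z 1), neg_pow]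
        ring
      rw [h3] at h1
      refine h1.congr_fun fun t => ?_
      simp only [Fin.prod_univ_two, Equiv.swap_apply_left, Equiv.swap_apply_right,
        Matrix.cons_val_zero, Matrix.cons_val_one]
      ring) y.swap
  have hAB : (dif (1, 0) (0, 1) ^ N₀) A y =
      (-1) ^ N₀ * ε * (dif (1, 0) (0, 1) ^ N₀) B y.swap := by
    refine hAs.unique (hBs.congr_fun fun t => ?_)
    simp only [Equiv.swap_apply_left, Equiv.swap_apply_right, Prod.fst_swap, Prod.snd_swap]
    simp only [and_comm]
  have e1 := congrFun (dif_pow_map ((1, 0) : ℤ × ℤ) (0, 1) ((pair v').comp incl) N₀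
    fun y : ℤ × ℤ => modes φ wt i y.1 (modes φ wt j y.2 x)) y
  have e2 := congrFun (dif_pow_map ((1, 0) : ℤ × ℤ) (0, 1) ((pair v').comp incl) N₀
    fun y : ℤ × ℤ => modes φ wt j y.2 (modes φ wt i y.1 x)) y
  have e3 := congrFun (dif_pow_comp (v := ((1, 0) : ℤ × ℤ)) (w := (0, 1)) (v' := (0, 1))
    (w' := (1, 0)) (Prod.swap : ℤ × ℤ → ℤ × ℤ) (fun y => by simp [Prod.swap])
    (fun y => by simp [Prod.swap]) N₀ B) y
  rw [congrFun (dif_pow_swap ((1, 0) : ℤ × ℤ) (0, 1) N₀ B) y.swap] at e3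
  simp only [LinearMap.comp_apply] at e1 e2
  rw [Pi.smul_apply, map_smul, map_smul, ← e1, ← e2, smul_eq_mul]
  refine hAB.trans ?_
  rw [show (fun y : ℤ × ℤ => pair v' (incl (modes φ wt j y.2 (modes φ wt i y.1 x)))) =
    fun y => B y.swap from rfl, e3]
  simp only [Pi.smul_apply, smul_eq_mul]
  ring

theorem modes_eq_zero {i : I} (h : modes φ wt i (-1) (vacuum vac) = 0) : modes φ wt i = 0 :=
  H.covariantModes.eq_zero_of_modes_vacuum
    (fun j => (H.modes_loc i j).imp fun _ h => ⟨_, h⟩)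
    (H.covariantModes.modes_vacuum_eq_zero (H.modes_cov i) (H.modes_creation i) h)

/-- The parity is defined by the vector φ^i_{-1} 𝟏, of weight wt i / 2. Only if this vector is zero
can it differ from the parity of the weight, and then the whole field vanishes by Goddard's
argument. -/
theorem fieldParity_eq (i : I) : modes φ wt i = 0 ∨
    (Even (wt i) ∧ fieldParity φ wt vac i = 0) ∨ (Odd (wt i) ∧ fieldParity φ wt vac i = 1) := by
  by_cases h : modes φ wt i (-1) (vacuum vac) = 0
  · exact Or.inl (H.modes_eq_zero h)
  right
  have hmem : modes φ wt i (-1) (vacuum vac) ∈ gr V (wt i) :=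
    modes_homog φ wt i (-1) 0 _ _ (vacuum_mem_gr vac) (by ring)
  rcases Int.even_or_odd (wt i) with hw | hw
  · refine Or.inl ⟨hw, if_pos fun n hn => hmem n ?_⟩
    rintro rfl
    simp [Int.even_iff.1 hw] at hn
  · refine Or.inr ⟨hw, if_neg fun hp => h ?_⟩
    rw [eq_lof_of_mem_gr hmem]
    have := hp (wt i) (by simp [Int.odd_iff.1 hw])
    change (modes φ wt i (-1) (vacuum vac)) (wt i) = 0 at this
    rw [this, map_zero]

theorem generatingModes : GeneratingModes vac (modes φ wt) wt D where
  toCovariantModes := H.covariantModes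
  loc i j := by
    rcases H.fieldParity_eq i with hi | hi
    · exact ⟨0, by rw [hi]; exact Loc.zero_left⟩
    rcases H.fieldParity_eq j with hj | hj
    · refine ⟨0, ?_⟩
      rw [hj]
      exact Loc.symm Loc.zero_left (sgn_mul_self _ _)
    obtain ⟨N, hN⟩ := H.modes_loc i j
    refine ⟨N, ?_⟩
    convert hN using 1
    rcases hi with ⟨hi, hi'⟩ | ⟨hi, hi'⟩ <;> rcases hj with ⟨hj, hj'⟩ | ⟨hj, hj'⟩ <;>
      rw [hi', hj', sgn]
    · simp [(hi.mul_right _).neg_one_zpow]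
    · simp [(hi.mul_right _).neg_one_zpow]
    · simp [(hj.mul_left _).neg_one_zpow]
    · simp [(hi.mul hj).neg_one_zpow]

end GeneratingFields
end GeneratingFields

/-! ### The vertex operator map and its axioms other than duality. -/

section VertexMap

variable {V : ℤ → Type u} [∀ n, AddCommGroup (V n)] [∀ n, Module ℂ (V n)] {I : Type v}

theorem ExtendsTo.add {A : Space V →ₗ[ℂ] Space V} {w w' a a' : Compl V} (h : ExtendsTo A w a)
    (h' : ExtendsTo A w' a') : ExtendsTo A (w + w') (a + a') := by
  intro v'
  simp only [map_add]
  exact (h v').add (h' v')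

theorem extendsTo_zero (A : Space V →ₗ[ℂ] Space V) : ExtendsTo A 0 0 := by
  intro v'
  simp only [map_zero]
  exact hasSum_zero

namespace GeneratingModes

variable {vac : V 0} {φ : I → ℤ → Module.End ℂ (Space V)} {wt : I → ℤ}
  {D : Module.End ℂ (Space V)} (G : GeneratingModes vac φ wt D)

/-- The vertex operator map defined by the state-field correspondence. -/
def vertexMap (z : ℂ) : Space V →ₗ[ℂ] Space V →ₗ[ℂ] Compl V :=
  DirectSum.toModule ℂ ℤ _ fun h => (fieldAt h z).comp (G.state.comp (DirectSum.lof ℂ ℤ V h))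

include G

theorem vertexMap_apply {h : ℤ} {u : Space V} (hu : u ∈ gr V h) (z : ℂ) :
    G.vertexMap z u = fieldAt h z (G.state u) := by
  rw [eq_lof_of_mem_gr hu, vertexMap, DirectSum.toModule_lof]
  rfl

theorem state_homog {h : ℤ} {u : Space V} (hu : u ∈ gr V h) : Homog (gr V) h (G.state u) :=
  (G.state_mem hu).1

theorem vertexMap_finExp (v' : GDual V) (u x : Space V) :
    FinExp (fun k => pair v' (incl (G.state u k x))) fun z => pair v' (G.vertexMap z u x) := by
  induction u using space_induction with
  | h0 => simp only [map_zero, Pi.zero_apply, LinearMap.zero_apply]; exact finExp_zero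
  | hadd u w hu hw =>
    simp only [map_add, Pi.add_apply, LinearMap.add_apply]
    exact hu.add hw
  | h m u hu =>
    simp only [G.vertexMap_apply hu]
    exact (G.state_homog hu).finExp v' x

theorem state_D_apply (u : Space V) (k : ℤ) :
    G.state (D u) k = (-(k : ℂ)) • G.state u (k - 1) := by
  rw [G.state_D]

theorem vertexMap_hasWeakDeriv (u x : Space V) {z : ℂ} (hz : z ≠ 0) :
    HasWeakDeriv (fun w => G.vertexMap w u x) (G.vertexMap z (D u) x) z := by
  intro v'
  refine FinExp.hasDerivAt_of (G.vertexMap_finExp v' u x)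
    (f' := fun w => pair v' (G.vertexMap w (D u) x)) ?_ hz
  convert G.vertexMap_finExp v' (D u) x using 2 with k
  rw [G.state_D_apply]
  simp

/-- The component from weight m to weight n carries the power z^{-e} with e = (m + h - n) / 2, and
the claim amounts to (n - m) / 2 = -e + h / 2. If m + h - n is odd, the component is zero. -/
theorem vertexMap_L0_bracket (u x : Space V) {z : ℂ} (hz : z ≠ 0) :
    L0Compl (G.vertexMap z u x) - G.vertexMap z u (L0 x) =
      z • G.vertexMap z (D u) x + G.vertexMap z (L0 u) x := by
  induction u using space_induction with
  | h0 => simp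
  | hadd u w hu hw =>
    simp only [map_add, LinearMap.add_apply, smul_add]
    rw [add_sub_add_comm, hu, hw]; abel
  | h h u hu =>
    induction x using space_induction with
    | h0 => simp
    | hadd x y hx hy =>
      simp only [map_add, smul_add] at hx hy ⊢
      rw [add_sub_add_comm, hx, hy]; abel
    | h m x hx =>
      funext n
      rw [L0_apply hx, L0_apply hu, map_smul, map_smul, LinearMap.smul_apply,
        G.vertexMap_apply hu, G.vertexMap_apply (G.D_mem_gr hu), Pi.sub_apply, Pi.add_apply,
        Pi.smul_apply, Pi.smul_apply, Pi.smul_apply, L0Compl_apply, fieldAt_apply hx,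
        fieldAt_apply hx, show (m + (h + 2) - n) / 2 = (m + h - n) / 2 + 1 by omega,
        add_sub_cancel_right, G.state_D_apply, LinearMap.smul_apply, DirectSum.smul_apply,
        smul_smul, smul_smul, smul_smul, smul_smul, smul_smul, ← sub_smul, ← add_smul]
      rcases Int.even_or_odd' (m + h - n) with ⟨e, he | he⟩
      · rw [he, show 2 * e / 2 = e by omega, neg_add, zpow_add₀ hz, zpow_neg_one]
        congr 1
        have : (n : ℂ) = m + h - 2 * e := by
          have : n = m + h - 2 * e := by omega
          rw [this]; push_cast; ring
        field_simp
        rw [this]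
        ring
      · rw [G.state_homog hu _ m _ x hx rfl n (by omega), smul_zero, smul_zero]

theorem vertexMap_extendsTo (u x : Space V) {z : ℂ} (hz : z ≠ 0) :
    ExtendsTo D (G.vertexMap z u x) (G.vertexMap z (D u) x + G.vertexMap z u (D x)) := by
  induction u using space_induction with
  | h0 => simpa using extendsTo_zero D
  | hadd u w hu hw =>
    simp only [map_add, LinearMap.add_apply]
    rw [add_add_add_comm]
    exact hu.add hw
  | h h u hu =>
    induction x using space_induction with
    | h0 => simpa using extendsTo_zero D
    | hadd x y hx hy =>
      simp only [map_add]
      rw [add_add_add_comm]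
      exact hx.add hy
    | h m x hx =>
      intro v'
      rw [map_add, G.vertexMap_apply hu]
      refine ((G.state_homog hu).hasSum_proj hx z ((pair v').comp (incl.comp D)) _).2 ?_
      rw [← G.vertexMap_apply hu]
      refine (((G.vertexMap_finExp v' (D u) x).hasSum hz).add
        ((G.vertexMap_finExp v' u (D x)).hasSum hz)).congr_fun fun k => ?_
      have h1 := LinearMap.congr_fun ((G.state_mem hu).2.1 k) x
      rw [LinearMap.sub_apply, Module.End.mul_apply, Module.End.mul_apply, sub_eq_iff_eq_add] at h1
      simp only [LinearMap.comp_apply, h1, G.state_D_apply, map_add]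
      ring

theorem vertexMap_vacuum (x : Space V) {z : ℂ} : G.vertexMap z (vacuum vac) x = incl x := by
  induction x using space_induction with
  | h0 => simp
  | hadd x y hx hy => simp only [map_add, hx, hy]
  | h m x hx =>
    funext n
    rw [G.vertexMap_apply (vacuum_mem_gr vac), fieldAt_apply hx, G.state_vacuum, incl_apply]
    by_cases hn : n = m
    · subst hn; simp [idField]
    · rw [hx n hn]
      unfold idField
      split_ifs
      · rw [Module.End.one_apply, hx n hn, smul_zero]
      · simp

theorem state_creation (u : Space V) {k : ℤ} (hk : 0 ≤ k) : G.state u k (vacuum vac) = 0 := by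
  induction u using space_induction with
  | h0 => simp
  | hadd u w hu hw => rw [map_add, Pi.add_apply, LinearMap.add_apply, hu, hw, add_zero]
  | h h u hu => exact (G.state_mem hu).2.2.1 k hk

theorem vertexMap_creation (u : Space V) :
    HasLimitAtZero (fun z => G.vertexMap z u (vacuum vac)) (incl u) := by
  intro v'
  have h := (G.vertexMap_finExp v' u (vacuum vac)).tendsto fun k hk => by
    rw [G.state_creation u hk]; simp
  rwa [G.state_vacuum_neg_one] at h

end GeneratingModes

theorem GeneratingFields.vertexMap_gen {vac : V 0} {φ : I → ℂ → Space V →ₗ[ℂ] Compl V}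
    {wt : I → ℤ} {D : Space V →ₗ[ℂ] Space V} (H : GeneratingFields vac φ wt D) (i : I) {z : ℂ}
    (hz : z ≠ 0) : H.generatingModes.vertexMap z (modes φ wt i (-1) (vacuum vac)) = φ i z := by
  rw [H.generatingModes.vertexMap_apply
    (H.generatingModes.vec_mem (H.generatingModes.gen_mem i)), H.generatingModes.state_gen,
    H.eq_fieldAt i hz]

end VertexMap

/-! ### Laurent series in two variables: division by z₁ - z₂, Taylor expansion, diagonal. -/

section LaurentPolynomials

/-- The monomial of the Laurent expansions in two variables. -/
def mon₂ (z₁ z₂ : ℂ) (y : ℤ × ℤ) : ℂ := z₁ ^ (-y.1 - 1) * z₂ ^ (-y.2 - 1)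

theorem mon₂_sub {z₁ z₂ : ℂ} (h₁ : z₁ ≠ 0) (h₂ : z₂ ≠ 0) (p q : ℤ) (i : ℕ) :
    mon₂ z₁ z₂ (p - 1 - i, q + i) * (z₁⁻¹ * (z₂ / z₁) ^ i) = mon₂ z₁ z₂ (p, q) := by
  have e1 : z₁ ^ (-(p - 1 - i) - 1) = z₁ ^ (-p - 1) * z₁ * z₁ ^ i := by
    rw [← zpow_natCast z₁ i, ← zpow_add_one₀ h₁, ← zpow_add₀ h₁]; congr 1; ring
  have e2 : z₂ ^ (-q - 1) = z₂ ^ (-(q + i) - 1) * z₂ ^ i := by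
    rw [← zpow_natCast z₂ i, ← zpow_add₀ h₂]; congr 1; ring
  simp only [mon₂]
  rw [e1, e2, div_pow]
  field_simp

theorem hasSum_mul {α β : Type*} {f : α → ℂ} {g : β → ℂ} {s t : ℂ} (hf : HasSum f s)
    (hg : HasSum g t) : HasSum (fun x : α × β => f x.1 * g x.2) (s * t) :=
  hf.mul hg (summable_mul_of_summable_norm hf.summable.norm hg.summable.norm)

/-- The bijection that collects the terms of the expansion of `(z₁ - z₂)⁻¹ F(z₁, z₂)`. -/
def antidiagEquiv : (ℤ × ℤ) × ℕ ≃ (ℤ × ℤ) × ℕ where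
  toFun x := ((x.1.1 - 1 - x.2, x.1.2 + x.2), x.2)
  invFun x := ((x.1.1 + 1 + x.2, x.1.2 - x.2), x.2)
  left_inv x := by ext <;> simp; ring
  right_inv x := by ext <;> simp; ring

theorem antidiagEquiv_apply (y : ℤ × ℤ) (i : ℕ) :
    antidiagEquiv (y, i) = ((y.1 - 1 - i, y.2 + i), i) := rfl

/-- Division of a Laurent series by `z₁ - z₂`. -/
theorem hasSum_of_dif {F : ℤ × ℤ → ℂ} {Q : ℤ} (hF : ∀ p q, Q ≤ q → F (p, q) = 0) {z₁ z₂ s : ℂ}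
    (h₂ : z₂ ≠ 0) (h : ‖z₂‖ < ‖z₁‖)
    (hs : HasSum (fun y : ℤ × ℤ => dif (1, 0) (0, 1) F y * mon₂ z₁ z₂ y) s) :
    HasSum (fun y => F y * mon₂ z₁ z₂ y) (s / (z₁ - z₂)) := by
  have h₁ : z₁ ≠ 0 := norm_pos_iff.1 ((norm_nonneg _).trans_lt h)
  have h₁₂ : z₁ - z₂ ≠ 0 := sub_ne_zero.2 (by rintro rfl; exact lt_irrefl _ h)
  have hr : ‖z₂ / z₁‖ < 1 := by rwa [norm_div, div_lt_one (norm_pos_iff.2 h₁)]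
  have hg := (hasSum_geometric_of_norm_lt_one hr).mul_left z₁⁻¹
  have hm := hasSum_mul hs hg
  have hm' := antidiagEquiv.hasSum_iff.2 hm
  have hval : s * (z₁⁻¹ * (1 - z₂ / z₁)⁻¹) = s / (z₁ - z₂) := by
    rw [div_eq_mul_inv s, ← mul_inv, mul_sub, mul_one, mul_div_cancel₀ _ h₁]
  rw [hval] at hm'
  refine hm'.prod_fiberwise fun y => ?_
  -- The geometric series for (z₁ - z₂)⁻¹ spreads each term along its antidiagonal. At a given
  -- monomial the contributions are consecutive differences of F and telescope.
  have h3 : ∀ i : ℕ, ((fun x : (ℤ × ℤ) × ℕ => dif (1, 0) (0, 1) F x.1 * mon₂ z₁ z₂ x.1 *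
      (z₁⁻¹ * (z₂ / z₁) ^ x.2)) ∘ antidiagEquiv) (y, i) =
      (F (y.1 - i, y.2 + i) - F (y.1 - (i + 1 : ℕ), y.2 + (i + 1 : ℕ))) * mon₂ z₁ z₂ y := by
    intro i
    rw [Function.comp_apply, antidiagEquiv_apply, dif_apply, Prod.mk_add_mk, Prod.mk_add_mk,
      mul_assoc, mon₂_sub h₁ h₂, show y.1 - 1 - i + 1 = y.1 - (i : ℤ) by ring,
      show y.1 - 1 - i + 0 = y.1 - ((i + 1 : ℕ) : ℤ) by push_cast; ring,
      show y.2 + i + 1 = y.2 + ((i + 1 : ℕ) : ℤ) by push_cast; ring, add_zero]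
  simp only [h3]
  refine HasSum.mul_right _ ?_
  -- From `k` steps on, the second index is at least `Q`, so the telescoping sum is finite.
  set k := (Q - y.2).toNat with hk
  have hz : ∀ i : ℕ, k ≤ i → F (y.1 - i, y.2 + i) = 0 := fun i hi => hF _ _ (by omega)
  have h4 : HasSum (fun i : ℕ => F (y.1 - i, y.2 + i) - F (y.1 - (i + 1 : ℕ), y.2 + (i + 1 : ℕ)))
      (∑ i ∈ Finset.range k,
        (F (y.1 - i, y.2 + i) - F (y.1 - (i + 1 : ℕ), y.2 + (i + 1 : ℕ)))) :=
    hasSum_sum_of_ne_finset_zero fun i hi => by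
      rw [Finset.mem_range, not_lt] at hi
      rw [hz i hi, hz (i + 1) (by omega), sub_zero]
  rw [Finset.sum_range_sub' (fun i : ℕ => F (y.1 - i, y.2 + i)), hz k le_rfl] at h4
  simpa using h4

theorem hasSum_of_dif_pow {F : ℤ × ℤ → ℂ} {Q : ℤ} (hF : ∀ p q, Q ≤ q → F (p, q) = 0)
    {z₁ z₂ s : ℂ} (h₂ : z₂ ≠ 0) (h : ‖z₂‖ < ‖z₁‖) (N : ℕ)
    (hs : HasSum (fun y => (dif (1, 0) (0, 1) ^ N) F y * mon₂ z₁ z₂ y) s) :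
    HasSum (fun y => F y * mon₂ z₁ z₂ y) (s / (z₁ - z₂) ^ N) := by
  induction N generalizing F s with
  | zero => simpa using hs
  | succ N ih =>
    rw [pow_succ, Module.End.mul_apply] at hs
    have h1 := ih (F := dif (1, 0) (0, 1) F) (fun p q hq => by
      simp [hF _ _ hq, hF _ _ (hq.trans (by omega : q ≤ q + 1))]) hs
    have h2 := hasSum_of_dif hF h₂ h h1
    rwa [div_div, ← pow_succ] at h2

/-- The Laurent polynomial in two variables with given coefficients. -/
def lp (X : ℤ × ℤ → ℂ) (z₁ z₂ : ℂ) : ℂ := ∑' y, X y * mon₂ z₁ z₂ y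

variable {X : ℤ × ℤ → ℂ}

theorem lp_eq_sum {s : Finset (ℤ × ℤ)} (hs : ∀ y ∉ s, X y = 0) (z₁ z₂ : ℂ) :
    lp X z₁ z₂ = ∑ y ∈ s, X y * mon₂ z₁ z₂ y :=
  tsum_eq_sum fun y hy => by rw [hs y hy, zero_mul]

theorem hasSum_lp (hX : X.support.Finite) (z₁ z₂ : ℂ) :
    HasSum (fun y => X y * mon₂ z₁ z₂ y) (lp X z₁ z₂) := by
  have hs : ∀ y ∉ hX.toFinset, X y = 0 := fun y hy => by simpa using hy
  rw [lp_eq_sum hs]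
  exact hasSum_sum_of_ne_finset_zero fun y hy => by rw [hs y hy, zero_mul]

theorem isRational_lp (hX : X.support.Finite) : IsRational fun z : Fin 2 → ℂ => lp X (z 0) (z 1) := by
  have hs : ∀ y ∉ hX.toFinset, X y = 0 := fun y hy => by simpa using hy
  simp only [lp_eq_sum hs, mon₂]
  exact IsRational.sum _ fun y _ => (isRational_const _).mul
    ((isRational_coord_zpow _ _).mul (isRational_coord_zpow _ _))

theorem finite_support_der₁ (hX : X.support.Finite) : (der₁ X).support.Finite := by
  refine (hX.image fun y => (y.1 + 1, y.2)).subset fun y hy => ?_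
  refine ⟨(y.1 - 1, y.2), fun h => hy ?_, by simp⟩
  obtain ⟨p, q⟩ := y
  rw [der₁_apply]
  simp [h]

theorem finite_support_der₁_pow (hX : X.support.Finite) (j : ℕ) :
    ((der₁ ^ j) X).support.Finite := by
  induction j with
  | zero => simpa using hX
  | succ j ih => rw [pow_succ', Module.End.mul_apply]; exact finite_support_der₁ ih

theorem hasDerivAt_lp (hX : X.support.Finite) {z₁ : ℂ} (h₁ : z₁ ≠ 0) (z₂ : ℂ) :
    HasDerivAt (fun w => lp X w z₂) (lp (der₁ X) z₁ z₂) z₁ := by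
  have hs : ∀ y ∉ hX.toFinset, X y = 0 := fun y hy => by simpa using hy
  have h3 : HasDerivAt (fun w => ∑ y ∈ hX.toFinset, X y * (w ^ (-y.1 - 1) * z₂ ^ (-y.2 - 1)))
      (∑ y ∈ hX.toFinset, X y * ((((-y.1 - 1 : ℤ) : ℂ) * z₁ ^ (-y.1 - 1 - 1)) * z₂ ^ (-y.2 - 1)))
      z₁ :=
    HasDerivAt.fun_sum fun y _ =>
      ((hasDerivAt_zpow _ _ (Or.inl h₁)).mul_const _).const_mul _
  have h4 : (fun w => lp X w z₂) =
      fun w => ∑ y ∈ hX.toFinset, X y * (w ^ (-y.1 - 1) * z₂ ^ (-y.2 - 1)) :=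
    funext fun w => lp_eq_sum hs w z₂
  rw [h4]
  refine h3.congr_deriv ?_
  have h5 : HasSum (fun y : ℤ × ℤ =>
      X y * ((((-y.1 - 1 : ℤ) : ℂ) * z₁ ^ (-y.1 - 1 - 1)) * z₂ ^ (-y.2 - 1)))
      (∑ y ∈ hX.toFinset,
        X y * ((((-y.1 - 1 : ℤ) : ℂ) * z₁ ^ (-y.1 - 1 - 1)) * z₂ ^ (-y.2 - 1))) :=
    hasSum_sum_of_ne_finset_zero fun y hy => by rw [hs y hy, zero_mul]
  have h6 := (Equiv.addRight ((1, 0) : ℤ × ℤ)).hasSum_iff.2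
    (hasSum_lp (finite_support_der₁ hX) z₁ z₂)
  refine h5.unique (h6.congr_fun fun y => ?_)
  obtain ⟨p, q⟩ := y
  simp only [Function.comp_apply, Equiv.coe_addRight, Prod.mk_add_mk, der₁_apply,
    add_sub_cancel_right, add_zero, mon₂, smul_eq_mul]
  rw [show -(p + 1) - 1 = -p - 1 - 1 by ring]
  push_cast
  ring

theorem iteratedDeriv_lp (hX : X.support.Finite) (j : ℕ) {z₁ : ℂ} (h₁ : z₁ ≠ 0) (z₂ : ℂ) :
    iteratedDeriv j (fun w => lp X w z₂) z₁ = lp ((der₁ ^ j) X) z₁ z₂ := by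
  induction j generalizing z₁ with
  | zero => simp
  | succ j ih =>
    rw [iteratedDeriv_succ, pow_succ', Module.End.mul_apply]
    have : iteratedDeriv j (fun w => lp X w z₂) =ᶠ[𝓝 z₁] fun w => lp ((der₁ ^ j) X) w z₂ := by
      filter_upwards [isOpen_ne.mem_nhds h₁] with w hw using ih hw
    rw [this.deriv_eq]
    exact (hasDerivAt_lp (finite_support_der₁_pow hX j) h₁ z₂).deriv

/-- In its first variable the Laurent polynomial is singular only at 0, so the Taylor series at z₂
converges up to radius ‖z₂‖. -/
theorem hasSum_taylor_lp (hX : X.support.Finite) {z₁ z₂ : ℂ} (h : ‖z₁ - z₂‖ < ‖z₂‖) :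
    HasSum (fun j : ℕ => (j.factorial : ℂ)⁻¹ * lp ((der₁ ^ j) X) z₂ z₂ * (z₁ - z₂) ^ j)
      (lp X z₁ z₂) := by
  have h₂ : z₂ ≠ 0 := norm_pos_iff.1 ((norm_nonneg _).trans_lt h)
  have h1 : DifferentiableOn ℂ (fun w => lp X w z₂) (Metric.ball z₂ ‖z₂‖) := by
    intro w hw
    have : w ≠ 0 := by
      rintro rfl
      simp at hw
    exact (hasDerivAt_lp hX this z₂).differentiableAt.differentiableWithinAt
  have h2 := Complex.hasSum_taylorSeries_on_ball h1 (z := z₁)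
    (by rwa [Metric.mem_ball, dist_eq_norm])
  refine h2.congr_fun fun j => ?_
  rw [iteratedDeriv_lp hX j h₂, smul_eq_mul, smul_eq_mul]
  ring

theorem hasSum_lp_diag (hX : X.support.Finite) {z : ℂ} (hz : z ≠ 0) :
    HasSum (fun n : ℤ => diag X n * z ^ (-n - 1)) (lp X z z) := by
  set E : ℤ × ℤ ≃ ℤ × ℤ :=
    { toFun := fun x => (x.2, x.1 - 1 - x.2)
      invFun := fun x => (x.1 + x.2 + 1, x.1)
      left_inv := fun x => by ext <;> simp
      right_inv := fun x => by ext <;> simp } with hE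
  refine (E.hasSum_iff.2 (hasSum_lp hX z z)).prod_fiberwise fun n => ?_
  have h1 : ∀ p : ℤ, ((fun y => X y * mon₂ z z y) ∘ E) (n, p) =
      X (p, n - 1 - p) * z ^ (-n - 1) := by
    intro p
    simp only [Function.comp_apply, hE, Equiv.coe_fn_mk, mon₂]
    rw [← zpow_add₀ hz]
    congr 2
    ring
  simp only [h1]
  refine HasSum.mul_right _ ?_
  have h2 : (Function.support fun p : ℤ => X (p, n - 1 - p)).Finite :=
    Set.Finite.preimage (f := fun p : ℤ => (p, n - 1 - p))
      (fun a _ b _ hab => (Prod.ext_iff.1 hab).1) hX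
  rw [diag, finsum_eq_sum _ h2]
  exact hasSum_sum_of_ne_finset_zero fun p hp => by simpa using hp

end LaurentPolynomials

/-! ### Duality. -/

section Duality

variable {V : ℤ → Type u} [∀ n, AddCommGroup (V n)] [∀ n, Module ℂ (V n)] {I : Type v}

theorem parity_induction {p : Fin 2} {P : Space V → Prop} (h0 : P 0)
    (hadd : ∀ x y, P x → P y → P (x + y))
    (h : ∀ m : ℤ, m % 2 = ((p : ℕ) : ℤ) → ∀ x ∈ gr V m, P x) (x : Space V) (hx : HasParity p x) :
    P x := by
  classical
  rw [← DirectSum.sum_support_of x]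
  refine Finset.sum_induction _ P hadd h0 fun m _ => ?_
  by_cases hm : m % 2 = ((p : ℕ) : ℤ)
  · exact h m hm _ (lof_mem_gr m _)
  · rw [hx m hm, map_zero]
    exact h0

theorem sgn_eq_of_mod {h g : ℤ} {p q : Fin 2} (hh : h % 2 = ((p : ℕ) : ℤ))
    (hg : g % 2 = ((q : ℕ) : ℤ)) : sgn h g = (-1) ^ ((p : ℕ) * (q : ℕ)) := by
  have h1 : h = ((p : ℕ) : ℤ) + 2 * (h / 2) := by omega
  have h2 : g = ((q : ℕ) : ℤ) + 2 * (g / 2) := by omega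
  rw [h1, sgn_add_even, sgn_comm, h2, sgn_add_even, sgn, mul_comm]
  exact_mod_cast zpow_natCast (-1 : ℂ) _

/-- The weights of the components of v' and x fix p + q, and truncation bounds p and q from above.
-/
theorem Homog₂.finite_support {w : ℤ} {F : ℤ × ℤ → Module.End ℂ (Space V)}
    (hF : Homog₂ (gr V) w F) (ht : ∀ x, Trunc fun y => F y x) (v' : GDual V) (x : Space V) :
    (Function.support fun y => pair v' (incl (F y x))).Finite := by
  induction x using space_induction with
  | h0 => simp
  | hadd x y hx hy =>
    refine (hx.union hy).subset ?_
    simp only [map_add]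
    exact Function.support_add _ _
  | h m x hx =>
    induction v' using gdual_induction with
    | h0 => simp
    | hadd v' w' hv hw =>
      refine (hv.union hw).subset ?_
      simp only [map_add, LinearMap.add_apply]
      exact Function.support_add _ _
    | h n l =>
      obtain ⟨P, hP⟩ := ht x
      set c := (m + w - n) / 2 with hc
      refine ((Set.finite_Ioo (c - P) P).prod (Set.finite_Ioo (c - P) P)).subset ?_
      rintro ⟨p, q⟩ hy
      have h1 : F (p, q) x ≠ 0 := fun h => hy (by simp [h])
      have h2 : ¬ (P ≤ p ∨ P ≤ q) := fun h => h1 (hP p q h)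
      have h3 : n = m + w - 2 * (p + q) := by
        by_contra hne
        refine hy ?_
        beta_reduce
        rw [pair_lof, incl_apply, hF p q m _ x hx rfl n hne, map_zero]
      simp only [Set.mem_prod, Set.mem_Ioo]
      omega

theorem ope_swap {E : Type*} [AddCommGroup E] [Module ℂ E] {N : ℕ} {ε : ℂ}
    {a b : ℤ → Module.End ℂ E} (h : Loc N ε a b) (x : E) (y : ℤ × ℤ) :
    ope N a b y x = ((-1) ^ N * ε) • ope N b a y.swap x := by
  rw [ope_apply, h x, ope_apply]
  have e := congrFun (dif_pow_comp (v := ((1, 0) : ℤ × ℤ)) (w := (0, 1)) (v' := (0, 1))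
    (w' := (1, 0)) (Prod.swap : ℤ × ℤ → ℤ × ℤ) (fun y => by simp [Prod.swap])
    (fun y => by simp [Prod.swap]) N fun y => b y.1 (a y.2 x)) y
  rw [congrFun (dif_pow_swap ((1, 0) : ℤ × ℤ) (0, 1) N fun y => b y.1 (a y.2 x)) y.swap] at e
  rw [Pi.smul_apply, mul_comm, mul_smul]
  exact congrArg (ε • ·) e

/-- The duality axiom for given vectors, with a sign `ε`. -/
def HasDuality (Y : ℂ → Space V →ₗ[ℂ] Space V →ₗ[ℂ] Compl V) (ε : ℂ) (v' : GDual V)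
    (u₁ u₂ x : Space V) : Prop :=
  ∃ f : (Fin 2 → ℂ) → ℂ, IsRational f ∧
    (∀ z₁ z₂ : ℂ, ‖z₂‖ < ‖z₁‖ → 0 < ‖z₂‖ →
      HasSum (fun m : ℤ => pair v' (Y z₁ u₁ (proj m (Y z₂ u₂ x)))) (f ![z₁, z₂])) ∧
    (∀ z₁ z₂ : ℂ, ‖z₁‖ < ‖z₂‖ → 0 < ‖z₁‖ →
      HasSum (fun m : ℤ => ε * pair v' (Y z₂ u₂ (proj m (Y z₁ u₁ x)))) (f ![z₁, z₂])) ∧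
    (∀ z₁ z₂ : ℂ, ‖z₁ - z₂‖ < ‖z₂‖ → 0 < ‖z₁ - z₂‖ →
      HasSum (fun m : ℤ => pair v' (Y z₂ (proj m (Y (z₁ - z₂) u₁ u₂)) x)) (f ![z₁, z₂]))

namespace GeneratingModes

variable {vac : V 0} {φ : I → ℤ → Module.End ℂ (Space V)} {wt : I → ℤ}
  {D : Module.End ℂ (Space V)} (G : GeneratingModes vac φ wt D)

include G

theorem hasSum_modes {h g : ℤ} {u₁ u₂ : Space V} (h₁ : u₁ ∈ gr V h) (h₂ : u₂ ∈ gr V g) {N : ℕ}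
    {ε : ℂ} (hl : Loc N ε (G.state u₁) (G.state u₂)) (v' : GDual V) (x : Space V) {z₁ z₂ : ℂ}
    (hz : z₂ ≠ 0) (hz' : ‖z₂‖ < ‖z₁‖) :
    HasSum (fun y => pair v' (incl (G.state u₁ y.1 (G.state u₂ y.2 x))) * mon₂ z₁ z₂ y)
      (lp (fun y => pair v' (incl (ope N (G.state u₁) (G.state u₂) y x))) z₁ z₂ /
        (z₁ - z₂) ^ N) := by
  have hb := G.isField (G.state_mem h₂)
  obtain ⟨Q, hQ⟩ := hb x
  refine hasSum_of_dif_pow (F := fun y : ℤ × ℤ =>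
    pair v' (incl (G.state u₁ y.1 (G.state u₂ y.2 x)))) (Q := Q) (fun p q hq => by
      simp [hQ q hq]) hz hz' N ?_
  have h3 := hasSum_lp ((((G.state_homog h₁).homog₂ (G.state_homog h₂)).dif N).finite_support
    (G.trunc (G.state_mem h₁) (G.state_mem h₂) hl) v' x) z₁ z₂
  refine h3.congr_fun fun y => ?_
  congr 1
  have := congrFun (dif_pow_map ((1, 0) : ℤ × ℤ) (0, 1) ((pair v').comp incl) N
    fun y : ℤ × ℤ => G.state u₁ y.1 (G.state u₂ y.2 x)) y
  rw [← ope_apply] at this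
  exact this

/-- The two-point functions. -/
theorem exists_twoPoint {h g : ℤ} {u₁ u₂ : Space V} (h₁ : u₁ ∈ gr V h) (h₂ : u₂ ∈ gr V g)
    (v' : GDual V) (x : Space V) : ∃ (N : ℕ) (X : ℤ × ℤ → ℂ), X.support.Finite ∧
      (∀ z₁ z₂ : ℂ, z₂ ≠ 0 → ‖z₂‖ < ‖z₁‖ → HasSum (fun y =>
        pair v' (incl (G.state u₁ y.1 (G.state u₂ y.2 x))) * mon₂ z₁ z₂ y)
          (lp X z₁ z₂ / (z₁ - z₂) ^ N)) ∧
      (∀ z₁ z₂ : ℂ, z₁ ≠ 0 → ‖z₁‖ < ‖z₂‖ → HasSum (fun y => sgn h g *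
        (pair v' (incl (G.state u₂ y.1 (G.state u₁ y.2 x))) * mon₂ z₂ z₁ y))
          (lp X z₁ z₂ / (z₁ - z₂) ^ N)) ∧
      (∀ z₁ z₂ : ℂ, z₁ ≠ z₂ → ‖z₁ - z₂‖ < ‖z₂‖ → HasSum (fun k : ℤ =>
        pair v' (G.vertexMap z₂ (G.state u₁ k u₂) x) * (z₁ - z₂) ^ (-k - 1))
          (lp X z₁ z₂ / (z₁ - z₂) ^ N)) := by
  obtain ⟨N, hl⟩ := G.state_loc h₁ h₂
  set a := G.state u₁ with ha
  set b := G.state u₂ with hb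
  set X : ℤ × ℤ → ℂ := fun y => pair v' (incl (ope N a b y x)) with hX
  have hfin : X.support.Finite :=
    (((G.state_homog h₁).homog₂ (G.state_homog h₂)).dif N).finite_support
      (G.trunc (G.state_mem h₁) (G.state_mem h₂) hl) v' x
  refine ⟨N, X, hfin, fun z₁ z₂ hz hz' => G.hasSum_modes h₁ h₂ hl v' x hz hz', ?_, ?_⟩
  · intro z₁ z₂ hz hz'
    have h3 := (G.hasSum_modes h₂ h₁ (hl.symm (sgn_mul_self _ _)) v' x hz hz').mul_left (sgn h g)
    -- Locality identifies X, up to a sign, with the Laurent polynomial of the other order of the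
    -- fields, to which the expansion for |z₂| > |z₁| applies.
    have h4 : lp X z₁ z₂ =
        (-1) ^ N * sgn h g * lp (fun y => pair v' (incl (ope N b a y x))) z₂ z₁ := by
      rw [lp, lp, ← tsum_mul_left, ← (Equiv.prodComm ℤ ℤ).tsum_eq]
      refine tsum_congr fun y => ?_
      simp only [hX, Equiv.prodComm_apply, ope_swap hl, map_smul, smul_eq_mul, mon₂, Prod.swap_swap,
        Prod.fst_swap, Prod.snd_swap]
      ring
    have h5 : lp X z₁ z₂ / (z₁ - z₂) ^ N =
        sgn h g * (lp (fun y => pair v' (incl (ope N b a y x))) z₂ z₁ / (z₂ - z₁) ^ N) := by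
      rw [h4, ← neg_sub z₂ z₁, neg_pow (z₂ - z₁), mul_assoc, mul_div_mul_left _ _ (by simp),
        mul_div_assoc]
    rw [h5]
    exact h3
  · intro z₁ z₂ hz hz'
    have hz₂ : z₂ ≠ 0 := norm_pos_iff.1 ((norm_nonneg _).trans_lt hz')
    have hξ : z₁ - z₂ ≠ 0 := sub_ne_zero.2 hz
    -- The j-th Taylor coefficient of X on the diagonal is the matrix coefficient of the product
    -- field of index N - 1 - j, which by `state_prod` is a vertex operator.
    have hj : ∀ j : ℕ, pair v' (G.vertexMap z₂ (a (N - 1 - j) u₂) x) =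
        (j.factorial : ℂ)⁻¹ * lp ((der₁ ^ j) X) z₂ z₂ := by
      intro j
      have h3 := (G.vertexMap_finExp v' (a (N - 1 - j) u₂) x).hasSum hz₂
      rw [G.state_prod h₁ h₂ hl j] at h3
      have h4 := (hasSum_lp_diag (finite_support_der₁_pow hfin j) hz₂).mul_left (j.factorial : ℂ)⁻¹
      refine h3.unique (h4.congr_fun fun n => ?_)
      rw [← mul_assoc]
      congr 1
      rw [fieldProd_apply]
      have htr := G.trunc (G.state_mem h₁) (G.state_mem h₂) hl
      have h6 := opeDer_map N j a b (((pair v').comp incl).comp (LinearMap.applyₗ x))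
      have h7 : Trunc X := (htr x).map ((pair v').comp incl)
      rw [← smul_eq_mul, ← diag_smul _ (h7.der₁ j)]
      exact (diag_map ((pair v').comp incl) (trunc_opeDer htr j x) n).symm.trans
        (congrArg (fun F => diag F n) h6)
    have h5 := (hasSum_taylor_lp hfin hz').mul_right ((z₁ - z₂) ^ N)⁻¹
    rw [← div_eq_mul_inv] at h5
    -- The terms with k ≥ N vanish, and the others are numbered by k = N - 1 - j.
    have hinj : Function.Injective fun j : ℕ => (N : ℤ) - 1 - j := fun i j hij => by
      simp only at hij; omega
    rw [← hinj.hasSum_iff]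
    · refine h5.congr_fun fun j => ?_
      rw [Function.comp_apply, hj, show -((N : ℤ) - 1 - j) - 1 = (j : ℤ) - N by ring,
        zpow_sub₀ hξ, zpow_natCast, zpow_natCast]
      ring
    · intro k hk
      have : (N : ℤ) ≤ k := by
        by_contra hc
        exact hk ⟨(N - 1 - k).toNat, by simp only; omega⟩
      rw [G.state_eq_zero_of_le h₁ h₂ hl this]
      simp

theorem hasSum_vertexMap_mode (v' : GDual V) (u₁ u₂ x : Space V) {z₁ z₂ s : ℂ} (hz : z₁ ≠ 0)
    (h : HasSum (fun y : ℤ × ℤ =>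
      pair v' (incl (G.state u₁ y.1 (G.state u₂ y.2 x))) * mon₂ z₁ z₂ y) s) :
    HasSum (fun k : ℤ => pair v' (G.vertexMap z₁ u₁ (G.state u₂ k x)) * z₂ ^ (-k - 1)) s := by
  refine ((Equiv.prodComm ℤ ℤ).hasSum_iff.2 h).prod_fiberwise fun k => ?_
  refine (((G.vertexMap_finExp v' u₁ (G.state u₂ k x)).hasSum hz).mul_right
    (z₂ ^ (-k - 1))).congr_fun fun p => ?_
  simp only [Function.comp_apply, Equiv.prodComm_apply, mon₂, Prod.fst_swap, Prod.snd_swap]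
  ring

theorem duality_of_mem {h₀ g m : ℤ} {u₁ u₂ x : Space V} (h₁ : u₁ ∈ gr V h₀) (h₂ : u₂ ∈ gr V g)
    (hx : x ∈ gr V m) (v' : GDual V) : HasDuality G.vertexMap (sgn h₀ g) v' u₁ u₂ x := by
  obtain ⟨N, X, hX, h1, h2, h3⟩ := G.exists_twoPoint h₁ h₂ v' x
  refine ⟨fun z => lp X (z 0) (z 1) / (z 0 - z 1) ^ N, ?_, fun z₁ z₂ h h' => ?_,
    fun z₁ z₂ h h' => ?_, fun z₁ z₂ h h' => ?_⟩
  · refine ((isRational_lp hX).mul ((isRational_sub_inv (j := 0) (l := 1) (by decide)).pow N)).congr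
      fun z _ => ?_
    rw [inv_pow, div_eq_mul_inv]
  · have hz₂ := norm_pos_iff.1 h'
    rw [G.vertexMap_apply h₂]
    refine ((G.state_homog h₂).hasSum_proj hx z₂ ((pair v').comp (G.vertexMap z₁ u₁)) _).2 ?_
    exact (G.hasSum_vertexMap_mode v' u₁ u₂ x (norm_pos_iff.1 (h'.trans h)) (h1 z₁ z₂ hz₂ h))
  · have hz₁ := norm_pos_iff.1 h'
    have h4 := (h2 z₁ z₂ hz₁ h).mul_left (sgn h₀ g)
    simp only [← mul_assoc, sgn_mul_self, one_mul] at h4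
    have h5 := G.hasSum_vertexMap_mode v' u₂ u₁ x (norm_pos_iff.1 (h'.trans h)) h4
    have h6 := (((G.state_homog h₁).hasSum_proj hx z₁
      ((pair v').comp (G.vertexMap z₂ u₂)) _).2 h5).mul_left (sgn h₀ g)
    simp only [← mul_assoc, sgn_mul_self, one_mul, ← G.vertexMap_apply h₁] at h6
    exact h6
  · rw [G.vertexMap_apply h₁]
    refine ((G.state_homog h₁).hasSum_proj h₂ (z₁ - z₂)
      ((pair v').comp ((G.vertexMap z₂).flip x)) _).2 ?_
    exact h3 z₁ z₂ (sub_ne_zero.1 (norm_pos_iff.1 h')) h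

theorem duality (p₁ p₂ : Fin 2) (u₁ u₂ x : Space V) (v' : GDual V) (hp₁ : HasParity p₁ u₁)
    (hp₂ : HasParity p₂ u₂) :
    HasDuality G.vertexMap ((-1) ^ ((p₁ : ℕ) * (p₂ : ℕ))) v' u₁ u₂ x := by
  refine parity_induction (P := fun u₁ => HasDuality G.vertexMap _ v' u₁ u₂ x) ?_ ?_ ?_ u₁ hp₁
  · exact ⟨0, isRational_const 0, by simp, by simp, by simp⟩
  · rintro u w ⟨f, hf, h1, h2, h3⟩ ⟨f', hf', h1', h2', h3'⟩
    refine ⟨_, hf.add hf', fun z₁ z₂ h h' => ?_, fun z₁ z₂ h h' => ?_, fun z₁ z₂ h h' => ?_⟩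
    · simpa only [map_add, LinearMap.add_apply] using (h1 z₁ z₂ h h').add (h1' z₁ z₂ h h')
    · simpa only [map_add, LinearMap.add_apply, mul_add] using
        (h2 z₁ z₂ h h').add (h2' z₁ z₂ h h')
    · simpa only [map_add, LinearMap.add_apply] using (h3 z₁ z₂ h h').add (h3' z₁ z₂ h h')
  intro h hh u₁ h₁
  refine parity_induction (P := fun u₂ => HasDuality G.vertexMap _ v' u₁ u₂ x) ?_ ?_ ?_ u₂ hp₂
  · exact ⟨0, isRational_const 0, by simp, by simp, by simp⟩
  · rintro u w ⟨f, hf, h1, h2, h3⟩ ⟨f', hf', h1', h2', h3'⟩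
    refine ⟨_, hf.add hf', fun z₁ z₂ h h' => ?_, fun z₁ z₂ h h' => ?_, fun z₁ z₂ h h' => ?_⟩
    · simpa only [map_add, LinearMap.add_apply] using (h1 z₁ z₂ h h').add (h1' z₁ z₂ h h')
    · simpa only [map_add, LinearMap.add_apply, mul_add] using
        (h2 z₁ z₂ h h').add (h2' z₁ z₂ h h')
    · simpa only [map_add, LinearMap.add_apply] using (h3 z₁ z₂ h h').add (h3' z₁ z₂ h h')
  intro g hg u₂ h₂
  rw [← sgn_eq_of_mod hh hg]
  induction x using space_induction with
  | h0 => exact ⟨0, isRational_const 0, by simp, by simp, by simp⟩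
  | hadd x y hx hy =>
    obtain ⟨f, hf, h1, h2, h3⟩ := hx
    obtain ⟨f', hf', h1', h2', h3'⟩ := hy
    refine ⟨_, hf.add hf', fun z₁ z₂ h h' => ?_, fun z₁ z₂ h h' => ?_, fun z₁ z₂ h h' => ?_⟩
    · simpa only [map_add, LinearMap.add_apply] using (h1 z₁ z₂ h h').add (h1' z₁ z₂ h h')
    · simpa only [map_add, LinearMap.add_apply, mul_add] using
        (h2 z₁ z₂ h h').add (h2' z₁ z₂ h h')
    · simpa only [map_add, LinearMap.add_apply] using (h3 z₁ z₂ h h').add (h3' z₁ z₂ h h')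
  | h m x hx => exact G.duality_of_mem h₁ h₂ hx v'

theorem isVertexSuperalgebra : IsVertexSuperalgebra vac G.vertexMap where
  grading := G.grading
  analytic u x v' _ hz :=
    (G.vertexMap_hasWeakDeriv u x hz v').differentiableAt.differentiableWithinAt
  L0_bracket u x _ hz :=
    ⟨_, G.vertexMap_hasWeakDeriv u x hz, G.vertexMap_L0_bracket u x hz⟩
  identity x _ _ := G.vertexMap_vacuum x
  creation := G.vertexMap_creation
  derivative := ⟨D, fun u => ⟨fun z => G.vertexMap z (D u) (vacuum vac),
      fun _ hz => G.vertexMap_hasWeakDeriv u _ hz, G.vertexMap_creation (D u)⟩,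
    fun u x _ hz => G.vertexMap_hasWeakDeriv u x hz,
    fun u x _ hz => G.vertexMap_extendsTo u x hz⟩
  duality := G.duality

end GeneratingModes
end Duality

/-! ### Expansions of rational functions of several variables and analytic continuation. -/

section RationalExpansions

variable {k : ℕ}

/-- Rational functions are generated by the coordinates, their inverses and the inverses of their
differences. -/
theorem IsRational.induction {P : ((Fin k → ℂ) → ℂ) → Prop}
    (hcongr : ∀ f g, P f → (∀ z ∈ config k, g z = f z) → P g)
    (hconst : ∀ c, P fun _ => c) (hadd : ∀ f g, P f → P g → P fun z => f z + g z)
    (hmul : ∀ f g, P f → P g → P fun z => f z * g z) (hcoord : ∀ j, P fun z => z j)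
    (hinv : ∀ j, P fun z => (z j)⁻¹) (hsub : ∀ j l, j < l → P fun z => (z j - z l)⁻¹)
    {f : (Fin k → ℂ) → ℂ} (hf : IsRational f) : P f := by
  have hpow : ∀ f n, P f → P fun z => f z ^ n := by
    intro f n h
    induction n with
    | zero => simpa only [pow_zero] using hconst 1
    | succ n ih => simpa only [pow_succ] using hmul _ _ ih h
  have hprod : ∀ (s : Finset (Fin k)) (f : Fin k → (Fin k → ℂ) → ℂ), (∀ j ∈ s, P (f j)) →
      P fun z => ∏ j ∈ s, f j z := by
    intro s
    induction s using Finset.induction_on with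
    | empty => intro f _; simpa using hconst 1
    | insert i s hi ih =>
      intro f h
      simp only [Finset.prod_insert hi]
      exact hmul _ _ (h i (by simp)) (ih f fun j hj => h j (by simp [hj]))
  have heval : ∀ p : MvPolynomial (Fin k) ℂ, P fun z => MvPolynomial.eval z p := by
    intro p
    induction p using MvPolynomial.induction_on with
    | C a => simpa using hconst a
    | add p q hp hq => simpa using hadd _ _ hp hq
    | mul_X p j hp => simpa using hmul _ _ hp (hcoord j)
  obtain ⟨p, a, b, hp⟩ := hf
  refine hcongr _ _ (hmul _ _ (heval p) (hmul _ _
    (hprod Finset.univ (fun j z => (z j)⁻¹ ^ a j) fun j _ => hpow _ _ (hinv j))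
    (hprod Finset.univ (fun j z => ∏ l ∈ Finset.Ioi j, (z j - z l)⁻¹ ^ b j l) fun j _ =>
      hprod _ (fun l z => (z j - z l)⁻¹ ^ b j l) fun l hl =>
        hpow _ _ (hsub j l (Finset.mem_Ioi.1 hl))))) fun z hz => ?_
  rw [hp z hz, ratFun, div_eq_mul_inv, mul_inv]
  simp only [inv_pow, Finset.prod_inv_distrib]

/-- The function has an expansion in decreasing powers of its first variable, with coefficients
rational in the other ones. -/
def FirstExpandable (f : (Fin (k + 1) → ℂ) → ℂ) : Prop :=
  ∃ (T : Type) (_ : Countable T) (e : T → ℤ) (c : T → (Fin k → ℂ) → ℂ),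
    (∃ P, ∀ t, e t ≤ P) ∧ (∀ n, {t | e t = n}.Finite) ∧ (∀ t, IsRational (c t)) ∧
    ∀ z ∈ config k, ∀ z₁ : ℂ, z₁ ≠ 0 → (∀ j, ‖z j‖ < ‖z₁‖) →
      HasSum (fun t => c t z * z₁ ^ e t) (f (Fin.cons z₁ z))

theorem FirstExpandable.of_unit {f : (Fin (k + 1) → ℂ) → ℂ} (n : ℤ) {c : (Fin k → ℂ) → ℂ}
    (hc : IsRational c) (h : ∀ z z₁, f (Fin.cons z₁ z) = c z * z₁ ^ n) : FirstExpandable f :=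
  ⟨Unit, inferInstance, fun _ => n, fun _ => c, ⟨n, fun _ => le_rfl⟩, fun _ => Set.toFinite _,
    fun _ => hc, fun z _ z₁ _ _ => by rw [h]; simp⟩

theorem IsRational.firstExpandable {f : (Fin (k + 1) → ℂ) → ℂ} (hf : IsRational f) :
    FirstExpandable f := by
  refine hf.induction ?_ ?_ ?_ ?_ ?_ ?_ ?_
  · rintro f g ⟨T, hT, e, c, hP, hfin, hc, h⟩ hfg
    refine ⟨T, hT, e, c, hP, hfin, hc, fun z hz z₁ h₁ hz₁ => ?_⟩
    rw [hfg]
    · exact h z hz z₁ h₁ hz₁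
    · refine ⟨fun j => Fin.cases (by simpa) (fun j => by simpa using hz.1 j) j, ?_⟩
      rw [Fin.cons_injective_iff]
      refine ⟨?_, hz.2⟩
      rintro ⟨j, hj⟩
      exact (hz₁ j).ne (by rw [hj])
  · exact fun c => .of_unit 0 (isRational_const c) fun z z₁ => by simp
  · rintro f g ⟨T, hT, e, c, ⟨P, hP⟩, hfin, hc, h⟩ ⟨T', hT', e', c', ⟨P', hP'⟩, hfin', hc', h'⟩
    refine ⟨T ⊕ T', inferInstance, Sum.elim e e', Sum.elim c c', ⟨max P P', ?_⟩, fun n => ?_, ?_,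
      fun z hz z₁ h₁ hz₁ => ?_⟩
    · rintro (t | t)
      · exact (hP t).trans (le_max_left _ _)
      · exact (hP' t).trans (le_max_right _ _)
    · refine (((hfin n).image Sum.inl).union ((hfin' n).image Sum.inr)).subset ?_
      rintro (t | t) ht
      · exact Or.inl ⟨t, ht, rfl⟩
      · exact Or.inr ⟨t, ht, rfl⟩
    · rintro (t | t)
      · exact hc t
      · exact hc' t
    · exact HasSum.sum (f := fun t => Sum.elim c c' t z * z₁ ^ Sum.elim e e' t)
        (h z hz z₁ h₁ hz₁) (h' z hz z₁ h₁ hz₁)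
  · rintro f g ⟨T, hT, e, c, ⟨P, hP⟩, hfin, hc, h⟩ ⟨T', hT', e', c', ⟨P', hP'⟩, hfin', hc', h'⟩
    refine ⟨T × T', inferInstance, fun t => e t.1 + e' t.2, fun t z => c t.1 z * c' t.2 z,
      ⟨P + P', fun t => add_le_add (hP _) (hP' _)⟩, fun n => ?_, fun t => (hc _).mul (hc' _),
      fun z hz z₁ h₁ hz₁ => ?_⟩
    -- The upper bounds on both families of exponents leave finitely many ways to write n as a sum.
    · refine ((Set.finite_Icc (n - P') P).biUnion fun i _ =>
        (hfin i).prod (hfin' (n - i))).subset ?_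
      rintro ⟨t, t'⟩ ht
      simp only [Set.mem_ofPred_eq] at ht
      have := hP t
      have := hP' t'
      refine Set.mem_biUnion (x := e t) ⟨by omega, by omega⟩ ⟨rfl, ?_⟩
      simp only [Set.mem_ofPred_eq]
      omega
    · refine (hasSum_mul (h z hz z₁ h₁ hz₁) (h' z hz z₁ h₁ hz₁)).congr_fun fun t => ?_
      beta_reduce
      rw [zpow_add₀ h₁]
      ring
  · intro j
    refine Fin.cases ?_ (fun j => ?_) j
    · exact .of_unit 1 (isRational_const 1) fun z z₁ => by simp
    · exact .of_unit 0 (isRational_coord j) fun z z₁ => by simp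
  · intro j
    refine Fin.cases ?_ (fun j => ?_) j
    · exact .of_unit (-1) (isRational_const 1) fun z z₁ => by simp
    · exact .of_unit 0 (isRational_coord_inv j) fun z z₁ => by simp
  · intro j l
    refine Fin.cases ?_ (fun l => ?_) l
    · intro h; simp at h
    refine Fin.cases (fun _ => ?_) (fun j hjl => ?_) j
    · refine ⟨ℕ, inferInstance, fun n => -n - 1, fun n z => z l ^ n, ⟨0, fun t => by beta_reduce; omega⟩,
        fun n => ?_, fun n => (isRational_coord l).pow n, fun z hz z₁ h₁ hz₁ => ?_⟩
      · refine (Set.finite_singleton (-n - 1).toNat).subset fun t ht => ?_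
        simp only [Set.mem_ofPred_eq] at ht
        simp only [Set.mem_singleton_iff]
        omega
      · simp only [Fin.cons_zero, Fin.cons_succ]
        have hr : ‖z l / z₁‖ < 1 := by
          rw [norm_div, div_lt_one (norm_pos_iff.2 h₁)]
          exact hz₁ l
        have hg := (hasSum_geometric_of_norm_lt_one hr).mul_left z₁⁻¹
        rw [← mul_inv, mul_sub, mul_one, mul_div_cancel₀ _ h₁] at hg
        refine hg.congr_fun fun n => ?_
        rw [zpow_sub_one₀ h₁, zpow_neg, zpow_natCast, div_pow]
        ring
    · exact .of_unit 0 (isRational_sub_inv (Fin.succ_lt_succ_iff.1 hjl)) fun z z₁ => by simp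

theorem hasSum_fiberwise {T : Type*} {F : T → ℂ} {s : ℂ} {κ : T → ℤ} {b : ℤ → ℂ} (h : HasSum F s)
    (hb : ∀ n, HasSum (fun t => if κ t = n then F t else 0) (b n)) : HasSum b s := by
  refine (h.tsum_fiberwise κ).congr_fun fun n => ?_
  rw [← (hb n).tsum_eq, tsum_subtype]
  refine tsum_congr fun t => ?_
  classical
  rw [Set.indicator_apply]
  exact ite_congr rfl (fun _ => rfl) fun _ => rfl

/-- Only finitely many terms share an exponent, so collecting them keeps the coefficients rational.
-/
theorem IsRational.exists_firstExpansion {f : (Fin (k + 1) → ℂ) → ℂ} (hf : IsRational f) :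
    ∃ c : ℤ → (Fin k → ℂ) → ℂ, (∀ n, IsRational (c n)) ∧
      ∀ z ∈ config k, ∀ z₁ : ℂ, z₁ ≠ 0 → (∀ j, ‖z j‖ < ‖z₁‖) →
        HasSum (fun n => c n z * z₁ ^ (-n - 1)) (f (Fin.cons z₁ z)) := by
  obtain ⟨T, hT, e, c, -, hfin, hc, h⟩ := hf.firstExpandable
  refine ⟨fun n z => ∑ t ∈ (hfin (-n - 1)).toFinset, c t z,
    fun n => IsRational.sum _ fun t _ => hc t, fun z hz z₁ h₁ hz₁ => ?_⟩
  refine hasSum_fiberwise (κ := fun t => -e t - 1) (h z hz z₁ h₁ hz₁) fun n => ?_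
  have h2 : ∀ t, (-e t - 1 = n) ↔ e t = -n - 1 := fun t => by omega
  have h3 : (∑ t ∈ (hfin (-n - 1)).toFinset, c t z) * z₁ ^ (-n - 1) =
      ∑ t ∈ (hfin (-n - 1)).toFinset, if -e t - 1 = n then c t z * z₁ ^ e t else 0 := by
    rw [Finset.sum_mul]
    refine Finset.sum_congr rfl fun t ht => ?_
    have : e t = -n - 1 := by simpa using ht
    rw [if_pos ((h2 t).2 this), this]
  rw [h3]
  exact hasSum_sum_of_ne_finset_zero fun t ht => if_neg fun hc => ht (by simpa using (h2 t).1 hc)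

/-- The configurations in which all but the first variable are close to `b`. -/
theorem IsRational.expandable_outer {f : (Fin (k + 1) → ℂ) → ℂ} (hf : IsRational f) {b : ℂ}
    (hb : b ≠ 0) : ∃ (T : Type) (_ : Countable T) (d : T → ℂ) (e : T → Fin (k + 1) → ℤ),
      ∀ (w : ℂ) (ξ : Fin k → ℂ), ξ ∈ region k → (∀ j, ‖ξ j‖ < ‖b‖) → (∀ j, ‖b‖ + ‖ξ j‖ < ‖w‖) →
        ‖b‖ < ‖w‖ → HasSum (fun t => d t * w ^ e t 0 * ∏ j, ξ j ^ e t (Fin.succ j))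
          (f (Fin.cons w fun j => ξ j + b)) := by
  set U : Set (Fin (k + 1) → ℂ) := {z | (∀ j, z j ≠ 0) ∧ Fin.tail z ∈ region k ∧
    (∀ j : Fin k, ‖z j.succ‖ < ‖b‖) ∧ (∀ j : Fin k, ‖b‖ + ‖z j.succ‖ < ‖z 0‖) ∧ ‖b‖ < ‖z 0‖} with hU
  have hU0 : ∀ z ∈ U, ∀ j, z j ≠ 0 := fun z hz => hz.1
  have key : Expandable U fun z => f (Fin.cons (z 0) fun j => z j.succ + b) := by
    refine hf.induction (P := fun f => Expandable U fun z => f (Fin.cons (z 0) fun j => z j.succ + b))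
      ?_ ?_ ?_ ?_ ?_ ?_ ?_
    · intro f g h hfg
      refine h.congr fun z hz => hfg _ ⟨?_, ?_⟩
      · refine fun j => Fin.cases (by simpa using hz.1 0) (fun j => ?_) j
        rw [Fin.cons_succ]
        intro h0
        have := hz.2.2.1 j
        rw [eq_neg_of_add_eq_zero_left h0, norm_neg] at this
        exact lt_irrefl _ this
      · rw [Fin.cons_injective_iff]
        refine ⟨?_, ?_⟩
        · rintro ⟨j, hj⟩
          have h1 := hz.2.2.2.1 j
          rw [← hj] at h1
          have := norm_add_le (z j.succ) b
          linarith
        · intro j l hjl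
          exact (region_subset_config k hz.2.1).2 (add_right_cancel hjl)
    · exact fun c => expandable_const c
    · exact fun f g h h' => h.add h'
    · exact fun f g h h' => h.mul hU0 h'
    · intro j
      refine Fin.cases ?_ (fun j => ?_) j
      · simpa using expandable_coord (U := U) 0
      · simpa using (expandable_coord (U := U) j.succ).add (expandable_const b)
    · intro j
      refine Fin.cases ?_ (fun j => ?_) j
      · simpa using expandable_zpow (U := U) 0 (-1)
      · simpa using expandable_const_add_inv (U := U) j.succ hb fun z hz => hz.2.2.1 j
    · intro j l
      refine Fin.cases (fun h => by simp at h) (fun l => ?_) l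
      refine Fin.cases (fun _ => ?_) (fun j hjl => ?_) j
      · refine (expandable_inv_three hU0 0 l.succ b fun z hz => hz.2.2.2.1 l).congr fun z _ => ?_
        simp only [Fin.cons_zero, Fin.cons_succ]
        congr 1
        ring
      · refine (expandable_sub_inv hU0 j.succ l.succ fun z hz =>
          hz.2.1.2 (Fin.succ_lt_succ_iff.1 hjl)).congr fun z _ => ?_
        simp only [Fin.cons_succ, add_sub_add_right_eq_sub]
  obtain ⟨T, hT, d, e, h⟩ := key
  refine ⟨T, hT, d, e, fun w ξ hξ h1 h2 h3 => ?_⟩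
  have hw : w ≠ 0 := norm_pos_iff.1 ((norm_nonneg _).trans_lt h3)
  have := h (Fin.cons w ξ) ⟨fun j => Fin.cases (by simpa) (fun j => by simpa using hξ.1 j) j,
    by simpa using hξ, by simpa using h1, by simpa using h2, by simpa using h3⟩
  simpa [Fin.prod_univ_succ, mul_assoc] using this

/-- To reach every w other than 0 and b, the quantity w - b is treated as an independent variable x,
and (x - ξⱼ)⁻¹ is expanded for |ξⱼ| < |x|. Only powers of y = w and x = w - b occur as coefficients,
so the residues in ξ become Laurent series in w and w - b, holomorphic off 0 and b. -/
theorem IsRational.expandable_inner {f : (Fin (k + 1) → ℂ) → ℂ} (hf : IsRational f) {b : ℂ}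
    (hb : b ≠ 0) : ∃ (T : Type) (_ : Countable T) (d : T → ℂ) (e₁ e₂ : T → ℤ) (e : T → Fin k → ℤ)
      (g : ℂ → ℂ → (Fin k → ℂ) → ℂ),
      (∀ (y x : ℂ) (ξ : Fin k → ℂ), y ≠ 0 → x ≠ 0 → ξ ∈ region k → (∀ j, ‖ξ j‖ < ‖b‖) →
        (∀ j, ‖ξ j‖ < ‖x‖) →
          HasSum (fun t => d t * (y ^ e₁ t * x ^ e₂ t) * ∏ j, ξ j ^ e t j) (g y x ξ)) ∧
      ∀ (w : ℂ) (ξ : Fin k → ℂ), w ≠ 0 → w ≠ b → ξ ∈ region k → (∀ j, ‖ξ j‖ < ‖b‖) →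
        (∀ j, ‖ξ j‖ < ‖w - b‖) → g w (w - b) ξ = f (Fin.cons w fun j => ξ j + b) := by
  set U : Set (Fin (k + 2) → ℂ) := {z | (∀ j, z j ≠ 0) ∧ Fin.tail (Fin.tail z) ∈ region k ∧
    (∀ j : Fin k, ‖z j.succ.succ‖ < ‖b‖) ∧ ∀ j : Fin k, ‖z j.succ.succ‖ < ‖z 1‖} with hU
  have hU0 : ∀ z ∈ U, ∀ j, z j ≠ 0 := fun z hz => hz.1
  have key : ∃ g, Expandable U g ∧ ∀ z ∈ U, z 1 = z 0 - b →
      g z = f (Fin.cons (z 0) fun j => z j.succ.succ + b) := by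
    refine hf.induction (P := fun f => ∃ g, Expandable U g ∧ ∀ z ∈ U, z 1 = z 0 - b →
      g z = f (Fin.cons (z 0) fun j => z j.succ.succ + b)) ?_ ?_ ?_ ?_ ?_ ?_ ?_
    · rintro f f' ⟨g, hg, h⟩ hfg
      refine ⟨g, hg, fun z hz hz1 => (h z hz hz1).trans (hfg _ ⟨?_, ?_⟩).symm⟩
      · refine fun j => Fin.cases (by simpa using hz.1 0) (fun j => ?_) j
        rw [Fin.cons_succ]
        intro h0
        have := hz.2.2.1 j
        rw [eq_neg_of_add_eq_zero_left h0, norm_neg] at this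
        exact lt_irrefl _ this
      · rw [Fin.cons_injective_iff]
        refine ⟨?_, ?_⟩
        · rintro ⟨j, hj⟩
          have h1 := hz.2.2.2 j
          rw [hz1, ← hj, add_sub_cancel_right] at h1
          exact lt_irrefl _ h1
        · intro j l hjl
          exact (region_subset_config k hz.2.1).2 (add_right_cancel hjl)
    · exact fun c => ⟨_, expandable_const c, fun _ _ _ => rfl⟩
    · rintro f f' ⟨g, hg, h⟩ ⟨g', hg', h'⟩
      exact ⟨_, hg.add hg', fun z hz hz1 => by rw [h z hz hz1, h' z hz hz1]⟩
    · rintro f f' ⟨g, hg, h⟩ ⟨g', hg', h'⟩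
      exact ⟨_, hg.mul hU0 hg', fun z hz hz1 => by rw [h z hz hz1, h' z hz hz1]⟩
    · intro j
      refine Fin.cases ?_ (fun j => ?_) j
      · exact ⟨_, expandable_coord 0, fun _ _ _ => by simp⟩
      · exact ⟨_, (expandable_coord j.succ.succ).add (expandable_const b), fun _ _ _ => by simp⟩
    · intro j
      refine Fin.cases ?_ (fun j => ?_) j
      · exact ⟨_, expandable_zpow 0 (-1), fun _ _ _ => by simp⟩
      · exact ⟨_, expandable_const_add_inv j.succ.succ hb fun z hz => hz.2.2.1 j,
          fun _ _ _ => by simp⟩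
    · intro j l
      refine Fin.cases (fun h => by simp at h) (fun l => ?_) l
      refine Fin.cases (fun _ => ?_) (fun j hjl => ?_) j
      · refine ⟨_, expandable_sub_inv hU0 1 l.succ.succ fun z hz => hz.2.2.2 l,
          fun z _ hz1 => ?_⟩
        simp only [Fin.cons_zero, Fin.cons_succ, hz1]
        congr 1
        ring
      · refine ⟨_, expandable_sub_inv hU0 j.succ.succ l.succ.succ fun z hz =>
          hz.2.1.2 (Fin.succ_lt_succ_iff.1 hjl), fun z _ _ => ?_⟩
        simp only [Fin.cons_succ, add_sub_add_right_eq_sub]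
  obtain ⟨g, ⟨T, hT, d, e, h⟩, hg⟩ := key
  have hmem : ∀ (y x : ℂ) (ξ : Fin k → ℂ), y ≠ 0 → x ≠ 0 → ξ ∈ region k → (∀ j, ‖ξ j‖ < ‖b‖) →
      (∀ j, ‖ξ j‖ < ‖x‖) → (Fin.cons y (Fin.cons x ξ) : Fin (k + 2) → ℂ) ∈ U := by
    intro y x ξ hy hx hξ h1 h2
    refine ⟨fun j => ?_, by simpa using hξ, by simpa using h1, ?_⟩
    · refine Fin.cases (by simpa) (fun j => Fin.cases (by simpa) (fun j => ?_) j) j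
      simpa using hξ.1 j
    · intro j
      rw [← Fin.succ_zero_eq_one]
      simpa using h2 j
  refine ⟨T, hT, d, fun t => e t 0, fun t => e t 1, fun t j => e t j.succ.succ,
    fun y x ξ => g (Fin.cons y (Fin.cons x ξ)), fun y x ξ hy hx hξ h1 h2 => ?_,
    fun w ξ hw hwb hξ h1 h2 => ?_⟩
  · refine (h _ (hmem y x ξ hy hx hξ h1 h2)).congr_fun fun t => ?_
    simp [Fin.prod_univ_succ, mul_assoc]
  · refine (hg _ (hmem w (w - b) ξ hw (sub_ne_zero.2 hwb) hξ h1 h2) ?_).trans ?_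
    · rw [← Fin.succ_zero_eq_one]
      simp
    · simp

theorem zpow_le_add {r a s : ℝ} (hr : 0 < r) (hra : r ≤ a) (has : a ≤ s) (e : ℤ) :
    a ^ e ≤ r ^ e + s ^ e := by
  rcases le_or_gt 0 e with he | he
  · exact (zpow_le_zpow_left₀ he (hr.le.trans hra) has).trans
      (le_add_of_nonneg_left (zpow_nonneg hr.le _))
  · have : a ^ e ≤ r ^ e := by
      obtain ⟨n, rfl⟩ : ∃ n : ℕ, e = -n := ⟨(-e).toNat, by omega⟩
      rw [zpow_neg, zpow_neg, zpow_natCast, zpow_natCast]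
      exact inv_anti₀ (pow_pos hr _) (pow_le_pow_left₀ hr.le hra _)
    exact this.trans (le_add_of_nonneg_right (zpow_nonneg (hr.le.trans (hra.trans has)) _))

/-- A Laurent series in `w` and `w - b` is holomorphic. -/
theorem differentiableOn_of_hasSum {T : Type*} {d : T → ℂ} {e₁ e₂ : T → ℤ} {h : ℂ → ℂ → ℂ}
    (hs : ∀ y x : ℂ, y ≠ 0 → x ≠ 0 → HasSum (fun t => d t * (y ^ e₁ t * x ^ e₂ t)) (h y x))
    (b : ℂ) : DifferentiableOn ℂ (fun w => h w (w - b)) {0, b}ᶜ := by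
  intro w hw
  simp only [Set.mem_compl_iff, Set.mem_insert_iff, Set.mem_singleton_iff, not_or] at hw
  obtain ⟨hw0, hwb⟩ := hw
  have hy : 0 < ‖w‖ := norm_pos_iff.2 hw0
  have hx : 0 < ‖w - b‖ := norm_pos_iff.2 (sub_ne_zero.2 hwb)
  set r := ‖w‖ with hr
  set s := ‖w - b‖ with hs'
  set U : Set ℂ := {v | r / 2 < ‖v‖ ∧ ‖v‖ < 2 * r ∧ s / 2 < ‖v - b‖ ∧ ‖v - b‖ < 2 * s} with hU
  have hcont : Continuous fun v : ℂ => ‖v - b‖ := by fun_prop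
  have hUo : IsOpen U := by
    refine (isOpen_lt continuous_const continuous_norm).inter
      ((isOpen_lt continuous_norm continuous_const).inter
      ((isOpen_lt continuous_const hcont).inter (isOpen_lt hcont continuous_const)))
  have hwU : w ∈ U := ⟨by linarith, by linarith, by linarith, by linarith⟩
  have hsum : ∀ r s : ℝ, 0 < r → 0 < s → Summable fun t => ‖d t‖ * (r ^ e₁ t * s ^ e₂ t) := by
    intro r s hr hs''
    have := (hs (r : ℂ) (s : ℂ) (by exact_mod_cast hr.ne') (by exact_mod_cast hs''.ne')).summable.norm
    simpa [norm_mul, norm_zpow, abs_of_pos hr, abs_of_pos hs''] using this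
  -- On `U` the moduli of v and v - b lie in [r/2, 2r] and [s/2, 2s]. By `zpow_le_add` a power of
  -- either sign is at most the sum of its values at the two ends, which gives a summable majorant.
  have hu : Summable fun t => ‖d t‖ *
      (((r / 2) ^ e₁ t + (2 * r) ^ e₁ t) * ((s / 2) ^ e₂ t + (2 * s) ^ e₂ t)) := by
    have h1 := ((hsum (r / 2) (s / 2) (by linarith) (by linarith)).add
      (hsum (r / 2) (2 * s) (by linarith) (by linarith))).add
      ((hsum (2 * r) (s / 2) (by linarith) (by linarith)).add
      (hsum (2 * r) (2 * s) (by linarith) (by linarith)))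
    refine h1.congr fun t => ?_
    ring
  have h2 : DifferentiableOn ℂ (fun v => ∑' t, d t * (v ^ e₁ t * (v - b) ^ e₂ t)) U := by
    refine Complex.differentiableOn_tsum_of_summable_norm hu (fun t v hv => ?_) hUo fun t v hv => ?_
    · have hv0 : v ≠ 0 := norm_pos_iff.1 ((by linarith : 0 < r / 2).trans hv.1)
      have hvb : v - b ≠ 0 := norm_pos_iff.1 ((by linarith : 0 < s / 2).trans hv.2.2.1)
      exact (((differentiableAt_id.zpow (Or.inl hv0)).mul
        ((differentiableAt_id.sub_const b).zpow (Or.inl hvb))).const_mul _).differentiableWithinAt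
    · rw [norm_mul, norm_mul, norm_zpow, norm_zpow]
      have e1 := zpow_le_add (by linarith : 0 < r / 2) hv.1.le hv.2.1.le (e₁ t)
      have e2 := zpow_le_add (by linarith : 0 < s / 2) hv.2.2.1.le hv.2.2.2.le (e₂ t)
      gcongr
  have h3 : DifferentiableAt ℂ (fun w => h w (w - b)) w := by
    refine (h2.differentiableAt (hUo.mem_nhds hwU)).congr_of_eventuallyEq ?_
    filter_upwards [hUo.mem_nhds hwU] with v hv
    have hv0 : v ≠ 0 := norm_pos_iff.1 ((by linarith : 0 < r / 2).trans hv.1)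
    have hvb : v - b ≠ 0 := norm_pos_iff.1 ((by linarith : 0 < s / 2).trans hv.2.2.1)
    exact (hs v (v - b) hv0 hvb).tsum_eq.symm
  exact h3.differentiableWithinAt

theorem eq_of_differentiableOn_compl {f g : ℂ → ℂ} {b : ℂ} (hf : DifferentiableOn ℂ f {0, b}ᶜ)
    (hg : DifferentiableOn ℂ g {0, b}ᶜ) (h : ∀ w, ‖b‖ < ‖w‖ → f w = g w) {w : ℂ} (hw : w ≠ 0)
    (hwb : w ≠ b) : f w = g w := by
  have hfin : ({0, b} : Set ℂ).Finite := Set.toFinite _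
  have hopen : IsOpen ({0, b} : Set ℂ)ᶜ := hfin.isClosed.isOpen_compl
  have hconn : IsPreconnected ({0, b} : Set ℂ)ᶜ :=
    (hfin.countable.isConnected_compl_of_one_lt_rank (by simp)).isPreconnected
  have hmem : ∀ w : ℂ, ‖b‖ < ‖w‖ → w ∈ ({0, b} : Set ℂ)ᶜ := by
    intro w hw
    simp only [Set.mem_compl_iff, Set.mem_insert_iff, Set.mem_singleton_iff, not_or]
    refine ⟨?_, ?_⟩ <;> rintro rfl
    · simp at hw
      exact absurd hw (norm_nonneg _).not_gt
    · exact lt_irrefl _ hw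
  have hn : ‖b‖ < ‖((‖b‖ + 1 : ℝ) : ℂ)‖ := by
    rw [Complex.norm_real, Real.norm_of_nonneg (by positivity)]
    linarith
  refine (hf.analyticOnNhd hopen).eqOn_of_preconnected_of_eventuallyEq (hg.analyticOnNhd hopen)
    hconn (hmem _ hn) ?_ (by simp [hw, hwb])
  filter_upwards [(isOpen_lt continuous_const continuous_norm).mem_nhds hn] with v hv using h v hv

end RationalExpansions

/-! ### The residue formula. -/

section ResidueFormula

variable {V : ℤ → Type u} [∀ n, AddCommGroup (V n)] [∀ n, Module ℂ (V n)] {I : Type v}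

/-- The graded dual is stable under adjoints of homogeneous operators, so in an induction on the
number of fields the leftmost mode can be absorbed into v'. -/
theorem exists_pair_comp {h : ℤ} {a : ℤ → Module.End ℂ (Space V)} (ha : Homog (gr V) h a) (n : ℤ)
    (v' : GDual V) : ∃ w' : GDual V, ∀ x, pair w' (incl x) = pair v' (incl (a n x)) := by
  induction v' using gdual_induction with
  | h0 => exact ⟨0, by simp⟩
  | hadd v' w' hv hw =>
    obtain ⟨v₁, h₁⟩ := hv
    obtain ⟨w₁, h₂⟩ := hw
    exact ⟨v₁ + w₁, fun x => by simp [h₁, h₂]⟩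
  | h m l =>
    refine ⟨DirectSum.lof ℂ ℤ _ (m - h + 2 * n + 2) (l.comp ((DirectSum.component ℂ ℤ V m).comp
      ((a n).comp (DirectSum.lof ℂ ℤ V (m - h + 2 * n + 2))))), fun x => ?_⟩
    rw [pair_lof, pair_lof]
    have h1 := congrArg (fun y : Space V => l (y m)) (ha.proj_comm n m x)
    have h2 : (proj m (incl (a n x)) : Space V) m = (a n x) m := DirectSum.lof_apply (R := ℂ) m _
    simp only [h2] at h1
    exact h1.symm

variable {vac : V 0} {φ : I → ℂ → Space V →ₗ[ℂ] Compl V} {wt : I → ℤ} {D : Space V →ₗ[ℂ] Space V}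

theorem modeProd_mem_gr {k : ℕ} (i : Fin k → I) (m : Fin k → ℤ) :
    ∃ g, modeProd φ wt i m (vacuum vac) ∈ gr V g := by
  induction k with
  | zero => exact ⟨0, by rw [modeProd_zero]; exact vacuum_mem_gr vac⟩
  | succ k ih =>
    obtain ⟨g, hg⟩ := ih (Fin.tail i) (Fin.tail m)
    exact ⟨_, by rw [modeProd_succ]; exact modes_homog φ wt (i 0) (m 0) g _ _ hg rfl⟩

theorem iterResidue_const_mul {k : ℕ} {T : Type*} [Countable T] {d : T → ℂ} {e : T → Fin k → ℤ}
    {f : (Fin k → ℂ) → ℂ} {ρ : ℝ} (hρ : 0 < ρ)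
    (h : ∀ ξ ∈ region k, (∀ j, ‖ξ j‖ < ρ) → HasSum (fun t => d t * ∏ j, ξ j ^ e t j) (f ξ))
    (m : Fin k → ℤ) (c : ℂ) : iterResidue k (fun ξ => (∏ j, ξ j ^ m j) * (c * f ξ)) =
      c * iterResidue k fun ξ => (∏ j, ξ j ^ m j) * f ξ := by
  have h1 := (hasSum_coeff hρ h m).mul_left c
  have h2 := hasSum_coeff (d := fun t => c * d t) (e := e) (f := fun ξ => c * f ξ) hρ
    (fun ξ hξ hb => ((h ξ hξ hb).mul_left c).congr_fun fun t => by ring) m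
  refine h2.unique (h1.congr_fun fun t => ?_)
  simp

theorem hasSum_circle_coeff {T : Type*} [Countable T] {w : T → ℂ} {e : T → ℤ} {g : ℂ → ℂ} {r : ℝ}
    (hr : 0 < r) (h : ∀ x, ‖x‖ = r → HasSum (fun t => w t * x ^ e t) (g x)) (n : ℤ) :
    HasSum (fun t => if e t = -n - 1 then w t else 0)
      ((2 * (Real.pi : ℂ) * Complex.I)⁻¹ * circleIntegral (fun x => x ^ n * g x) 0 r) := by
  have h1 := hasSum_circleIntegral (w := w) (e := fun t => e t + n) (g := fun x => x ^ n * g x) hr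
    fun x hx => ((h x hx).mul_left (x ^ n)).congr_fun fun t => by
      have : x ≠ 0 := by rintro rfl; simp at hx; exact hr.ne hx
      rw [zpow_add₀ this]; ring
  refine h1.congr_fun fun t => ?_
  exact if_congr (by omega) rfl rfl

/-- The coefficients of the expansion of a product of `k + 1` fields in powers of the first
variable. -/
theorem productHasSum_coeff {k : ℕ} {i : Fin (k + 1) → I} {v' w' : GDual V} {x : Space V}
    {f : (Fin (k + 1) → ℂ) → ℂ} {c : ℤ → (Fin k → ℂ) → ℂ} {n : ℤ}
    (hw : ∀ x, pair w' (incl x) = pair v' (incl (modes φ wt (i 0) n x)))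
    (hf : ∀ z ∈ region (k + 1), ProductHasSum φ wt i v' x z (f z))
    (hc : ∀ z ∈ config k, ∀ z₁ : ℂ, z₁ ≠ 0 → (∀ j, ‖z j‖ < ‖z₁‖) →
      HasSum (fun n => c n z * z₁ ^ (-n - 1)) (f (Fin.cons z₁ z)))
    {z : Fin k → ℂ} (hz : z ∈ region k) : ProductHasSum φ wt (Fin.tail i) w' x z (c n z) := by
  -- A radius exceeding every ‖z j‖, so that the first variable dominates on the circle.
  set r : ℝ := 1 + ∑ j, ‖z j‖ with hr
  have hr0 : 0 < r := by positivity
  have hrj : ∀ j, ‖z j‖ < r := fun j => by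
    have := Finset.single_le_sum (f := fun j => ‖z j‖) (fun j _ => norm_nonneg _)
      (Finset.mem_univ j)
    linarith
  have hne : ∀ y : ℂ, ‖y‖ = r → y ≠ 0 := by
    rintro y hy rfl
    rw [norm_zero] at hy
    exact hr0.ne hy
  have h1 := hasSum_circle_coeff (g := fun y => f (Fin.cons y z)) hr0 (fun y hy =>
    hc z (region_subset_config k hz) y (hne y hy) fun j => by rw [hy]; exact hrj j) n
  have h2 := hasSum_circle_coeff (T := Fin (k + 1) → ℤ)
    (w := fun t => pair v' (incl (modeProd φ wt i t x)) * ∏ j : Fin k, z j ^ (-t j.succ - 1))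
    (e := fun t => -t 0 - 1) (g := fun y => f (Fin.cons y z)) hr0 (fun y hy => by
      refine HasSum.congr_fun (hf (Fin.cons y z) (cons_mem_region (hne y hy) hz fun j => by
        rw [hy]; exact hrj j)) fun t => ?_
      simp only [Fin.prod_univ_succ, Fin.cons_zero, Fin.cons_succ]
      ring) n
  have h3 : HasSum (fun t : ℤ => if -t - 1 = -n - 1 then c t z else 0) (c n z) := by
    refine (hasSum_ite_eq n (c n z)).congr_fun fun t => ?_
    by_cases ht : t = n
    · subst ht; simp
    · rw [if_neg ht, if_neg (by omega)]
  rw [h1.unique h3] at h2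
  have hinj : Function.Injective fun t : Fin k → ℤ => (Fin.cons n t : Fin (k + 1) → ℤ) :=
    Fin.cons_right_injective (α := fun _ => ℤ) n
  rw [← hinj.hasSum_iff] at h2
  · refine HasSum.congr_fun h2 fun t => ?_
    simp only [Function.comp_apply, Fin.cons_zero, if_true, Fin.cons_succ, hw, modeProd_succ,
      Fin.tail_cons]
  · intro t ht
    refine if_neg fun h0 => ht ⟨Fin.tail t, ?_⟩
    have : t 0 = n := by omega
    rw [← this]
    exact Fin.cons_self_tail t

theorem add_const_mem_config {k : ℕ} {ξ : Fin k → ℂ} {b : ℂ} (hξ : ξ ∈ region k)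
    (h : ∀ j, ‖ξ j‖ < ‖b‖) : (fun j => ξ j + b) ∈ config k := by
  refine ⟨fun j h0 => ?_, fun j l hjl => (region_subset_config k hξ).2 (add_right_cancel hjl)⟩
  have := h j
  rw [eq_neg_of_add_eq_zero_left h0, norm_neg] at this
  exact lt_irrefl _ this

/-- The residues of the expansion in powers of the first variable. -/
theorem hasSum_iterResidue_coeff {k : ℕ} {f : (Fin (k + 1) → ℂ) → ℂ} (hf : IsRational f)
    {c : ℤ → (Fin k → ℂ) → ℂ} (hc : ∀ z ∈ config k, ∀ z₁ : ℂ, z₁ ≠ 0 → (∀ j, ‖z j‖ < ‖z₁‖) →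
      HasSum (fun n => c n z * z₁ ^ (-n - 1)) (f (Fin.cons z₁ z))) {b : ℂ} (hb : b ≠ 0)
    (m : Fin k → ℤ) {w : ℂ} (hw : ‖b‖ < ‖w‖) :
    HasSum (fun n : ℤ => iterResidue k (fun ξ => (∏ j, ξ j ^ m j) * c n fun j => ξ j + b) *
        w ^ (-n - 1))
      (iterResidue k fun ξ => (∏ j, ξ j ^ m j) * f (Fin.cons w fun j => ξ j + b)) := by
  obtain ⟨T, hT, d, e, h⟩ := hf.expandable_outer hb
  have hb0 : 0 < ‖b‖ := norm_pos_iff.2 hb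
  have hA := hasSum_coeff (d := fun t => d t * w ^ e t 0) (e := fun t j => e t (Fin.succ j))
    (f := fun ξ => f (Fin.cons w fun j => ξ j + b)) (ρ := min ‖b‖ (‖w‖ - ‖b‖))
    (lt_min hb0 (sub_pos.2 hw)) (fun ξ hξ h1 => h w ξ hξ
      (fun j => (h1 j).trans_le (min_le_left _ _)) (fun j => by
        have := (h1 j).trans_le (min_le_right _ _)
        linarith) hw) m
  -- The joint expansion in w and ξ is grouped by the exponent of w. That each group is the residue
  -- of `c n` is checked on the circle of radius 3‖b‖, where both expansions hold because ‖ξ j‖ <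
  -- ‖b‖.
  refine hasSum_fiberwise (κ := fun t => -e t 0 - 1) hA fun n => ?_
  have hB := hasSum_coeff (d := fun t => if e t 0 = -n - 1 then d t else 0)
    (e := fun t j => e t (Fin.succ j)) (f := fun ξ => c n fun j => ξ j + b) hb0 (fun ξ hξ h1 => by
      have h3 : ∀ y : ℂ, ‖y‖ = 3 * ‖b‖ → y ≠ 0 := fun y hy => norm_pos_iff.1 (by rw [hy]; positivity)
      have h4 : ∀ j, ‖ξ j + b‖ < 3 * ‖b‖ := fun j => by
        have := norm_add_le (ξ j) b
        have := h1 j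
        linarith
      have e1 := hasSum_circle_coeff (g := fun y => f (Fin.cons y fun j => ξ j + b))
        (r := 3 * ‖b‖) (by positivity) (fun y hy => hc _ (add_const_mem_config hξ h1) y (h3 y hy)
          fun j => by rw [hy]; exact h4 j) n
      have e2 := hasSum_circle_coeff (w := fun t => d t * ∏ j, ξ j ^ e t (Fin.succ j))
        (e := fun t => e t 0) (g := fun y => f (Fin.cons y fun j => ξ j + b))
        (r := 3 * ‖b‖) (by positivity) (fun y hy => (h y ξ hξ h1 (fun j => by
          rw [hy]; have := h1 j; linarith) (by rw [hy]; linarith)).congr_fun fun t => by ring) n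
      have e3 : HasSum (fun t : ℤ => if -t - 1 = -n - 1 then c t fun j => ξ j + b else 0)
          (c n fun j => ξ j + b) := by
        refine (hasSum_ite_eq n (c n fun j => ξ j + b)).congr_fun fun t => ?_
        by_cases ht : t = n
        · subst ht; simp
        · rw [if_neg ht, if_neg (by omega)]
      rw [e1.unique e3] at e2
      refine e2.congr_fun fun t => ?_
      split_ifs <;> simp) m
  refine (hB.mul_right (w ^ (-n - 1))).congr_fun fun t => ?_
  by_cases ht : e t 0 = -n - 1
  · rw [if_pos (by omega), if_pos ht, ht]
    split_ifs <;> simp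
  · rw [if_neg (by omega), if_neg ht]
    simp

namespace GeneratingFields

variable (H : GeneratingFields vac φ wt D)

include H

/-- The residue formula for the vertex operators. -/
theorem iterResidue_eq {k : ℕ} (i : Fin k → I) (m : Fin k → ℤ) (v' : GDual V) (x : Space V)
    {b : ℂ} (hb : b ≠ 0) {f : (Fin k → ℂ) → ℂ} (hf : IsRational f)
    (hs : ∀ z ∈ region k, ProductHasSum φ wt i v' x z (f z)) :
    iterResidue k (fun ξ => (∏ j, ξ j ^ m j) * f fun j => ξ j + b) =
      pair v' (H.generatingModes.vertexMap b (modeProd φ wt i m (vacuum vac)) x) := by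
  set G := H.generatingModes with hG
  induction k generalizing v' with
  | zero =>
    have h1 := hs Fin.elim0 ⟨fun j => j.elim0, fun j => j.elim0⟩
    unfold ProductHasSum at h1
    have h2 := hasSum_unique fun n : Fin 0 → ℤ => pair v' (incl (modeProd φ wt i n x)) *
      ∏ j, (Fin.elim0 : Fin 0 → ℂ) j ^ (-n j - 1)
    have h3 := h1.unique h2
    rw [modeProd_zero, Fin.prod_univ_zero, mul_one] at h3
    rw [modeProd_zero, G.vertexMap_vacuum, iterResidue, Fin.prod_univ_zero, one_mul, ← h3]
    congr 1
    exact funext fun j => j.elim0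
  | succ k ih =>
    obtain ⟨c, hcr, hc⟩ := hf.exists_firstExpansion
    set u := modeProd φ wt (Fin.tail i) (Fin.tail m) (vacuum vac) with hu
    obtain ⟨g, hug⟩ := modeProd_mem_gr (vac := vac) (φ := φ) (wt := wt) (Fin.tail i) (Fin.tail m)
    rw [← hu] at hug
    set u₁ := modes φ wt (i 0) (-1) (vacuum vac) with hu₁
    have hu₁g : u₁ ∈ gr V (wt (i 0)) := G.vec_mem (G.gen_mem (i 0))
    have hst : G.state u₁ = modes φ wt (i 0) := G.state_gen (i 0)
    obtain ⟨N, X, hX, h1, -, h3⟩ := G.exists_twoPoint hu₁g hug v' x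
    rw [hst] at h1 h3
    -- `A` is the two-point function of the first field at w and the vertex operator of u at b. `C`
    -- is what the residues in the remaining variables leave of the correlator, where w = ξ₁ + b.
    set A : ℂ → ℂ := fun w => lp X w b / (w - b) ^ N with hA
    set C : ℂ → ℂ := fun w => iterResidue k fun ξ => (∏ j, ξ j ^ Fin.tail m j) *
      f (Fin.cons w fun j => ξ j + b) with hC
    have hb0 : 0 < ‖b‖ := norm_pos_iff.2 hb
    -- Both are expanded in powers of w, and the coefficients agree by the induction hypothesis for
    -- v' composed with the n-th mode of the first field.
    have houter : ∀ w, ‖b‖ < ‖w‖ → C w = A w := by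
      intro w hw
      have e1 := hasSum_iterResidue_coeff hf hc hb (Fin.tail m) hw
      refine e1.unique ?_
      refine (h1 w b hb hw).prod_fiberwise fun n => ?_
      obtain ⟨w', hw'⟩ := exists_pair_comp (modes_homog φ wt (i 0)) n v'
      rw [ih (Fin.tail i) (Fin.tail m) w' (hcr n) fun z hz => productHasSum_coeff hw' hs hc hz]
      refine (((G.vertexMap_finExp w' u x).hasSum hb).mul_right (w ^ (-n - 1))).congr_fun
        fun q => ?_
      rw [hw', mon₂]
      ring
    obtain ⟨T, hT, d, e₁, e₂, e, gg, hgs, hgf⟩ := hf.expandable_inner hb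
    have hCs : ∀ y x : ℂ, y ≠ 0 → x ≠ 0 → HasSum (fun t => (if ∀ j, e t j + Fin.tail m j = -1 then
        d t else 0) * (y ^ e₁ t * x ^ e₂ t))
        (iterResidue k fun ξ => (∏ j, ξ j ^ Fin.tail m j) * gg y x ξ) := by
      intro y x hy hx
      refine (hasSum_coeff (lt_min hb0 (norm_pos_iff.2 hx)) (fun ξ hξ h => hgs y x ξ hy hx hξ
        (fun j => (h j).trans_le (min_le_left _ _)) fun j => (h j).trans_le (min_le_right _ _))
        (Fin.tail m)).congr_fun fun t => ?_
      split_ifs <;> simp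
    have hCg : ∀ w, w ≠ 0 → w ≠ b → ∃ ρ > 0, ∀ ξ ∈ region k, (∀ j, ‖ξ j‖ < ρ) →
        HasSum (fun t => d t * (w ^ e₁ t * (w - b) ^ e₂ t) * ∏ j, ξ j ^ e t j)
          (f (Fin.cons w fun j => ξ j + b)) := by
      intro w hw hwb
      have hwb' := sub_ne_zero.2 hwb
      refine ⟨min ‖b‖ ‖w - b‖, lt_min hb0 (norm_pos_iff.2 hwb'), fun ξ hξ h => ?_⟩
      have e1 : ∀ j, ‖ξ j‖ < ‖b‖ := fun j => (h j).trans_le (min_le_left _ _)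
      have e2 : ∀ j, ‖ξ j‖ < ‖w - b‖ := fun j => (h j).trans_le (min_le_right _ _)
      rw [← hgf w ξ hw hwb hξ e1 e2]
      exact hgs w (w - b) ξ hw hwb' hξ e1 e2
    -- Analytic continuation to w near b, where the outermost residue is taken.
    have hCA : ∀ w, w ≠ 0 → w ≠ b → C w = A w := by
      intro w hw hwb
      refine eq_of_differentiableOn_compl (b := b) ?_ ?_ houter hw hwb
      · refine (differentiableOn_of_hasSum hCs b).congr fun w hw => ?_
        simp only [Set.mem_compl_iff, Set.mem_insert_iff, Set.mem_singleton_iff, not_or] at hw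
        obtain ⟨ρ, hρ, h⟩ := hCg w hw.1 hw.2
        refine (hasSum_coeff hρ h (Fin.tail m)).unique ?_
        refine (hCs w (w - b) hw.1 (sub_ne_zero.2 hw.2)).congr_fun fun t => ?_
        split_ifs <;> simp
      · intro w hw
        simp only [Set.mem_compl_iff, Set.mem_insert_iff, Set.mem_singleton_iff, not_or] at hw
        refine DifferentiableAt.differentiableWithinAt ?_
        refine (hasDerivAt_lp hX hw.1 b).differentiableAt.div
          ((differentiableAt_id.sub_const b).pow N) (pow_ne_zero _ (sub_ne_zero.2 hw.2))
    -- Near b, associativity expands `A` in powers of y = w - b, and the residue against y^{m 0}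
    -- selects the coefficient n = m 0.
    have hres : HasSum (fun n : ℤ => if m 0 - n - 1 = -1 then pair v' (G.vertexMap b
        (modes φ wt (i 0) n u) x) else 0) (iterResidue (k + 1)
          (fun ξ => (∏ j, ξ j ^ m j) * f fun j => ξ j + b)) := by
      refine hasSum_residue (ρ := ‖b‖) hb0 fun y hy hyb => ?_
      have hyb0 : y + b ≠ 0 := by
        intro h0
        rw [eq_neg_of_add_eq_zero_left h0, norm_neg] at hyb
        exact lt_irrefl _ hyb
      have hyb1 : y + b ≠ b := by simpa using hy
      obtain ⟨ρ, hρ, h⟩ := hCg (y + b) hyb0 hyb1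
      have e1 : (fun ξ : Fin k → ℂ => (∏ j, (Fin.cons y ξ : Fin (k + 1) → ℂ) j ^ m j) *
          f fun j => (Fin.cons y ξ : Fin (k + 1) → ℂ) j + b) = fun ξ => (∏ j, ξ j ^ Fin.tail m j) *
          (y ^ m 0 * f (Fin.cons (y + b) fun j => ξ j + b)) := by
        funext ξ
        have : (fun j => (Fin.cons y ξ : Fin (k + 1) → ℂ) j + b) =
            Fin.cons (y + b) fun j => ξ j + b := by
          funext j
          refine Fin.cases ?_ (fun j => ?_) j <;> simp
        rw [this, Fin.prod_univ_succ]
        simp only [Fin.cons_zero, Fin.cons_succ, Fin.tail]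
        ring
      rw [e1, iterResidue_const_mul hρ h]
      change HasSum _ (y ^ m 0 * C (y + b))
      rw [hCA _ hyb0 hyb1]
      refine ((h3 (y + b) b hyb1 (by simpa using hyb)).mul_left (y ^ m 0)).congr_fun fun n => ?_
      rw [add_sub_cancel_right, show m 0 - n - 1 = m 0 + (-n - 1) by ring, zpow_add₀ hy]
      ring
    rw [modeProd_succ]
    refine hres.unique ((hasSum_ite_eq (m 0) (pair v' (G.vertexMap b
      (modes φ wt (i 0) (m 0) u) x))).congr_fun fun n => ?_)
    by_cases hn : n = m 0
    · subst hn; simp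
    · rw [if_neg hn, if_neg (by omega)]

theorem residueFormula : ResidueFormula vac φ wt H.generatingModes.vertexMap := by
  intro k i m v' x z hz
  obtain ⟨h1, h2⟩ := H.correlator_spec i v' x
  exact (H.iterResidue_eq i m v' x hz h1 h2).symm

end GeneratingFields

end ResidueFormula

/-! ### Uniqueness, generation and the case of integral weights. -/

section Uniqueness

variable {V : ℤ → Type u} [∀ n, AddCommGroup (V n)] [∀ n, Module ℂ (V n)] {I : Type v}
  {vac : V 0} {φ : I → ℂ → Space V →ₗ[ℂ] Compl V} {wt : I → ℤ} {D : Space V →ₗ[ℂ] Space V}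

theorem exists_hasParity {h : ℤ} {x : Space V} (hx : x ∈ gr V h) : ∃ p : Fin 2, HasParity p x := by
  rcases Int.emod_two_eq_zero_or_one h with h0 | h0
  · exact ⟨0, fun n hn => hx n fun e => hn (by rw [e, h0]; rfl)⟩
  · exact ⟨1, fun n hn => hx n fun e => hn (by rw [e, h0]; rfl)⟩

theorem mode_zero (w n : ℤ) : mode w (0 : Space V →ₗ[ℂ] Compl V) n = 0 := by
  refine DirectSum.linearMap_ext ℂ fun m => LinearMap.ext fun x => ?_
  simp [mode, DirectSum.toModule_lof]

theorem vertexMode_of_mem {Y : ℂ → Space V →ₗ[ℂ] Space V →ₗ[ℂ] Compl V} {h : ℤ} {u : Space V}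
    (hu : u ∈ gr V h) (n : ℤ) (x : Space V) : vertexMode Y n u x = mode h (Y 1 u) n x := by
  rw [vertexMode, finsum_eq_single _ h, proj_incl_of_mem hu]
  intro a ha
  rw [proj_incl, hu a ha, map_zero, map_zero, mode_zero, LinearMap.zero_apply]

namespace GeneratingFields

variable (H : GeneratingFields vac φ wt D)

include H

theorem eq_of_modeProd {W : Type*} [AddCommGroup W] [Module ℂ W] {A B : Space V →ₗ[ℂ] W}
    (h : ∀ (k : ℕ) (i : Fin k → I) (m : Fin k → ℤ),
      A (modeProd φ wt i m (vacuum vac)) = B (modeProd φ wt i m (vacuum vac))) : A = B := by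
  refine LinearMap.ext_on H.spanning ?_
  rintro x ⟨k, i, m, rfl⟩
  exact h k i m

theorem eq_of_residueFormula {Y Y' : ℂ → Space V →ₗ[ℂ] Space V →ₗ[ℂ] Compl V}
    (hY : ResidueFormula vac φ wt Y) (hY' : ResidueFormula vac φ wt Y') {z : ℂ} (hz : z ≠ 0) :
    Y' z = Y z := by
  refine H.eq_of_modeProd fun k i m => LinearMap.ext fun x => compl_ext fun v' => ?_
  rw [hY k i m v' x z hz, hY' k i m v' x z hz]

/-- Induction on the length of the spanning vectors. If the vertex operators of u₁ = φ^i_{-1} 𝟏 and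
of u agree in both structures, so do their products, hence the rational functions of duality, hence
the iterates. The coefficients of the iterates in powers of z₁ - z₂ are the vertex operators of the
vectors φ^i_n u. -/
theorem eq_vertexMap {Y : ℂ → Space V →ₗ[ℂ] Space V →ₗ[ℂ] Compl V}
    (hY : IsVertexSuperalgebra vac Y)
    (hφ : ∀ i, ∀ z : ℂ, z ≠ 0 → Y z (modes φ wt i (-1) (vacuum vac)) = φ i z) {z : ℂ}
    (hz : z ≠ 0) : Y z = H.generatingModes.vertexMap z := by
  set G := H.generatingModes with hG
  refine H.eq_of_modeProd fun k i m => ?_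
  induction k generalizing z with
  | zero =>
    rw [modeProd_zero]
    refine LinearMap.ext fun x => ?_
    rw [hY.identity x z hz, G.vertexMap_vacuum]
  | succ k ih =>
    rw [modeProd_succ]
    set u := modeProd φ wt (Fin.tail i) (Fin.tail m) (vacuum vac) with hu
    obtain ⟨g, hug⟩ := modeProd_mem_gr (vac := vac) (φ := φ) (wt := wt) (Fin.tail i) (Fin.tail m)
    rw [← hu] at hug
    have hu' : ∀ z : ℂ, z ≠ 0 → Y z u = G.vertexMap z u := fun z hz => ih hz _ _
    set u₁ := modes φ wt (i 0) (-1) (vacuum vac) with hu₁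
    have hu₁g : u₁ ∈ gr V (wt (i 0)) := G.vec_mem (G.gen_mem (i 0))
    have hu₁' : ∀ z : ℂ, z ≠ 0 → Y z u₁ = G.vertexMap z u₁ := fun z hz => by
      rw [hφ (i 0) z hz, H.vertexMap_gen (i 0) hz]
    obtain ⟨p₁, hp₁⟩ := exists_hasParity hu₁g
    obtain ⟨p₂, hp₂⟩ := exists_hasParity hug
    refine LinearMap.ext fun x => compl_ext fun v' => ?_
    obtain ⟨f, hf, h1, -, h3⟩ := hY.duality p₁ p₂ u₁ u x v' hp₁ hp₂
    obtain ⟨f', hf', h1', -, h3'⟩ := G.duality p₁ p₂ u₁ u x v' hp₁ hp₂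
    have hff : ∀ w ∈ config 2, f w = f' w := by
      refine hf.eq_of_region hf' fun w hw => ?_
      have hw01 : ‖w 1‖ < ‖w 0‖ := hw.2 (by decide : (0 : Fin 2) < 1)
      have hw1 : 0 < ‖w 1‖ := norm_pos_iff.2 (hw.1 1)
      have e1 := h1 (w 0) (w 1) hw01 hw1
      have e2 := h1' (w 0) (w 1) hw01 hw1
      rw [hu' _ (hw.1 1), hu₁' _ (hw.1 0)] at e1
      have e3 := e1.unique e2
      have e4 : ![w 0, w 1] = w := by ext j; fin_cases j <;> rfl
      rwa [e4] at e3
    have hexp : ∀ (Y : ℂ → Space V →ₗ[ℂ] Space V →ₗ[ℂ] Compl V) (ξ s : ℂ), ξ ≠ 0 →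
        Y ξ u₁ = G.vertexMap ξ u₁ →
        HasSum (fun n : ℤ => pair v' (Y z (proj n (Y ξ u₁ u)) x)) s →
        HasSum (fun n : ℤ => pair v' (Y z (modes φ wt (i 0) n u) x) * ξ ^ (-n - 1)) s := by
      intro Y ξ s hξ hY₁ hs
      rw [hY₁, H.vertexMap_gen (i 0) hξ, H.eq_fieldAt (i 0) hξ] at hs
      exact ((modes_homog φ wt (i 0)).hasSum_proj hug ξ ((pair v').comp ((Y z).flip x)) s).1 hs
    have hb : ∀ ξ : ℂ, ‖ξ‖ < ‖z‖ → ξ ≠ 0 → ‖ξ + z - z‖ < ‖z‖ ∧ 0 < ‖ξ + z - z‖ := by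
      intro ξ h h0
      rw [add_sub_cancel_right]
      exact ⟨h, norm_pos_iff.2 h0⟩
    refine congrFun (eq_of_hasSum_laurent
      (c := fun n => pair v' (Y z (modes φ wt (i 0) n u) x))
      (c' := fun n => pair v' (G.vertexMap z (modes φ wt (i 0) n u) x))
      (f := fun ξ => f ![ξ + z, z]) (norm_pos_iff.2 hz)
      (fun ξ hξ hξz => ?_) fun ξ hξ hξz => ?_) (m 0)
    · have e := h3 (ξ + z) z (hb ξ hξz hξ).1 (hb ξ hξz hξ).2
      rw [add_sub_cancel_right] at e
      exact hexp Y ξ _ hξ (hu₁' ξ hξ) e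
    · have e := h3' (ξ + z) z (hb ξ hξz hξ).1 (hb ξ hξz hξ).2
      rw [add_sub_cancel_right] at e
      beta_reduce
      rw [hff _ (mem_config_two (fun h0 => ?_) hz (by simpa using hξ))]
      · exact hexp G.vertexMap ξ _ hξ rfl e
      · rw [eq_neg_of_add_eq_zero_left h0, norm_neg] at hξz
        exact lt_irrefl _ hξz

theorem generatedBy : GeneratedBy vac H.generatingModes.vertexMap
    (Set.range fun i => modes φ wt i (-1) (vacuum vac)) := by
  intro W h0 hS hW
  refine H.modes_span W h0 fun i n x hx => ?_
  have h1 := hW _ (hS ⟨i, rfl⟩) x hx n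
  beta_reduce at h1
  rwa [vertexMode_of_mem (H.generatingModes.vec_mem (H.generatingModes.gen_mem i)),
    H.vertexMap_gen i one_ne_zero] at h1

/-- Modes of fields of integral weight preserve V⁰, which contains the vacuum, so V⁰ is all of V. -/
theorem subsingleton_of_even (hwt : ∀ i, Even (wt i)) {n : ℤ} (hn : Odd n) :
    Subsingleton (V n) := by
  have hW := H.modes_span
    { carrier := {x | ∀ m : ℤ, Odd m → x m = 0}
      add_mem' := fun hx hy m hm => by rw [DirectSum.add_apply, hx m hm, hy m hm, add_zero]
      zero_mem' := fun _ _ => rfl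
      smul_mem' := fun c x hx m hm => by rw [DirectSum.smul_apply, hx m hm, smul_zero] }
    (fun m hm => vacuum_mem_gr vac m (by rintro rfl; simp at hm)) (by
      intro i k x hx m hm
      have h1 := (modes_homog φ wt i).proj_comm k m x
      have h2 : Odd (m - wt i + 2 * k + 2) := by
        have := hwt i
        obtain ⟨a, ha⟩ := this
        obtain ⟨c, hc⟩ := hm
        exact ⟨c - a + k + 1, by omega⟩
      rw [proj_incl, proj_incl, hx _ h2, map_zero, map_zero] at h1
      have h3 := congrArg (fun y : Space V => y m) h1
      exact (DirectSum.lof_apply (R := ℂ) m _).symm.trans h3)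
  have h0 : ∀ x : V n, x = 0 := by
    intro x
    have hx : DirectSum.lof ℂ ℤ V n x ∈ (⊤ : Submodule ℂ (Space V)) := trivial
    rw [← hW] at hx
    exact (DirectSum.lof_apply (R := ℂ) n x).symm.trans (hx n hn)
  exact ⟨fun x y => by rw [h0 x, h0 y]⟩

end GeneratingFields

end Uniqueness

end VertexConstruction

end

theorem theorem3p5 {V : ℤ → Type*} [∀ n, AddCommGroup (V n)] [∀ n, Module ℂ (V n)]
    {I : Type*} (vac : V 0)
    (φ : I → ℂ → VertexConstruction.Space V →ₗ[ℂ] VertexConstruction.Compl V) (wt : I → ℤ)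
    (D : VertexConstruction.Space V →ₗ[ℂ] VertexConstruction.Space V)
    (hφ : VertexConstruction.GeneratingFields vac φ wt D) :
    ∃ Y : ℂ → VertexConstruction.Space V →ₗ[ℂ] VertexConstruction.Space V →ₗ[ℂ]
        VertexConstruction.Compl V,
      -- `Y` is the vertex operator map well defined by the residue formula
      VertexConstruction.ResidueFormula vac φ wt Y ∧
      (∀ Y', VertexConstruction.ResidueFormula vac φ wt Y' → ∀ z : ℂ, z ≠ 0 → Y' z = Y z) ∧
      -- it is a grading-restricted vertex superalgebra structure, an algebra for integral weights
      VertexConstruction.IsVertexSuperalgebra vac Y ∧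
      ((∀ i, Even (wt i)) → VertexConstruction.IsVertexAlgebra vac Y) ∧
      -- whose operator `L(-1)` is the given one
      (∀ u v, ∀ z : ℂ, z ≠ 0 → VertexConstruction.HasWeakDeriv (fun w => Y w u v) (Y z (D u) v) z) ∧
      (∀ u, VertexConstruction.HasLimitAtZero
        (fun z => Y z (D u) (VertexConstruction.vacuum vac)) (VertexConstruction.incl (D u))) ∧
      -- generated by the vectors `φ^i_{-1} 𝟏`
      VertexConstruction.GeneratedBy vac Y (Set.range fun i =>
        VertexConstruction.mode (wt i) (φ i 1) (-1) (VertexConstruction.vacuum vac)) ∧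
      -- with vertex operators `φ^i`
      (∀ i, ∀ z : ℂ, z ≠ 0 →
        Y z (VertexConstruction.mode (wt i) (φ i 1) (-1) (VertexConstruction.vacuum vac)) = φ i z) ∧
      -- and it is the only such structure
      ∀ Y', VertexConstruction.IsVertexSuperalgebra vac Y' →
        (∀ i, ∀ z : ℂ, z ≠ 0 →
          Y' z (VertexConstruction.mode (wt i) (φ i 1) (-1) (VertexConstruction.vacuum vac)) =
            φ i z) →
        ∀ z : ℂ, z ≠ 0 → Y' z = Y z := by
  set G := hφ.generatingModes with hG
  refine ⟨G.vertexMap, hφ.residueFormula,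
    fun Y' hY' z hz => hφ.eq_of_residueFormula hφ.residueFormula hY' hz,
    G.isVertexSuperalgebra, fun hwt => ⟨G.isVertexSuperalgebra,
      fun n hn => hφ.subsingleton_of_even hwt hn⟩,
    fun u v z hz => G.vertexMap_hasWeakDeriv u v hz, fun u => G.vertexMap_creation (D u),
    hφ.generatedBy, fun i z hz => hφ.vertexMap_gen i hz,
    fun Y' hY' hgen z hz => hφ.eq_vertexMap hY' hgen hz⟩
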